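/- Let $\mathbb H^d=\mathbb R^{2d}\times\mathbb R$ be the Heisenberg group, with points $(z,s)$, $z=(x,y)$, Lebesgue (Haar) measure, $z\cdot_\sigma z'=x'\cdot y-x\cdot y'$ for $z'=(x',y')$, and group law $(z,s)\cdot(z',s')=(z+z',\,s+s'+z\cdot_\sigma z')$. Let $X_i=\partial_{x_i}+y_i\partial_s$, $Y_i=\partial_{y_i}-x_i\partial_s$, and let $L$ be the closure in $L^2(\mathbb H^d)$ of $\sum_{i=1}^d(X_i^2+Y_i^2)$ on $C_c^\infty(\mathbb H^d)$. Then $L$ is self-adjoint, and there is a unique strongly continuous unitary group $U(\tau)=e^{i\tau L/2}$, $\tau\in\mathbb R$, on $L^2(\mathbb H^d)$ with generator $\tfrac i2L$. For $\tau\ge0$ and a Schwartz function $\psi$ on $\mathbb H^d$ put $$[S(\tau)\psi](z,s)=\frac1{(2\pi i)^d}\int^{o}_{\mathbb R^{2d}}e^{\frac i2|\zeta|^2}\,\psi\bigl(z+\sqrt\tau\,\zeta,\;s+\sqrt\tau\,z\cdot_\sigma\zeta\bigr)\,d\zeta ,$$ where $\int^{o} e^{\frac i2|\zeta|^2}f(\zeta)\,d\zeta$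 denotes $\lim_{\epsilon\downarrow0}\int\varphi(\epsilon\zeta)e^{\frac i2|\zeta|^2}f(\zeta)\,d\zeta$, the regularized integrals being required to converge absolutely and the limit to exist and be the same for all Schwartz functions $\varphi$ on $\mathbb R^{2d}$ with $\varphi(0)=1$. Then: 1. For all $\tau\ge0$, all Schwartz functions $\psi$ and all $(z,s)$, this oscillatory integral exists, and $S(\tau)$ extends uniquely to a bounded operator on $L^2(\mathbb H^d)$, again denoted $S(\tau)$, with $\|S(\tau)\|\le1$. 2. With $\tilde z=(y,-x)$ for $z=(x,y)$, one has $S(\tau)=F^{-1}U_2(\tau)V(\tau)U_1(\tau)F$ for all $\tau\ge 0$, where $F$ is the unitary Fourier transform in $s$, $(F\psi)(z,\alpha)=(2\pi)^{-1/2}\int_{\mathbb R} e^{-i\alpha s}\psi(z,s)\,ds$ for Schwartz $\psi$; $U_1(\tau)$ is the unitary operator given for Schwartz $\chi$ by $$(U_1(\tau)\chi)(z,\alpha)=\int_{\mathbb R^{2d}}e^{i\eta\cdot z}e^{-\frac i2\tau|\eta|^2}\hat\chi(\eta,\alpha)\,d\eta,\qquad \hat\chi(\eta,\alpha)=(2\pi)^{-2d}\int_{\mathbb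 R^{2d}}e^{-i\eta\cdot z}\chi(z,\alpha)\,dz;$$ $V(\tau)$ is the shear $(V(\tau)\chi)(z,\alpha)=\chi(z-\tau\alpha\tilde z,\alpha)$, which is a contraction on $L^2$; and $U_2(\tau)$ is the unitary multiplication operator $(U_2(\tau)\chi)(z,\alpha)=e^{-\frac i2\tau|\alpha\tilde z|^2}\chi(z,\alpha)$. 3. $S$ is Chernoff-equivalent to $(e^{i\tau L/2})_{\tau\ge0}$: for all $\psi\in L^2(\mathbb H^d)$ and $T>0$, $$\lim_{n\to\infty}\ \sup_{t\in[0,T]}\bigl\|S(t/n)^n\psi-e^{itL/2}\psi\bigr\|_{L^2(\mathbb H^d)}=0 .$$ In particular $S(t/n)^n\psi\to e^{itL/2}\psi$ in $L^2(\mathbb H^d)$ for every $t\ge0$. For $\psi\in D(L)$ the function $u(t)=e^{itL/2}\psi$, $t\in\mathbb R$, takes values in $D(L)$, is continuously differentiable in $L^2(\mathbb H^d)$, and satisfies $u'(t)=\tfrac i2Lu(t)$, i.e. the free Schrödinger equation $i\,\partial_tu=-\tfrac12Lu$. -/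

import Mathlib

open MeasureTheory Filter Topology
open scoped ENNReal NNReal SchwartzMap ContDiff

noncomputable section

/-- The horizontal coordinates `z = (x, y) ∈ ℝ^{2d}` with the Euclidean norm:
`x_i = z (Sum.inl i)` and `y_i = z (Sum.inr i)`. -/
abbrev Plane (d : ℕ) : Type := EuclideanSpace ℝ (Fin d ⊕ Fin d)

/-- The underlying manifold `ℝ^{2d} × ℝ` of the Heisenberg group, with points `(z, s)`.
Its Haar measure is the Lebesgue measure `volume`. -/
abbrev Heis (d : ℕ) : Type := Plane d × ℝ

/-- The Hilbert space `L²(ℍ^d)` of complex functions. -/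
abbrev HeisL2 (d : ℕ) : Type := Lp ℂ 2 (volume : Measure (Heis d))

namespace Heis

variable {d : ℕ}

instance volume_isAddHaarMeasure : (volume : Measure (Heis d)).IsAddHaarMeasure :=
  inferInstanceAs ((volume : Measure (Plane d)).prod (volume : Measure ℝ)).IsAddHaarMeasure

/-- The form `(x, y) ·_σ (x', y') = x' · y - x · y'`. -/
def symp (z z' : Plane d) : ℝ :=
  ∑ i : Fin d, (z' (Sum.inl i) * z (Sum.inr i) - z (Sum.inl i) * z' (Sum.inr i))

/-- `z̃ = (y, -x)` for `z = (x, y)`. -/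
def tilde (z : Plane d) : Plane d :=
  WithLp.toLp 2 (Sum.elim (fun i => z (Sum.inr i)) (fun i => -z (Sum.inl i)))

/-- The left-invariant vector field `X_i = ∂_{x_i} + y_i ∂_s`. -/
def fieldX (i : Fin d) (f : Heis d → ℂ) (p : Heis d) : ℂ :=
  fderiv ℝ f p (EuclideanSpace.single (Sum.inl i) 1, p.1 (Sum.inr i))

/-- The left-invariant vector field `Y_i = ∂_{y_i} - x_i ∂_s`. -/
def fieldY (i : Fin d) (f : Heis d → ℂ) (p : Heis d) : ℂ :=
  fderiv ℝ f p (EuclideanSpace.single (Sum.inr i) 1, -p.1 (Sum.inl i))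

/-- The differential expression `∑ i, (X_i² + Y_i²)`. -/
def subLaplacianFun (f : Heis d → ℂ) (p : Heis d) : ℂ :=
  ∑ i : Fin d, (fieldX i (fieldX i f) p + fieldY i (fieldY i f) p)

/-- The space `C_c^∞(ℍ^d)` of complex test functions. -/
def testFunctions (d : ℕ) : Submodule ℂ (Heis d → ℂ) where
  carrier := {f | ContDiff ℝ ∞ f ∧ HasCompactSupport f}
  zero_mem' := ⟨contDiff_const, HasCompactSupport.zero⟩
  add_mem' := fun hf hg => ⟨hf.1.add hg.1, hf.2.add hg.2⟩
  smul_mem' := fun c _ hf => ⟨hf.1.const_smul c, hf.2.smul_left (f := fun _ => c)⟩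

theorem fieldX_mem (i : Fin d) {f : Heis d → ℂ} (hf : f ∈ testFunctions d) :
    fieldX i f ∈ testFunctions d := by
  refine ⟨?_, ?_⟩
  · have h1 : ContDiff ℝ ∞ (fderiv ℝ f) := hf.1.fderiv_right (by simp)
    unfold fieldX
    fun_prop
  · refine (hf.2.fderiv (𝕜 := ℝ)).mono ?_
    intro p hp h
    exact hp (by simp [fieldX, h])

theorem fieldY_mem (i : Fin d) {f : Heis d → ℂ} (hf : f ∈ testFunctions d) :
    fieldY i f ∈ testFunctions d := by
  refine ⟨?_, ?_⟩
  · have h1 : ContDiff ℝ ∞ (fderiv ℝ f) := hf.1.fderiv_right (by simp)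
    unfold fieldY
    fun_prop
  · refine (hf.2.fderiv (𝕜 := ℝ)).mono ?_
    intro p hp h
    exact hp (by simp [fieldY, h])

theorem testFunction_differentiable {f : Heis d → ℂ} (hf : f ∈ testFunctions d) :
    Differentiable ℝ f := hf.1.differentiable (by simp)

theorem fieldX_add (i : Fin d) {f g : Heis d → ℂ} (hf : f ∈ testFunctions d)
    (hg : g ∈ testFunctions d) : fieldX i (f + g) = fieldX i f + fieldX i g := by
  ext p
  simp [fieldX, fderiv_add (testFunction_differentiable hf p) (testFunction_differentiable hg p)]

theorem fieldY_add (i : Fin d) {f g : Heis d → ℂ} (hf : f ∈ testFunctions d)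
    (hg : g ∈ testFunctions d) : fieldY i (f + g) = fieldY i f + fieldY i g := by
  ext p
  simp [fieldY, fderiv_add (testFunction_differentiable hf p) (testFunction_differentiable hg p)]

theorem fieldX_smul (i : Fin d) (c : ℂ) {f : Heis d → ℂ} (hf : f ∈ testFunctions d) :
    fieldX i (c • f) = c • fieldX i f := by
  ext p
  simp [fieldX, fderiv_const_smul (testFunction_differentiable hf p) c]

theorem fieldY_smul (i : Fin d) (c : ℂ) {f : Heis d → ℂ} (hf : f ∈ testFunctions d) :
    fieldY i (c • f) = c • fieldY i f := by
  ext p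
  simp [fieldY, fderiv_const_smul (testFunction_differentiable hf p) c]

theorem subLaplacianFun_mem {f : Heis d → ℂ} (hf : f ∈ testFunctions d) :
    subLaplacianFun f ∈ testFunctions d := by
  have h : subLaplacianFun f = ∑ i : Fin d, (fieldX i (fieldX i f) + fieldY i (fieldY i f)) := by
    ext p
    simp [subLaplacianFun]
  rw [h]
  exact Submodule.sum_mem _ fun i _ =>
    Submodule.add_mem _ (fieldX_mem i (fieldX_mem i hf)) (fieldY_mem i (fieldY_mem i hf))

/-- `∑ i, (X_i² + Y_i²)` as a linear map on test functions. -/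
def subLaplacian (d : ℕ) : testFunctions d →ₗ[ℂ] testFunctions d where
  toFun f := ⟨subLaplacianFun f.1, subLaplacianFun_mem f.2⟩
  map_add' f g := by
    ext p
    simp only [subLaplacianFun, Submodule.coe_add, Pi.add_apply,
      fieldX_add _ f.2 g.2, fieldY_add _ f.2 g.2,
      fieldX_add _ (fieldX_mem _ f.2) (fieldX_mem _ g.2),
      fieldY_add _ (fieldY_mem _ f.2) (fieldY_mem _ g.2), ← Finset.sum_add_distrib]
    exact Finset.sum_congr rfl fun i _ => by ring
  map_smul' c f := by
    ext p
    simp only [subLaplacianFun, Submodule.coe_smul, Pi.smul_apply, RingHom.id_apply,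
      fieldX_smul _ c f.2, fieldY_smul _ c f.2,
      fieldX_smul _ c (fieldX_mem _ f.2), fieldY_smul _ c (fieldY_mem _ f.2), Finset.smul_sum,
      smul_add]

theorem memLp_of_mem {f : Heis d → ℂ} (hf : f ∈ testFunctions d) :
    MemLp f 2 (volume : Measure (Heis d)) :=
  hf.1.continuous.memLp_of_hasCompactSupport hf.2

/-- The inclusion `C_c^∞(ℍ^d) → L²(ℍ^d)`. -/
def testToL2 (d : ℕ) : testFunctions d →ₗ[ℂ] HeisL2 d where
  toFun f := (memLp_of_mem f.2).toLp f.1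
  map_add' _ _ := rfl
  map_smul' _ _ := rfl

theorem testToL2_injective (d : ℕ) : Function.Injective (testToL2 d) := by
  intro f g h
  have h1 : f.1 =ᵐ[volume] g.1 := (MemLp.toLp_eq_toLp_iff (memLp_of_mem f.2) (memLp_of_mem g.2)).1 h
  exact Subtype.ext (Continuous.ae_eq_iff_eq volume f.2.1.continuous g.2.1.continuous |>.1 h1)

/-- The operator `L₀ = ∑ i, (X_i² + Y_i²)` in `L²(ℍ^d)` with domain `C_c^∞(ℍ^d)`. -/
def minimalLaplacian (d : ℕ) : HeisL2 d →ₗ.[ℂ] HeisL2 d where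
  domain := LinearMap.range (testToL2 d)
  toFun := (testToL2 d ∘ₗ subLaplacian d) ∘ₗ
    (LinearEquiv.ofInjective (testToL2 d) (testToL2_injective d)).symm.toLinearMap

/-- The horizontal Laplacian `L`, the closure of `L₀` in `L²(ℍ^d)`. -/
def horizontalLaplacian (d : ℕ) : HeisL2 d →ₗ.[ℂ] HeisL2 d := (minimalLaplacian d).closure

end Heis

/-- `w` is the Fresnel integral `∫° e^{i|ζ|²/2} f(ζ) dζ`: for every Schwartz function `φ` with
`φ 0 = 1` the regularized integrals `∫ φ(ε ζ) e^{i|ζ|²/2} f(ζ) dζ`, `ε > 0`, converge absolutely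
and tend to `w` as `ε ↓ 0`. -/
def HasFresnelIntegral {E : Type*} [NormedAddCommGroup E] [InnerProductSpace ℝ E]
    [FiniteDimensional ℝ E] [MeasurableSpace E] [BorelSpace E] (f : E → ℂ) (w : ℂ) : Prop :=
  ∀ φ : 𝓢(E, ℂ), φ 0 = 1 →
    (∀ ε : ℝ, 0 < ε →
      Integrable (fun ζ : E => φ (ε • ζ) * Complex.exp (Complex.I * ‖ζ‖ ^ 2 / 2) * f ζ)) ∧
    Tendsto (fun ε : ℝ => ∫ ζ : E, φ (ε • ζ) * Complex.exp (Complex.I * ‖ζ‖ ^ 2 / 2) * f ζ)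
      (𝓝[>] 0) (𝓝 w)

namespace Heis

variable {d : ℕ}

/-- `w = (2πi)^{-d} ∫° e^{i|ζ|²/2} ψ(z + √τ ζ, s + √τ z ·_σ ζ) dζ` at `p = (z, s)`. -/
def HasFresnelAverage (τ : ℝ≥0) (ψ : Heis d → ℂ) (p : Heis d) (w : ℂ) : Prop :=
  ∃ I : ℂ,
    HasFresnelIntegral
      (fun ζ : Plane d => ψ (p.1 + √(τ : ℝ) • ζ, p.2 + √(τ : ℝ) * symp p.1 ζ)) I ∧
    w = ((2 * Real.pi * Complex.I) ^ d)⁻¹ * I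

/-- The bounded operators `S τ` on `L²(ℍ^d)` extend the Fresnel averages of Schwartz functions. -/
def ExtendsFresnelAverage (S : ℝ≥0 → HeisL2 d →L[ℂ] HeisL2 d) : Prop :=
  ∀ (τ : ℝ≥0) (ψ : 𝓢(Heis d, ℂ)),
    ∀ᵐ p : Heis d, HasFresnelAverage τ ψ p (S τ (ψ.toLp 2 volume) p)

/-- `F` is the unitary Fourier transform in the central variable,
`(F ψ)(z, α) = (2π)^{-1/2} ∫ e^{-iαs} ψ(z, s) ds` for Schwartz functions `ψ`. -/
def IsCentralFourier (F : HeisL2 d ≃ₗᵢ[ℂ] HeisL2 d) : Prop :=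
  ∀ ψ : 𝓢(Heis d, ℂ), ∀ᵐ p : Heis d,
    F (ψ.toLp 2 volume) p =
      ((√(2 * Real.pi) : ℝ) : ℂ)⁻¹ * ∫ s : ℝ, Complex.exp (-Complex.I * p.2 * s) * ψ (p.1, s)

/-- The Fourier transform in the horizontal variables,
`(2π)^{-2d} ∫ e^{-iη·z} χ(z, α) dz`. -/
def horizontalFourier (χ : Heis d → ℂ) (η : Plane d) (α : ℝ) : ℂ :=
  ((2 * Real.pi : ℂ) ^ (2 * d))⁻¹ *
    ∫ z : Plane d, Complex.exp (-Complex.I * (inner ℝ η z : ℝ)) * χ (z, α)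

/-- `U₁` is the unitary operator with
`(U₁ χ)(z, α) = ∫ e^{iη·z} e^{-iτ|η|²/2} χ̂(η, α) dη` for Schwartz functions `χ`, where `χ̂` is
the Fourier transform in the horizontal variables. -/
def IsFourierMultiplier (τ : ℝ≥0) (U₁ : HeisL2 d ≃ₗᵢ[ℂ] HeisL2 d) : Prop :=
  ∀ χ : 𝓢(Heis d, ℂ), ∀ᵐ p : Heis d,
    U₁ (χ.toLp 2 volume) p =
      ∫ η : Plane d, Complex.exp (Complex.I * (inner ℝ η p.1 : ℝ)) *
        Complex.exp (-Complex.I / 2 * (τ : ℝ) * ‖η‖ ^ 2) * horizontalFourier χ η p.2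

/-- `V` is the shear `(V χ)(z, α) = χ(z - τ α z̃, α)`. -/
def IsShear (τ : ℝ≥0) (V : HeisL2 d →L[ℂ] HeisL2 d) : Prop :=
  ∀ χ : HeisL2 d, ∀ᵐ p : Heis d, V χ p = χ (p.1 - ((τ : ℝ) * p.2) • tilde p.1, p.2)

/-- `U₂` is multiplication by `e^{-(i/2) τ |α z̃|²}`. -/
def IsPhaseMultiplication (τ : ℝ≥0) (U₂ : HeisL2 d ≃ₗᵢ[ℂ] HeisL2 d) : Prop :=
  ∀ χ : HeisL2 d, ∀ᵐ p : Heis d,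
    U₂ χ p = Complex.exp (-Complex.I / 2 * (τ : ℝ) * ‖p.2 • tilde p.1‖ ^ 2) * χ p

end Heis

/-- A strongly continuous one-parameter group of unitary operators on a Hilbert space. -/
structure IsUnitaryGroup {H : Type*} [NormedAddCommGroup H] [InnerProductSpace ℂ H]
    [CompleteSpace H] (U : ℝ → H →L[ℂ] H) : Prop where
  mem_unitary : ∀ t, U t ∈ unitary (H →L[ℂ] H)
  map_zero : U 0 = 1
  map_add : ∀ s t, U (s + t) = U s * U t
  continuous : ∀ f, Continuous fun t => U t f

/-- `A` is the infinitesimal generator of `U`: `f ∈ D(A)` and `A f = g` if and only if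
`(U t f - f) / t → g` as `t → 0`. -/
def IsGeneratorOf {H : Type*} [NormedAddCommGroup H] [NormedSpace ℂ H]
    (A : H →ₗ.[ℂ] H) (U : ℝ → H →L[ℂ] H) : Prop :=
  ∀ f g : H, (f, g) ∈ A.graph ↔
    Tendsto (fun t : ℝ => (t : ℂ)⁻¹ • (U t f - f)) (𝓝[≠] 0) (𝓝 g)

/-- `S` is Chernoff-equivalent to `V`:
`sup_{t ∈ [0, T]} ‖S(t/n)^n f - V(t) f‖ → 0` as `n → ∞`, for all `f` and all `T > 0`. -/
def ChernoffEquivalent {B : Type*} [NormedAddCommGroup B] [NormedSpace ℂ B]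
    (S V : ℝ≥0 → B →L[ℂ] B) : Prop :=
  ∀ (f : B) (T : ℝ≥0), 0 < T →
    TendstoUniformlyOn (fun (n : ℕ) (t : ℝ≥0) => (S (t / n) ^ n) f) (fun t => V t f)
      atTop (Set.Icc 0 T)

end

open MeasureTheory Filter Topology
open scoped ENNReal NNReal SchwartzMap ContDiff

set_option linter.unusedSectionVars false

noncomputable section

/-! The average S(τ) is an exact product of three explicit contractions, and Chernoff's theorem
needs only the derivative of that product at τ = 0 on a core. After the Fourier transform in s the
left-invariant fields become ∂_j + iα z̃_j. Since z̃_j does not depend on z_j, squaring produces no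
commutator term, and (i/2) Σ (∂_j + iα z̃_j)² = (i/2)Δ_z − α z̃·∇_z − (i/2)|α z̃|²
(`half_I_smul_sum_twistedFieldS`). The three terms are the derivatives at 0 of the free evolution
U₁, the shear V and the phase U₂, so S has derivative (i/2)L on Schwartz functions
(`tendsto_slope_fresnelOperator`); test functions form a core because L is defined as a closure.

The factorization is a completed square. U₁ is convolution with the Fresnel kernel
(`freeEvolutionS_eq`). Evaluating it at the sheared point and translating ζ by √τ α z̃ yields a
square cancelled by U₂ and a cross term e^{iα√τ z·_σ ζ}, which is the translation of s seen on the
Fourier side (`freeEvolutionS_shear`, `fresnelS_eq`). For τ > 0 the amplitude is integrable, so the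
oscillatory integral is an ordinary one; only at τ = 0, where it is constant, does the
regularization matter. V is a contraction because z̃ is orthogonal to z and of the same length: z ↦
z − b z̃ is √(1+b²) times an isometry, hence expands volume.

Self-adjointness of L: the fields have measure-preserving flows, so the minimal operator is
symmetric and nonpositive, and it suffices that Lu = (4d+2)u has no nonzero weak L² solution.
Convolution on the group, on the side that respects left-invariant fields, turns such a u into
bounded functions satisfying the equation pointwise; the barrier 1 + |z|² + s² gives a maximum
principle that kills them (`nonpos_of_bounded_solution`, `eq_zero_of_weak_solution`).

The abstract half is Hilbert space theory on graphs. Stone's theorem comes from exponentials of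
bounded skew-adjoint Yosida approximations. Chernoff's theorem compares Q_h = (1 − (S_h − 1)/h)⁻¹
with R = (1 − A)⁻¹: Q_h → R strongly, and the smoothed defect Q_h(S_hⁿ − U(nh))R telescopes into n
errors, each o(h) uniformly on compact time intervals (`chernoff`). -/

theorem mem_smul_graph_iff {H : Type*} [AddCommGroup H] [Module ℂ H] {T : H →ₗ.[ℂ] H} {a : ℂ}
    (ha : a ≠ 0) {f g : H} :
    (f, a • g) ∈ (a • T).graph ↔ (f, g) ∈ T.graph := by
  rw [LinearPMap.smul_graph, Submodule.mem_map]
  constructor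
  · rintro ⟨⟨f', g'⟩, h, h'⟩
    simp only [LinearMap.prodMap_apply, LinearMap.id_coe, id_eq, LinearMap.smul_apply,
      Prod.mk.injEq] at h'
    obtain ⟨rfl, h2⟩ := h'
    have h3 := congrArg (a⁻¹ • ·) h2
    simp only [smul_smul, inv_mul_cancel₀ ha, one_smul] at h3
    rwa [← h3]
  · intro h
    exact ⟨(f, g), h, rfl⟩

/-! ### A criterion for essential self-adjointness, and skew-adjoint operators. -/

section SelfAdjoint

variable {H : Type*} [NormedAddCommGroup H] [InnerProductSpace ℂ H] [CompleteSpace H]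

/-- A closed linear relation that is bounded below under `(f, g) ↦ a f + b g`, with dense range,
is mapped onto the whole space. -/
theorem exists_mem_eq_of_bound_of_dense {G : Submodule ℂ (H × H)} (hG : IsClosed (G : Set (H × H)))
    (a b : ℂ) (K : ℝ≥0) (hK : ∀ p ∈ G, ‖p‖ ≤ K * ‖a • p.1 + b • p.2‖)
    (hd : ∀ y, (∀ p ∈ G, inner ℂ (a • p.1 + b • p.2) y = 0) → y = 0) (w : H) :
    ∃ p ∈ G, a • p.1 + b • p.2 = w := by
  let Φ : G →L[ℂ] H :=
    ((a • ContinuousLinearMap.fst ℂ H H + b • ContinuousLinearMap.snd ℂ H H)).comp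
    G.subtypeL
  have hΦ : ∀ p : G, Φ p = a • p.1.1 + b • p.1.2 := fun p => rfl
  have hanti : AntilipschitzWith K Φ := by
    apply Φ.antilipschitz_of_bound
    intro p
    simpa [hΦ] using hK p.1 p.2
  have : CompleteSpace G := hG.completeSpace_coe
  have hcl : IsClosed (Set.range Φ) := hanti.isClosed_range Φ.uniformContinuous
  have hcl' : IsClosed (LinearMap.range (Φ : G →ₗ[ℂ] H) : Set H) := by
    convert hcl using 1
    ext; simp
  have htop : LinearMap.range (Φ : G →ₗ[ℂ] H) = ⊤ := by
    have h2 : (LinearMap.range (Φ : G →ₗ[ℂ] H)).topologicalClosure = ⊤ := by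
      rw [Submodule.topologicalClosure_eq_top_iff, Submodule.eq_bot_iff]
      intro y hy
      apply hd
      intro p hp
      exact (Submodule.mem_orthogonal _ _).1 hy _ ⟨⟨p, hp⟩, rfl⟩
    rwa [hcl'.submodule_topologicalClosure_eq] at h2
  obtain ⟨p, hp⟩ : w ∈ LinearMap.range (Φ : G →ₗ[ℂ] H) := by rw [htop]; trivial
  exact ⟨p.1, p.2, hp⟩

/-- A densely defined symmetric operator `T ≤ 0` such that `c - T` has dense range for some
`c > 0` is essentially self-adjoint. -/
theorem isSelfAdjoint_closure_of_dense_range {T : H →ₗ.[ℂ] H} (hT : Dense (T.domain : Set H))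
    (hsymm : ∀ x y : T.domain, inner ℂ (T x) (y : H) = inner ℂ (x : H) (T y))
    (hneg : ∀ x : T.domain, (inner ℂ (x : H) (T x)).re ≤ 0) {c : ℝ} (hc : 0 < c)
    (hrange : ∀ u : H, (∀ x : T.domain, inner ℂ ((c : ℂ) • (x : H) - T x) u = 0) → u = 0) :
    T.IsClosable ∧ IsSelfAdjoint T.closure := by
  have hle : T ≤ T.adjoint := LinearPMap.IsFormalAdjoint.le_adjoint hT hsymm
  have hclosable : T.IsClosable :=
    ((LinearPMap.adjoint_isClosed hT).isClosable).leIsClosable hle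
  refine ⟨hclosable, ?_⟩
  have hgr := hclosable.graph_closure_eq_closure_graph
  have hclosed : IsClosed (T.closure.graph : Set (H × H)) := hclosable.closure_isClosed
  have hdense : Dense (T.closure.domain : Set H) := hT.mono (LinearPMap.le_closure T).1
  have hmemcl : ∀ p : H × H, p ∈ T.closure.graph ↔ p ∈ closure (T.graph : Set (H × H)) := by
    intro p; rw [← hgr]; rw [← SetLike.mem_coe, Submodule.topologicalClosure_coe]
  have hsub : ∀ p ∈ T.graph, p ∈ T.closure.graph := fun p hp =>
    (hmemcl p).2 (subset_closure hp)
  have hsym1 : ∀ p ∈ T.closure.graph, ∀ q ∈ T.graph, inner ℂ q.2 p.1 = inner ℂ q.1 p.2 := by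
    intro p hp q hq
    have hclo : IsClosed {p : H × H | inner ℂ q.2 p.1 = inner ℂ q.1 p.2} :=
      isClosed_eq (by fun_prop) (by fun_prop)
    refine hclo.closure_subset_iff.2 ?_ ((hmemcl p).1 hp)
    intro p hp
    obtain ⟨x, hx1, hx2⟩ := (LinearPMap.mem_graph_iff T).1 hp
    obtain ⟨y, hy1, hy2⟩ := (LinearPMap.mem_graph_iff T).1 hq
    simp only [Set.mem_ofPred_eq, ← hx1, ← hx2, ← hy1, ← hy2]
    exact hsymm y x
  have hsym2 : ∀ p ∈ T.closure.graph, ∀ q ∈ T.closure.graph,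
      inner ℂ q.2 p.1 = inner ℂ q.1 p.2 := by
    intro p hp q hq
    have hclo : IsClosed {q : H × H | inner ℂ q.2 p.1 = inner ℂ q.1 p.2} :=
      isClosed_eq (by fun_prop) (by fun_prop)
    exact hclo.closure_subset_iff.2 (fun q hq => hsym1 p hp q hq) ((hmemcl q).1 hq)
  have hneg' : ∀ p ∈ T.closure.graph, (inner ℂ p.1 p.2 : ℂ).re ≤ 0 := by
    intro p hp
    have hclo : IsClosed {p : H × H | (inner ℂ p.1 p.2 : ℂ).re ≤ 0} :=
      isClosed_le (Complex.continuous_re.comp (by fun_prop)) continuous_const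
    refine hclo.closure_subset_iff.2 ?_ ((hmemcl p).1 hp)
    intro p hp
    obtain ⟨x, hx1, hx2⟩ := (LinearPMap.mem_graph_iff T).1 hp
    simp only [Set.mem_ofPred_eq, ← hx1, ← hx2]
    exact hneg x
  -- Nonpositivity gives c‖f‖² ≤ Re⟨f, cf − g⟩; Cauchy–Schwarz then lets one factor ‖f‖ be divided
  -- out.
  have hbound : ∀ p ∈ T.closure.graph, c * ‖p.1‖ ≤ ‖(c : ℂ) • p.1 + (-1 : ℂ) • p.2‖ := by
    intro p hp
    have h1 : c * ‖p.1‖ ^ 2 ≤ (inner ℂ p.1 ((c : ℂ) • p.1 + (-1 : ℂ) • p.2) : ℂ).re := by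
      rw [inner_add_right, inner_smul_right, inner_smul_right, inner_self_eq_norm_sq_to_K]
      have := hneg' p hp
      have h3 : (((c : ℂ) * ((‖p.1‖ : ℝ) : ℂ) ^ 2)).re = c * ‖p.1‖ ^ 2 := by norm_cast
      simp only [Complex.add_re, Complex.coe_algebraMap] at *
      rw [h3]
      simp only [neg_mul, one_mul, Complex.neg_re]
      linarith
    have h2 : (inner ℂ p.1 ((c : ℂ) • p.1 + (-1 : ℂ) • p.2) : ℂ).re ≤
        ‖p.1‖ * ‖(c : ℂ) • p.1 + (-1 : ℂ) • p.2‖ :=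
      (Complex.re_le_norm _).trans (norm_inner_le_norm _ _)
    by_cases h0 : ‖p.1‖ = 0
    · rw [h0]; simp
    · have hp0 : 0 < ‖p.1‖ := lt_of_le_of_ne (norm_nonneg _) (Ne.symm h0)
      nlinarith
  have hsurj : ∀ w, ∃ p ∈ T.closure.graph, (c : ℂ) • p.1 + (-1 : ℂ) • p.2 = w := by
    -- `hbound` controls f with c⁻¹; writing g = cf − (cf − g) controls g with 2.
    apply exists_mem_eq_of_bound_of_dense hclosed _ _ (⟨c⁻¹, by positivity⟩ + 2)
    · intro p hp
      have h1 := hbound p hp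
      have h3 : ‖p.1‖ ≤ c⁻¹ * ‖(c : ℂ) • p.1 + (-1 : ℂ) • p.2‖ := by
        rw [inv_mul_eq_div, le_div_iff₀ hc]; linarith
      have h2 : ‖p.2‖ ≤ 2 * ‖(c : ℂ) • p.1 + (-1 : ℂ) • p.2‖ := by
        have h4 : p.2 = (c : ℂ) • p.1 - ((c : ℂ) • p.1 + (-1 : ℂ) • p.2) := by simp
        calc ‖p.2‖ = ‖(c : ℂ) • p.1 - ((c : ℂ) • p.1 + (-1 : ℂ) • p.2)‖ := by rw [← h4]
          _ ≤ ‖(c : ℂ) • p.1‖ + ‖(c : ℂ) • p.1 + (-1 : ℂ) • p.2‖ := norm_sub_le _ _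
          _ = c * ‖p.1‖ + ‖(c : ℂ) • p.1 + (-1 : ℂ) • p.2‖ := by
            rw [norm_smul, Complex.norm_real, Real.norm_of_nonneg hc.le]
          _ ≤ _ := by linarith
      have hn := norm_nonneg ((c : ℂ) • p.1 + (-1 : ℂ) • p.2)
      have hci : 0 ≤ c⁻¹ * ‖(c : ℂ) • p.1 + (-1 : ℂ) • p.2‖ := by positivity
      rw [Prod.norm_def]
      change _ ≤ (c⁻¹ + 2) * _
      rw [add_mul]
      exact max_le (by linarith) (by linarith)
    · intro y hy
      apply hrange
      intro x
      have := hy ((x : H), T x) (hsub _ (T.mem_graph x))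
      simpa [sub_eq_add_neg] using this
  rw [LinearPMap.isSelfAdjoint_def]
  apply LinearPMap.eq_of_eq_graph
  rw [LinearPMap.adjoint_graph_eq_graph_adjoint hdense]
  ext ⟨y, z⟩
  rw [Submodule.mem_adjoint_iff]
  constructor
  · intro h
    -- With (f, g) in the closure solving cf − g = cy − z, the vector y − f is orthogonal to the
    -- range of c − T, so it vanishes and (y, z) = (f, g).
    obtain ⟨⟨f, g⟩, hp, hw⟩ := hsurj ((c : ℂ) • y + (-1 : ℂ) • z)
    have hyf : y - f = 0 := by
      apply hrange
      intro x
      have hx := hsub _ (T.mem_graph x)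
      have h1 := h _ _ hx
      have h2 := hsym2 _ hp _ hx
      have hz : z - g = (c : ℂ) • (y - f) := by
        simp only [smul_sub]
        simp only [neg_smul, one_smul] at hw
        have : z = (c : ℂ) • y - ((c : ℂ) • y + -z) := by abel
        rw [this, ← hw]; abel
      have h3 : inner ℂ (T x) (y - f) = inner ℂ (x : H) ((c : ℂ) • (y - f)) := by
        rw [← hz, inner_sub_right, inner_sub_right, h2, sub_eq_zero.1 h1]
      rw [inner_sub_left, h3, inner_smul_left, inner_smul_right]
      simp
    have h1 : y = f := sub_eq_zero.1 hyf
    subst h1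
    have h2 : z = g := by
      have := add_left_cancel hw
      simpa using this.symm
    subst h2
    exact hp
  · intro hp a b hab
    exact sub_eq_zero.2 (hsym2 _ hp _ hab)

/-- `A` is skew-symmetric and `c - A` is onto for all real `c ≠ 0`. -/
structure IsSkewAdjointPMap (A : H →ₗ.[ℂ] H) : Prop where
  dense : Dense (A.domain : Set H)
  skew : ∀ {f g f' g' : H}, (f, g) ∈ A.graph → (f', g') ∈ A.graph →
    inner ℂ g f' = -inner ℂ f g'
  surj : ∀ c : ℝ, c ≠ 0 → ∀ y, ∃ f, (f, (c : ℂ) • f - y) ∈ A.graph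

theorem IsSelfAdjoint.mem_graph_iff {T : H →ₗ.[ℂ] H} (hT : IsSelfAdjoint T) (p : H × H) :
    p ∈ T.graph ↔ ∀ a b, (a, b) ∈ T.graph → inner ℂ b p.1 = inner ℂ a p.2 := by
  have h1 := LinearPMap.adjoint_graph_eq_graph_adjoint hT.dense_domain
  rw [LinearPMap.isSelfAdjoint_def.1 hT] at h1
  conv_lhs => rw [h1]
  rw [Submodule.mem_adjoint_iff]
  simp only [sub_eq_zero]

/-- Since ⟨f, Tf⟩ is real, ‖cf − (i/2)Tf‖² = c²‖f‖² + ‖Tf‖²/4. The range of c − (i/2)T is therefore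
closed, and its orthogonal complement would consist of eigenvectors of T with a nonreal eigenvalue.
-/
theorem IsSelfAdjoint.isSkewAdjointPMap {T : H →ₗ.[ℂ] H} (hT : IsSelfAdjoint T) :
    IsSkewAdjointPMap ((Complex.I / 2) • T) := by
  have hI : (Complex.I / 2 : ℂ) ≠ 0 := by simp
  have hconj : (starRingEnd ℂ) (Complex.I / 2) = -(Complex.I / 2) := by
    simp [Complex.conj_ofNat]
    ring
  have hsym : ∀ {f g f' g' : H}, (f, g) ∈ T.graph → (f', g') ∈ T.graph →
      inner ℂ g f' = inner ℂ f g' := fun h h' => (hT.mem_graph_iff _).1 h' _ _ h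
  refine ⟨hT.dense_domain, ?_, ?_⟩
  · intro f g f' g' h h'
    have e : ∀ g : H, g = (Complex.I / 2) • ((Complex.I / 2)⁻¹ • g) := fun g => by
      rw [smul_smul, mul_inv_cancel₀ hI, one_smul]
    rw [e g] at h ⊢
    rw [e g'] at h' ⊢
    rw [mem_smul_graph_iff hI] at h h'
    rw [inner_smul_left, inner_smul_right, hsym h h', hconj]
    ring
  · intro c hc y
    have hnorm : ∀ p ∈ T.graph, ‖(c : ℂ) • p.1 + (-(Complex.I / 2)) • p.2‖ ^ 2 =
        c ^ 2 * ‖p.1‖ ^ 2 + 1 / 4 * ‖p.2‖ ^ 2 := by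
      rintro ⟨f, g⟩ hp
      have h0 := hsym hp hp
      have hcross : RCLike.re (inner ℂ ((c : ℂ) • f) ((-(Complex.I / 2)) • g)) = 0 := by
        have hreal : (inner ℂ f g : ℂ).im = 0 := by
          have h5 := inner_conj_symm (𝕜 := ℂ) f g
          rw [h0] at h5
          exact Complex.conj_eq_iff_im.1 h5
        rw [inner_smul_left, inner_smul_right]
        simp [hreal]
      simp only
      rw [@norm_add_sq ℂ, hcross, norm_smul, norm_smul]
      simp only [Complex.norm_real, norm_neg, norm_div, Complex.norm_I, Real.norm_eq_abs]
      rw [mul_pow, sq_abs]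
      simp
      ring
    obtain ⟨⟨f, g⟩, hp, hw⟩ := exists_mem_eq_of_bound_of_dense (G := T.graph) hT.isClosed
      (c : ℂ) (-(Complex.I / 2)) (⟨|c|⁻¹, by positivity⟩ + 2) (by
        intro p hp
        have h := hnorm p hp
        set N := ‖(c : ℂ) • p.1 + (-(Complex.I / 2)) • p.2‖ with hN
        have hN0 : 0 ≤ N := norm_nonneg _
        have hc' : 0 < |c| := abs_pos.2 hc
        have h1 : |c| * ‖p.1‖ ≤ N := by
          refine (pow_le_pow_iff_left₀ (by positivity) hN0 two_ne_zero).1 ?_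
          rw [h, mul_pow, sq_abs]; nlinarith [sq_nonneg ‖p.2‖]
        have h2 : ‖p.2‖ ≤ 2 * N := by
          refine (pow_le_pow_iff_left₀ (by positivity) (by positivity) two_ne_zero).1 ?_
          rw [mul_pow, h]; nlinarith [sq_nonneg (c * ‖p.1‖)]
        have h3 : ‖p.1‖ ≤ |c|⁻¹ * N := by
          rw [inv_mul_eq_div, le_div_iff₀ hc']; linarith
        have hci : 0 ≤ |c|⁻¹ * N := by positivity
        rw [Prod.norm_def]
        change _ ≤ (|c|⁻¹ + 2) * _
        rw [add_mul]
        exact max_le (by linarith) (by linarith)) (by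
        intro y hy
        -- Orthogonality to the range says Ty = 2ci y, which is impossible for a symmetric T unless
        -- y = 0.
        have hmem : (y, (2 * c * Complex.I) • y) ∈ T.graph := by
          rw [hT.mem_graph_iff]
          intro a b hab
          have h := hy (a, b) hab
          simp only [inner_add_left, inner_smul_left, map_neg, hconj, neg_neg,
            Complex.conj_ofReal] at h
          simp only [inner_smul_right]
          have h2 : (Complex.I / 2) * inner ℂ b y = -(c * inner ℂ a y) := by
            linear_combination h
          have h3 : inner ℂ b y = (-2 * Complex.I) * ((Complex.I / 2) * inner ℂ b y) := by
            ring_nf; simp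
          rw [h3, h2]; ring
        have h := hsym hmem hmem
        rw [inner_smul_left, inner_smul_right] at h
        simp only [map_mul, Complex.conj_I, Complex.conj_ofReal, Complex.conj_ofNat] at h
        have h4 : (4 * c * Complex.I) * inner ℂ y y = 0 := by linear_combination -h
        have h5 : (4 * c * Complex.I : ℂ) ≠ 0 := by simp [hc]
        exact inner_self_eq_zero.1 ((mul_eq_zero.1 h4).resolve_left h5)) y
    refine ⟨f, ?_⟩
    have h6 : (c : ℂ) • f - y = (Complex.I / 2) • g := by
      rw [← hw]; simp
    rw [h6, mem_smul_graph_iff hI]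
    exact hp

end SelfAdjoint

/-! ### Resolvents and Yosida approximations of a skew-adjoint operator. -/

namespace IsSkewAdjointPMap

variable {H : Type*} [NormedAddCommGroup H] [InnerProductSpace ℂ H] [CompleteSpace H]
  {A : H →ₗ.[ℂ] H}

theorem re_inner_eq_zero (hA : IsSkewAdjointPMap A) {f g : H} (h : (f, g) ∈ A.graph) :
    (inner ℂ f g : ℂ).re = 0 := by
  have h1 := congrArg Complex.re (hA.skew h h)
  have h2 := congrArg Complex.re (inner_conj_symm (𝕜 := ℂ) f g)
  simp only [Complex.conj_re, Complex.neg_re] at h1 h2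
  linarith

theorem norm_le_of_mem (hA : IsSkewAdjointPMap A) {c : ℝ} (hc : c ≠ 0) {f g : H}
    (h : (f, g) ∈ A.graph) : ‖f‖ ≤ |c|⁻¹ * ‖(c : ℂ) • f - g‖ := by
  have h1 := hA.re_inner_eq_zero h
  have h2 : ‖(c : ℂ) • f - g‖ ^ 2 = c ^ 2 * ‖f‖ ^ 2 + ‖g‖ ^ 2 := by
    rw [@norm_sub_sq ℂ, inner_smul_left, norm_smul]
    simp [h1, mul_pow]
  have hc' : 0 < |c| := abs_pos.2 hc
  rw [inv_mul_eq_div, le_div_iff₀ hc']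
  refine (pow_le_pow_iff_left₀ (by positivity) (by positivity) two_ne_zero).1 ?_
  rw [h2, mul_pow, sq_abs]
  nlinarith [sq_nonneg ‖g‖]

theorem eq_of_mem (hA : IsSkewAdjointPMap A) {c : ℝ} (hc : c ≠ 0) {f f' y : H}
    (h : (f, (c : ℂ) • f - y) ∈ A.graph) (h' : (f', (c : ℂ) • f' - y) ∈ A.graph) : f = f' := by
  have h1 := hA.norm_le_of_mem hc (A.graph.sub_mem h h')
  have h2 : (c : ℂ) • (f - f') - ((c : ℂ) • f - y - ((c : ℂ) • f' - y)) = 0 := by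
    rw [smul_sub]; abel
  rw [h2, norm_zero, mul_zero] at h1
  exact sub_eq_zero.1 (norm_le_zero_iff.1 h1)

/-- The resolvent `(c - A)⁻¹` for real `c ≠ 0` (and `0` for `c = 0`). -/
def resolvent (hA : IsSkewAdjointPMap A) (c : ℝ) : H →L[ℂ] H :=
  open Classical in
  if hc : c = 0 then 0 else
    LinearMap.mkContinuous
      { toFun := fun y => (hA.surj c hc y).choose
        map_add' := fun x y => by
          refine hA.eq_of_mem hc (hA.surj c hc _).choose_spec ?_
          have := A.graph.add_mem (hA.surj c hc x).choose_spec (hA.surj c hc y).choose_spec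
          convert! this using 1
          simp only [Prod.mk_add_mk, smul_add, Prod.mk.injEq, true_and]
          abel
        map_smul' := fun a x => by
          refine hA.eq_of_mem hc (hA.surj c hc _).choose_spec ?_
          have := A.graph.smul_mem a (hA.surj c hc x).choose_spec
          convert! this using 1
          simp only [RingHom.id_apply, Prod.smul_mk, smul_sub, smul_comm a] }
      |c|⁻¹ (fun y => by
        have := hA.norm_le_of_mem hc (hA.surj c hc y).choose_spec
        simpa using this)

variable (hA : IsSkewAdjointPMap A)

theorem resolvent_mem {c : ℝ} (hc : c ≠ 0) (y : H) :
    (hA.resolvent c y, (c : ℂ) • hA.resolvent c y - y) ∈ A.graph := by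
  have := (hA.surj c hc y).choose_spec
  simpa [resolvent, hc] using this

theorem resolvent_eq {c : ℝ} (hc : c ≠ 0) {f g : H} (h : (f, g) ∈ A.graph) :
    hA.resolvent c ((c : ℂ) • f - g) = f :=
  hA.eq_of_mem hc (hA.resolvent_mem hc _) (by simpa using h)

theorem norm_resolvent_le {c : ℝ} (hc : c ≠ 0) (y : H) :
    ‖hA.resolvent c y‖ ≤ |c|⁻¹ * ‖y‖ := by
  simpa using hA.norm_le_of_mem hc (hA.resolvent_mem hc y)

theorem resolvent_eq_of_mem {c : ℝ} (hc : c ≠ 0) {f g : H} (h : (f, g) ∈ A.graph) :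
    hA.resolvent c g = (c : ℂ) • hA.resolvent c f - f := by
  have := hA.resolvent_eq hc h
  rw [map_sub, map_smul] at this
  rw [eq_sub_iff_add_eq, add_comm]
  exact (sub_eq_iff_eq_add.1 this).symm

theorem resolvent_mem_of_mem {c : ℝ} (hc : c ≠ 0) {f g : H} (h : (f, g) ∈ A.graph) :
    (hA.resolvent c f, hA.resolvent c g) ∈ A.graph := by
  rw [hA.resolvent_eq_of_mem hc h]
  exact hA.resolvent_mem hc f

/-- A resolvent maps the graph of A to itself, so applying it to the equation defining R(b)y gives
the equation whose only solution is R(b)R(a)y. -/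
theorem resolvent_commute {a b : ℝ} (ha : a ≠ 0) (hb : b ≠ 0) :
    Commute (hA.resolvent a) (hA.resolvent b) := by
  ext y
  change hA.resolvent a (hA.resolvent b y) = hA.resolvent b (hA.resolvent a y)
  have h := hA.resolvent_mem_of_mem ha (hA.resolvent_mem hb y)
  rw [map_sub, map_smul] at h
  exact hA.eq_of_mem hb h (hA.resolvent_mem hb _)

/-- A changes sign when moved across the inner product. This is why `yosida` sums over both signs of
c: the sum is then skew-adjoint. -/
theorem adjoint_resolvent {c : ℝ} (hc : c ≠ 0) :
    ContinuousLinearMap.adjoint (hA.resolvent c) = -hA.resolvent (-c) := by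
  symm
  rw [ContinuousLinearMap.eq_adjoint_iff]
  intro x y
  have h1 := hA.resolvent_mem (neg_ne_zero.2 hc) x
  have h2 := hA.resolvent_mem hc y
  have := hA.skew h1 h2
  rw [inner_sub_left, inner_sub_right, inner_smul_left, inner_smul_right] at this
  simp only [Complex.ofReal_neg, map_neg, Complex.conj_ofReal] at this
  rw [neg_apply, inner_neg_left]
  linear_combination this

/-- The bounded skew-adjoint approximations `n² A (n² - A²)⁻¹` of `A`. -/
def yosida (n : ℕ) : H →L[ℂ] H :=
  -- By partial fractions 1/(c − a) − 1/(c + a) = 2a/(c² − a²). Here c = n + 1, which avoids the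
  -- default value of the resolvent at 0.
  ((((n : ℝ) + 1) ^ 2 / 2 : ℝ) : ℂ) • (hA.resolvent (n + 1) + hA.resolvent (-(n + 1)))

theorem natCast_add_one_ne_zero' (n : ℕ) : (n : ℝ) + 1 ≠ 0 := by positivity

theorem yosida_mem_skewAdjoint (n : ℕ) : hA.yosida n ∈ skewAdjoint (H →L[ℂ] H) := by
  have hn := natCast_add_one_ne_zero' n
  rw [skewAdjoint.mem_iff, yosida, star_smul, star_add, ContinuousLinearMap.star_eq_adjoint,
    ContinuousLinearMap.star_eq_adjoint, hA.adjoint_resolvent hn,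
    hA.adjoint_resolvent (neg_ne_zero.2 hn), neg_neg]
  simp only [Complex.star_def, Complex.conj_ofReal]
  rw [← smul_neg]
  congr 1
  abel

theorem yosida_commute (m n : ℕ) : Commute (hA.yosida m) (hA.yosida n) := by
  have hm := natCast_add_one_ne_zero' m
  have hn := natCast_add_one_ne_zero' n
  have hm' := neg_ne_zero.2 hm
  have hn' := neg_ne_zero.2 hn
  refine Commute.smul_left (Commute.smul_right ?_ _) _
  exact ((hA.resolvent_commute hm hn).add_right (hA.resolvent_commute hm hn')).add_left
    ((hA.resolvent_commute hm' hn).add_right (hA.resolvent_commute hm' hn'))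

/-- The operators cR(c) are contractions, and on the domain cR(c)f − f = R(c)Af = O(1/|c|); density
does the rest. The sign σ covers c → +∞ and c → −∞ at once. -/
theorem resolvent_tendsto (σ : ℝ) (hσ : |σ| = 1) (g : H) :
    Tendsto (fun n : ℕ => ((σ * ((n : ℝ) + 1) : ℝ) : ℂ) • hA.resolvent (σ * (n + 1)) g)
      atTop (𝓝 g) := by
  have hσ0 : σ ≠ 0 := by rintro rfl; simp at hσ
  have hc : ∀ n : ℕ, σ * ((n : ℝ) + 1) ≠ 0 := fun n =>
    mul_ne_zero hσ0 (natCast_add_one_ne_zero' n)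
  have habs : ∀ n : ℕ, |σ * ((n : ℝ) + 1)| = (n : ℝ) + 1 := fun n => by
    rw [abs_mul, hσ, one_mul, abs_of_pos (by positivity)]
  have hbd : ∀ (n : ℕ) (y : H),
      ‖((σ * ((n : ℝ) + 1) : ℝ) : ℂ) • hA.resolvent (σ * (n + 1)) y‖ ≤ ‖y‖ := by
    intro n y
    rw [norm_smul, Complex.norm_real, Real.norm_eq_abs]
    have := hA.norm_resolvent_le (hc n) y
    calc _ ≤ |σ * ((n : ℝ) + 1)| * (|σ * ((n : ℝ) + 1)|⁻¹ * ‖y‖) := by gcongr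
      _ = ‖y‖ := by rw [← mul_assoc, mul_inv_cancel₀ (abs_ne_zero.2 (hc n)), one_mul]
  have hdom : ∀ f ∈ A.domain, Tendsto
      (fun n : ℕ => ((σ * ((n : ℝ) + 1) : ℝ) : ℂ) • hA.resolvent (σ * (n + 1)) f)
      atTop (𝓝 f) := by
    intro f hf
    have hfg : (f, A ⟨f, hf⟩) ∈ A.graph := A.mem_graph ⟨f, hf⟩
    rw [tendsto_iff_norm_sub_tendsto_zero]
    have hlim : Tendsto (fun n : ℕ => ((n : ℝ) + 1)⁻¹ * ‖A ⟨f, hf⟩‖) atTop (𝓝 0) := by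
      have := (tendsto_one_div_add_atTop_nhds_zero_nat (𝕜 := ℝ)).mul_const ‖A ⟨f, hf⟩‖
      simpa using this
    refine squeeze_zero (fun _ => norm_nonneg _) (fun n => ?_) hlim
    rw [← hA.resolvent_eq_of_mem (hc n) hfg]
    have := hA.norm_resolvent_le (hc n) (A ⟨f, hf⟩)
    rwa [habs] at this
  rw [Metric.tendsto_atTop]
  intro ε hε
  obtain ⟨f, hf, hfg⟩ := Metric.dense_iff.1 hA.dense g (ε / 3) (by positivity)
  obtain ⟨N, hN⟩ := Metric.tendsto_atTop.1 (hdom f hfg) (ε / 3) (by positivity)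
  refine ⟨N, fun n hn => ?_⟩
  have h1 := hN n hn
  have h2 := hbd n (g - f)
  rw [Metric.mem_ball, dist_eq_norm, norm_sub_rev] at hf
  rw [dist_eq_norm] at h1 ⊢
  set B := hA.resolvent (σ * (n + 1))
  set c : ℂ := ((σ * ((n : ℝ) + 1) : ℝ) : ℂ)
  have e : c • B g - g = c • B (g - f) + (c • B f - f) + (f - g) := by
    rw [map_sub, smul_sub]; abel
  rw [e]
  have h3 : ‖f - g‖ = ‖g - f‖ := norm_sub_rev _ _
  linarith [norm_add₃_le (a := c • B (g - f)) (b := c • B f - f) (c := f - g)]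

/-- On the graph the approximation is the mean of cR(c)g over c = ±(n + 1): the terms cf coming from
`resolvent_eq_of_mem` cancel between the two signs. -/
theorem yosida_tendsto {f g : H} (h : (f, g) ∈ A.graph) :
    Tendsto (fun n => hA.yosida n f) atTop (𝓝 g) := by
  have h1 := hA.resolvent_tendsto 1 (by simp) g
  have h2 := hA.resolvent_tendsto (-1) (by simp) g
  have h3 := (h1.add h2).const_smul (1 / 2 : ℂ)
  have e : (1 / 2 : ℂ) • (g + g) = g := by rw [← two_smul ℂ g, smul_smul]; simp
  rw [e] at h3
  refine h3.congr fun n => ?_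
  have hn := natCast_add_one_ne_zero' n
  simp only [one_mul, neg_one_mul]
  rw [hA.resolvent_eq_of_mem hn h, hA.resolvent_eq_of_mem (neg_ne_zero.2 hn) h]
  simp only [yosida, smul_apply, add_apply]
  push_cast
  module

end IsSkewAdjointPMap

/-! ### Exponentials of bounded skew-adjoint operators. -/

section BoundedGroup

variable {H : Type*} [NormedAddCommGroup H] [InnerProductSpace ℂ H] [CompleteSpace H]

theorem exp_smul_mem_unitary {B : H →L[ℂ] H} (hB : B ∈ skewAdjoint (H →L[ℂ] H)) (t : ℝ) :
    NormedSpace.exp (t • B) ∈ unitary (H →L[ℂ] H) := by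
  let _ : NormedAlgebra ℚ (H →L[ℂ] H) := NormedAlgebra.restrictScalars ℚ ℂ _
  refine NormedSpace.exp_mem_unitary_of_mem_skewAdjoint ?_
  exact skewAdjoint.smul_mem t hB

theorem norm_exp_smul_apply {B : H →L[ℂ] H} (hB : B ∈ skewAdjoint (H →L[ℂ] H)) (t : ℝ) (f : H) :
    ‖NormedSpace.exp (t • B) f‖ = ‖f‖ :=
  ContinuousLinearMap.norm_map_of_mem_unitary (exp_smul_mem_unitary hB t) f

theorem hasDerivAt_exp_smul_apply (B : H →L[ℂ] H) (t : ℝ) (f : H) :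
    HasDerivAt (fun t : ℝ => NormedSpace.exp (t • B) f) (NormedSpace.exp (t • B) (B f)) t := by
  let _ : NormedAlgebra ℝ (H →L[ℂ] H) := NormedAlgebra.restrictScalars ℝ ℂ _
  have h := hasDerivAt_exp_smul_const (𝕂 := ℝ) B t
  have h2 := ((ContinuousLinearMap.apply ℂ H f).restrictScalars ℝ).hasFDerivAt.comp_hasDerivAt t h
  exact h2

theorem norm_exp_smul_sub_le {B : H →L[ℂ] H} (hB : B ∈ skewAdjoint (H →L[ℂ] H)) (s t : ℝ)
    (f : H) : ‖NormedSpace.exp (t • B) f - NormedSpace.exp (s • B) f‖ ≤ ‖B f‖ * |t - s| := by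
  have := Convex.norm_image_sub_le_of_norm_hasDerivWithin_le (𝕜 := ℝ) (s := Set.univ)
    (C := ‖B f‖) (x := s) (y := t)
    (fun x _ => (hasDerivAt_exp_smul_apply B x f).hasDerivWithinAt)
    (fun x _ => (norm_exp_smul_apply hB x _).le) convex_univ trivial trivial
  simpa using this

/-- By commutation e^{tB} = e^{tC}e^{t(B−C)}; the isometry e^{tC} drops out of the norm and the
remaining curve has speed ‖(B − C)f‖. -/
theorem norm_exp_smul_sub_exp_smul_le {B C : H →L[ℂ] H} (hB : B ∈ skewAdjoint (H →L[ℂ] H))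
    (hC : C ∈ skewAdjoint (H →L[ℂ] H)) (hBC : Commute B C) (t : ℝ) (f : H) :
    ‖NormedSpace.exp (t • B) f - NormedSpace.exp (t • C) f‖ ≤ ‖B f - C f‖ * |t| := by
  let _ : NormedAlgebra ℚ (H →L[ℂ] H) := NormedAlgebra.restrictScalars ℚ ℂ _
  have hD : B - C ∈ skewAdjoint (H →L[ℂ] H) := sub_mem hB hC
  have e : NormedSpace.exp (t • B) = NormedSpace.exp (t • C) * NormedSpace.exp (t • (B - C)) := by
    rw [← NormedSpace.exp_add_of_commute]
    · rw [smul_sub]; congr 1; abel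
    · exact ((hBC.symm.sub_right (Commute.refl C)).smul_left t).smul_right t
  have h := norm_exp_smul_sub_le hD 0 t f
  rw [e]
  change ‖NormedSpace.exp (t • C) (NormedSpace.exp (t • (B - C)) f) - NormedSpace.exp (t • C) f‖ ≤ _
  rw [← map_sub, norm_exp_smul_apply hC]
  simpa using h

end BoundedGroup

/-! ### The unitary group as a locally uniform limit. -/

namespace IsSkewAdjointPMap

variable {H : Type*} [NormedAddCommGroup H] [InnerProductSpace ℂ H] [CompleteSpace H]
  {A : H →ₗ.[ℂ] H} (hA : IsSkewAdjointPMap A)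

/-- The unitary group generated by the bounded approximation `hA.yosida n`. -/
def approxGroup (n : ℕ) (t : ℝ) : H →L[ℂ] H := NormedSpace.exp (t • hA.yosida n)

theorem norm_approxGroup (n : ℕ) (t : ℝ) (f : H) : ‖hA.approxGroup n t f‖ = ‖f‖ :=
  norm_exp_smul_apply (hA.yosida_mem_skewAdjoint n) t f

/-- On the domain the difference is at most |t| times the difference of the Yosida approximations,
which is Cauchy. The approximating groups are isometric, so approximating f costs ε/3 on each side.
-/
theorem approxGroup_uniformCauchy (f : H) (T : ℝ) {ε : ℝ} (hε : 0 < ε) :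
    ∃ N, ∀ m ≥ N, ∀ n ≥ N, ∀ t : ℝ, |t| ≤ T →
      ‖hA.approxGroup m t f - hA.approxGroup n t f‖ < ε := by
  obtain ⟨f', hf, hfg⟩ := Metric.dense_iff.1 hA.dense f (ε / 3) (by positivity)
  rw [Metric.mem_ball, dist_eq_norm] at hf
  have hc := (hA.yosida_tendsto (A.mem_graph ⟨f', hfg⟩)).cauchySeq
  obtain ⟨N, hN⟩ := Metric.cauchySeq_iff.1 hc (ε / (3 * (|T| + 1))) (by positivity)
  refine ⟨N, fun m hm n hn t ht => ?_⟩
  have h1 := norm_exp_smul_sub_exp_smul_le (hA.yosida_mem_skewAdjoint m)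
    (hA.yosida_mem_skewAdjoint n) (hA.yosida_commute m n) t f'
  have h2 := hN m hm n hn
  rw [dist_eq_norm] at h2
  have h3 : ‖hA.yosida m f' - hA.yosida n f'‖ * |t| ≤ ε / 3 := by
    calc _ ≤ ε / (3 * (|T| + 1)) * (|T| + 1) := by
          have : |t| ≤ |T| + 1 := ht.trans ((le_abs_self T).trans (by linarith))
          gcongr
      _ = ε / 3 := by field_simp
  have e : hA.approxGroup m t f - hA.approxGroup n t f = hA.approxGroup m t (f - f') +
      (hA.approxGroup m t f' - hA.approxGroup n t f') - hA.approxGroup n t (f - f') := by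
    simp only [map_sub]; abel
  have h4 := hA.norm_approxGroup m t (f - f')
  have h5 := hA.norm_approxGroup n t (f - f')
  rw [norm_sub_rev] at hf
  rw [e]
  have h6 : ‖hA.approxGroup m t f' - hA.approxGroup n t f'‖ ≤ ε / 3 := h1.trans h3
  calc _ ≤ ‖hA.approxGroup m t (f - f')‖ + ‖hA.approxGroup m t f' - hA.approxGroup n t f'‖
        + ‖hA.approxGroup n t (f - f')‖ :=
        (norm_sub_le _ _).trans (add_le_add_left (norm_add_le _ _) _)
    _ < ε := by rw [h4, h5]; linarith

theorem exists_tendsto_approxGroup (t : ℝ) (f : H) :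
    ∃ y, Tendsto (fun n => hA.approxGroup n t f) atTop (𝓝 y) := by
  apply cauchySeq_tendsto_of_complete
  rw [Metric.cauchySeq_iff]
  intro ε hε
  obtain ⟨N, hN⟩ := hA.approxGroup_uniformCauchy f |t| hε
  exact ⟨N, fun m hm n hn => by rw [dist_eq_norm]; exact hN m hm n hn t le_rfl⟩

/-- The unitary group with generator `A`. -/
def group (t : ℝ) : H →L[ℂ] H :=
  (linearMapOfTendsto (l := atTop) (fun f => (hA.exists_tendsto_approxGroup t f).choose)
    (fun n => (hA.approxGroup n t : H →ₗ[ℂ] H))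
    (tendsto_pi_nhds.2 fun f => (hA.exists_tendsto_approxGroup t f).choose_spec)).mkContinuous 1
    (fun f => by
      have h := (hA.exists_tendsto_approxGroup t f).choose_spec.norm
      simp only [norm_approxGroup] at h
      rw [one_mul]
      exact (tendsto_nhds_unique h tendsto_const_nhds).le)

theorem tendsto_group (t : ℝ) (f : H) :
    Tendsto (fun n => hA.approxGroup n t f) atTop (𝓝 (hA.group t f)) :=
  (hA.exists_tendsto_approxGroup t f).choose_spec

theorem norm_group (t : ℝ) (f : H) : ‖hA.group t f‖ = ‖f‖ := by
  have h := (hA.tendsto_group t f).norm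
  simp only [norm_approxGroup] at h
  exact tendsto_nhds_unique h tendsto_const_nhds |>.symm ▸ rfl

theorem tendstoUniformlyOn_group (f : H) (T : ℝ) :
    TendstoUniformlyOn (fun n t => hA.approxGroup n t f) (fun t => hA.group t f) atTop
      (Metric.ball 0 T) := by
  rw [Metric.tendstoUniformlyOn_iff]
  intro ε hε
  obtain ⟨N, hN⟩ := hA.approxGroup_uniformCauchy f T (half_pos hε)
  filter_upwards [eventually_ge_atTop N] with n hn t ht
  rw [Metric.mem_ball, dist_zero_right, Real.norm_eq_abs] at ht
  have h1 := ((hA.tendsto_group t f).sub_const (hA.approxGroup n t f)).norm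
  have h2 : ‖hA.group t f - hA.approxGroup n t f‖ ≤ ε / 2 :=
    le_of_tendsto h1 ((eventually_ge_atTop N).mono fun m hm => (hN m hm n hn t ht.le).le)
  rw [dist_eq_norm]
  linarith

theorem continuous_group (f : H) : Continuous fun t => hA.group t f := by
  rw [continuous_iff_continuousAt]
  intro t
  have h := (hA.tendstoUniformlyOn_group f (|t| + 1)).continuousOn
    (Frequently.of_forall fun n => Continuous.continuousOn <| by
      rw [continuous_iff_continuousAt]
      exact fun t => (hasDerivAt_exp_smul_apply (hA.yosida n) t f).continuousAt)
  exact h.continuousAt (Metric.isOpen_ball.mem_nhds (by simp))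

/-- Both the approximating orbits and their derivatives converge, the latter uniformly on a ball
around t, so the limit may be differentiated. -/
theorem hasDerivAt_group {f g : H} (h : (f, g) ∈ A.graph) (t : ℝ) :
    HasDerivAt (fun t => hA.group t f) (hA.group t g) t := by
  refine hasDerivAt_of_tendstoUniformlyOn (l := atTop) (s := Metric.ball (0 : ℝ) (|t| + 1))
    (f := fun n t => hA.approxGroup n t f)
    (f' := fun n t => hA.approxGroup n t (hA.yosida n f)) (g' := fun t => hA.group t g)
    Metric.isOpen_ball ?_
    (Eventually.of_forall fun n x _ => hasDerivAt_exp_smul_apply (hA.yosida n) x f)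
    (fun x _ => hA.tendsto_group x f) (x := t) (by simp)
  rw [Metric.tendstoUniformlyOn_iff]
  intro ε hε
  have h1 := Metric.tendstoUniformlyOn_iff.1 (hA.tendstoUniformlyOn_group g (|t| + 1)) (ε / 2)
    (half_pos hε)
  have h2 := Metric.tendsto_nhds.1 (hA.yosida_tendsto h) (ε / 2) (half_pos hε)
  filter_upwards [h1, h2] with n h1 h2 x hx
  have h3 := h1 x hx
  have h4 : dist (hA.approxGroup n x g) (hA.approxGroup n x (hA.yosida n f)) < ε / 2 := by
    rw [dist_eq_norm, ← map_sub, norm_approxGroup, ← dist_eq_norm, dist_comm]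
    exact h2
  linarith [dist_triangle (hA.group x g) (hA.approxGroup n x g)
    (hA.approxGroup n x (hA.yosida n f))]

theorem group_zero : hA.group 0 = 1 := by
  ext f
  refine tendsto_nhds_unique (hA.tendsto_group 0 f) ?_
  simp [approxGroup]

theorem group_add (s t : ℝ) : hA.group (s + t) = hA.group s * hA.group t := by
  ext f
  change hA.group (s + t) f = hA.group s (hA.group t f)
  refine tendsto_nhds_unique (hA.tendsto_group (s + t) f) ?_
  have h1 := hA.tendsto_group s (hA.group t f)
  have h2 : Tendsto (fun n => hA.approxGroup n s (hA.approxGroup n t f) -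
      hA.approxGroup n s (hA.group t f)) atTop (𝓝 0) := by
    rw [tendsto_zero_iff_norm_tendsto_zero]
    simp only [← map_sub, norm_approxGroup]
    exact tendsto_iff_norm_sub_tendsto_zero.1 (hA.tendsto_group t f)
  have h3 := h2.add h1
  simp only [sub_add_cancel, zero_add] at h3
  refine h3.congr fun n => ?_
  let _ : NormedAlgebra ℚ (H →L[ℂ] H) := NormedAlgebra.restrictScalars ℚ ℂ _
  simp only [approxGroup]
  rw [add_smul, NormedSpace.exp_add_of_commute]
  · rfl
  · exact ((Commute.refl _).smul_left s).smul_right t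

theorem isUnitaryGroup_group : IsUnitaryGroup hA.group where
  mem_unitary t := by
    have h1 : star (hA.group t) * hA.group t = 1 :=
      (ContinuousLinearMap.norm_map_iff_adjoint_comp_self _).1 (hA.norm_group t)
    have h2 : hA.group t * hA.group (-t) = 1 := by
      rw [← hA.group_add, add_neg_cancel, hA.group_zero]
    refine ⟨h1, ?_⟩
    rwa [left_inv_eq_right_inv h1 h2]
  map_zero := hA.group_zero
  map_add := hA.group_add
  continuous := hA.continuous_group

end IsSkewAdjointPMap

/-! ### Generators of unitary groups and Stone's theorem. -/

section Generator

variable {H : Type*} [NormedAddCommGroup H] [InnerProductSpace ℂ H] [CompleteSpace H]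
  {A : H →ₗ.[ℂ] H} {U : ℝ → H →L[ℂ] H}

theorem IsUnitaryGroup.norm_map (hU : IsUnitaryGroup U) (t : ℝ) (f : H) : ‖U t f‖ = ‖f‖ :=
  ContinuousLinearMap.norm_map_of_mem_unitary (hU.mem_unitary t) f

theorem IsUnitaryGroup.hasDerivAt_iff (hU : IsUnitaryGroup U) {f g : H} :
    HasDerivAt (fun t => U t f) g 0 ↔
      Tendsto (fun t : ℝ => (t : ℂ)⁻¹ • (U t f - f)) (𝓝[≠] 0) (𝓝 g) := by
  rw [hasDerivAt_iff_tendsto_slope_zero]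
  simp only [zero_add, hU.map_zero]
  refine tendsto_congr fun t => ?_
  rw [← Complex.ofReal_inv, Complex.coe_smul]
  rfl

theorem IsUnitaryGroup.hasDerivAt_of_zero (hU : IsUnitaryGroup U) {f g : H}
    (h : HasDerivAt (fun t => U t f) g 0) (t : ℝ) :
    HasDerivAt (fun t => U t f) (U t g) t := by
  have h1 : HasDerivAt (fun r => U (r - t) f) g t := by
    have h0 : HasDerivAt (fun t => U t f) g (t - t) := by rwa [sub_self]
    simpa [Function.comp_def] using HasDerivAt.scomp (h := fun r : ℝ => r - t) t h0
      ((hasDerivAt_id' t).sub_const t)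
  have h2 := ((U t).restrictScalars ℝ).hasFDerivAt.comp_hasDerivAt t h1
  refine h2.congr_of_eventuallyEq (Eventually.of_forall fun r => ?_)
  change U r f = U t (U (r - t) f)
  have : r = t + (r - t) := by ring
  conv_lhs => rw [this, hU.map_add]
  rfl

theorem IsGeneratorOf.hasDerivAt (hAU : IsGeneratorOf A U) (hU : IsUnitaryGroup U) {f g : H}
    (h : (f, g) ∈ A.graph) (t : ℝ) : HasDerivAt (fun t => U t f) (U t g) t :=
  hU.hasDerivAt_of_zero (hU.hasDerivAt_iff.2 ((hAU f g).1 h)) t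

theorem IsGeneratorOf.mem_graph (hAU : IsGeneratorOf A U) (hU : IsUnitaryGroup U) {f g : H}
    (h : (f, g) ∈ A.graph) (t : ℝ) : (U t f, U t g) ∈ A.graph := by
  rw [hAU, ← hU.hasDerivAt_iff]
  have h1 := hAU.hasDerivAt hU h 0
  have h2 := ((U t).restrictScalars ℝ).hasFDerivAt.comp_hasDerivAt 0 h1
  rw [hU.map_zero] at h2
  refine h2.congr_of_eventuallyEq (Eventually.of_forall fun r => ?_)
  change U r (U t f) = U t (U r f)
  have h3 := hU.map_add r t
  have h4 := hU.map_add t r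
  rw [add_comm] at h3
  exact DFunLike.congr_fun (h3.symm.trans h4) f

/-- A unitary group is determined by its (densely defined) generator. -/
theorem IsGeneratorOf.unique (hA : IsSkewAdjointPMap A) {W : ℝ → H →L[ℂ] H}
    (hU : IsUnitaryGroup U) (hAU : IsGeneratorOf A U) (hW : IsUnitaryGroup W)
    (hAW : IsGeneratorOf A W) : U = W := by
  funext t
  have key : ∀ f ∈ A.domain, U t f = W t f := by
    intro f hf
    have hfg := A.mem_graph ⟨f, hf⟩
    set D : ℝ → H := fun r => U r f - W r f with hD
    have hmem : ∀ r, (D r, U r (A ⟨f, hf⟩) - W r (A ⟨f, hf⟩)) ∈ A.graph := fun r =>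
      A.graph.sub_mem (hAU.mem_graph hU hfg r) (hAW.mem_graph hW hfg r)
    have hderiv : ∀ r, HasDerivAt D (U r (A ⟨f, hf⟩) - W r (A ⟨f, hf⟩)) r := fun r =>
      (hAU.hasDerivAt hU hfg r).sub (hAW.hasDerivAt hW hfg r)
    -- Skew-symmetry on the graph cancels the two halves of the derivative of ‖D‖², and D vanishes
    -- at 0.
    have hin : ∀ r, HasDerivAt (fun r => inner ℂ (D r) (D r)) 0 r := by
      intro r
      have h := (hderiv r).inner ℂ (hderiv r)
      rwa [hA.skew (hmem r) (hmem r), add_neg_cancel] at h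
    have hc := is_const_of_deriv_eq_zero (fun r => (hin r).differentiableAt)
      (fun r => (hin r).deriv) t 0
    have hD0 : D 0 = 0 := by simp [hD, hU.map_zero, hW.map_zero]
    simp only [hD0, inner_zero_left] at hc
    exact sub_eq_zero.1 (inner_self_eq_zero.1 hc)
  exact DFunLike.ext' (Continuous.ext_on hA.dense (U t).continuous (W t).continuous key)

/-- The point is maximality. If the orbit of f has derivative g at 0, solve f' − Af' = f − g. Then w
= f − f' has an orbit of constant norm whose derivative at 0 is w itself, so 2‖w‖² = 0 and f lies in
the domain. -/
theorem IsSkewAdjointPMap.isGeneratorOf_group (hA : IsSkewAdjointPMap A) :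
    IsGeneratorOf A hA.group := by
  have hU := hA.isUnitaryGroup_group
  have hderiv : ∀ {f g : H}, (f, g) ∈ A.graph → HasDerivAt (fun t => hA.group t f) g 0 := by
    intro f g h
    simpa [hA.group_zero] using hA.hasDerivAt_group h 0
  intro f g
  rw [← hU.hasDerivAt_iff]
  refine ⟨hderiv, fun h => ?_⟩
  obtain ⟨f', hf'⟩ := hA.surj 1 one_ne_zero (f - g)
  simp only [Complex.ofReal_one, one_smul] at hf'
  have h1 : HasDerivAt (fun t => hA.group t (f - f')) (f - f') 0 := by
    have := h.sub (hderiv hf')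
    convert this using 1
    · ext t; simp
    · abel
  have hin := h1.inner ℂ h1
  have hconst : HasDerivAt (fun t => inner ℂ (hA.group t (f - f')) (hA.group t (f - f')))
      (0 : ℂ) 0 := by
    simp only [inner_self_eq_norm_sq_to_K, hA.norm_group]
    exact hasDerivAt_const _ _
  have h0 := hin.unique hconst
  simp only [hA.group_zero, one_apply_eq_self, ← two_mul] at h0
  have h2 : inner ℂ (f - f') (f - f') = 0 := by simpa using h0
  have h3 : f = f' := sub_eq_zero.1 (inner_self_eq_zero.1 h2)
  subst h3
  simpa using hf'

/-- Stone's theorem: a self-adjoint operator generates a unique unitary group. -/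
theorem IsSkewAdjointPMap.existsUnique_group (hA : IsSkewAdjointPMap A) :
    ∃! U : ℝ → H →L[ℂ] H, IsUnitaryGroup U ∧ IsGeneratorOf A U :=
  ⟨hA.group, ⟨hA.isUnitaryGroup_group, hA.isGeneratorOf_group⟩, fun _ hV =>
    IsGeneratorOf.unique hA hV.1 hV.2 hA.isUnitaryGroup_group hA.isGeneratorOf_group⟩

end Generator

/-! ### Chernoff's product theorem. -/

section Chernoff

variable {H : Type*} [NormedAddCommGroup H] [InnerProductSpace ℂ H] [CompleteSpace H]
  {A : H →ₗ.[ℂ] H} {U : ℝ → H →L[ℂ] H} {S : ℝ → H →L[ℂ] H}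

/-- For a contraction `S`, `Q = h (1 + h - S)⁻¹` is a contraction. -/
theorem exists_contraction_resolvent {S : H →L[ℂ] H} (hS : ‖S‖ ≤ 1) {h : ℝ} (hh : 0 < h) :
    ∃ Q : H →L[ℂ] H, (∀ x, Q (x - h⁻¹ • (S x - x)) = x) ∧ (∀ x, Q (S x) = S (Q x)) ∧
      ∀ x, ‖Q x‖ ≤ ‖x‖ := by
  have h1 : (0 : ℝ) < 1 + h := by positivity
  have hlt : ‖(((1 + h)⁻¹ : ℝ) : ℂ) • S‖ < 1 := by
    rw [norm_smul, Complex.norm_real, Real.norm_of_nonneg (by positivity)]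
    calc _ ≤ (1 + h)⁻¹ * 1 := by gcongr
      _ < 1 := by rw [mul_one]; exact inv_lt_one_of_one_lt₀ (by linarith)
  -- Neumann series: 1 − S/(1+h) is invertible, and Q is h/(1+h) times its inverse.
  set u := Units.oneSub _ hlt with hu
  have hinv : ∀ x, (↑u⁻¹ : H →L[ℂ] H) (x - (((1 + h)⁻¹ : ℝ) : ℂ) • S x) = x := fun x =>
    DFunLike.congr_fun u.inv_mul x
  have hinv' : ∀ x, (↑u⁻¹ : H →L[ℂ] H) x -
      (((1 + h)⁻¹ : ℝ) : ℂ) • S ((↑u⁻¹ : H →L[ℂ] H) x) = x := fun x =>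
    DFunLike.congr_fun u.mul_inv x
  have hQ : ∀ x, (↑u⁻¹ : H →L[ℂ] H) ((((h / (1 + h)) : ℝ) : ℂ) • (x - h⁻¹ • (S x - x))) = x := by
    intro x
    conv_rhs => rw [← hinv x]
    congr 1
    rw [← Complex.coe_smul h⁻¹]
    have e1 : (h : ℂ) ≠ 0 := by exact_mod_cast hh.ne'
    have e2 : (1 + h : ℂ) ≠ 0 := by exact_mod_cast h1.ne'
    push_cast
    rw [smul_sub, smul_smul, smul_sub]
    have e3 : (h : ℂ) / (1 + h) * (h : ℂ)⁻¹ = (1 + h : ℂ)⁻¹ := by field_simp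
    rw [e3]
    have e4 : x = ((h : ℂ) / (1 + h)) • x + (1 + h : ℂ)⁻¹ • x := by
      rw [← add_smul]
      have : (h : ℂ) / (1 + h) + (1 + h : ℂ)⁻¹ = 1 := by field_simp; ring
      rw [this, one_smul]
    nth_rewrite 4 [e4]
    abel
  refine ⟨(((h / (1 + h)) : ℝ) : ℂ) • (↑u⁻¹ : H →L[ℂ] H), fun x => ?_, fun x => ?_, fun x => ?_⟩
  · rw [smul_apply, ← map_smul]
    exact hQ x
  · simp only [smul_apply, map_smul]
    congr 1
    conv_lhs => rw [← hinv' x]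
    rw [map_sub, map_smul]
    exact hinv _
  · have h2 := hinv' x
    simp only [smul_apply]
    rw [norm_smul, Complex.norm_real, Real.norm_of_nonneg (by positivity)]
    set y := (↑u⁻¹ : H →L[ℂ] H) x
    have h3 : ‖(((1 + h)⁻¹ : ℝ) : ℂ) • S y‖ ≤ (1 + h)⁻¹ * ‖y‖ := by
      rw [norm_smul, Complex.norm_real, Real.norm_of_nonneg (by positivity)]
      gcongr
      exact (S.le_of_opNorm_le hS y).trans (one_mul _).le
    have h4 : ‖y‖ - (1 + h)⁻¹ * ‖y‖ ≤ ‖x‖ := by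
      rw [← h2]
      exact (sub_le_sub_left h3 _).trans (norm_sub_norm_le _ _)
    have h5 : h / (1 + h) = 1 - (1 + h)⁻¹ := by field_simp; ring
    rw [h5]
    linarith

theorem IsSkewAdjointPMap.norm_resolvent_one_le (hA : IsSkewAdjointPMap A) (y : H) :
    ‖hA.resolvent 1 y‖ ≤ ‖y‖ := by
  simpa using hA.norm_resolvent_le one_ne_zero y

theorem IsSkewAdjointPMap.resolvent_one_mem (hA : IsSkewAdjointPMap A) (y : H) :
    (hA.resolvent 1 y, hA.resolvent 1 y - y) ∈ A.graph := by
  simpa using hA.resolvent_mem one_ne_zero y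

theorem IsSkewAdjointPMap.resolvent_one_eq (hA : IsSkewAdjointPMap A) {f g : H}
    (h : (f, g) ∈ A.graph) : hA.resolvent 1 (f - g) = f := by
  simpa using hA.resolvent_eq one_ne_zero h

/-- The range of R is the dense domain, and R is a contraction, so approximating inside R does not
enlarge the error. -/
theorem IsSkewAdjointPMap.dense_resolvent_sq (hA : IsSkewAdjointPMap A) (f : H) {ε : ℝ}
    (hε : 0 < ε) : ∃ g, ‖hA.resolvent 1 (hA.resolvent 1 g) - f‖ < ε := by
  obtain ⟨f₁, h₁, hf₁⟩ := Metric.dense_iff.1 hA.dense f (ε / 2) (half_pos hε)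
  have e₁ := hA.resolvent_one_eq (A.mem_graph ⟨f₁, hf₁⟩)
  set y := f₁ - A ⟨f₁, hf₁⟩
  obtain ⟨f₂, h₂, hf₂⟩ := Metric.dense_iff.1 hA.dense y (ε / 2) (half_pos hε)
  have e₂ := hA.resolvent_one_eq (A.mem_graph ⟨f₂, hf₂⟩)
  refine ⟨f₂ - A ⟨f₂, hf₂⟩, ?_⟩
  · rw [e₂]
    rw [Metric.mem_ball, dist_eq_norm] at h₁ h₂
    have h3 := hA.norm_resolvent_one_le (f₂ - y)
    rw [map_sub, e₁] at h3
    simp only at h3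
    have h4 := norm_add_le (hA.resolvent 1 f₂ - f₁) (f₁ - f)
    rw [sub_add_sub_cancel] at h4
    linarith

/-- A set of contractions converging strongly converges uniformly on compact sets. -/
theorem exists_forall_norm_sub_lt_of_isCompact {ι : Type*} {l : Filter ι} {Q : ι → H →L[ℂ] H}
    {R : H →L[ℂ] H} (hQ : ∀ᶠ i in l, ∀ x, ‖Q i x‖ ≤ ‖x‖) (hR : ∀ x, ‖R x‖ ≤ ‖x‖)
    (hlim : ∀ x, Tendsto (fun i => Q i x) l (𝓝 (R x))) {K : Set H} (hK : IsCompact K) {ε : ℝ}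
    (hε : 0 < ε) : ∀ᶠ i in l, ∀ x ∈ K, ‖Q i x - R x‖ < ε := by
  obtain ⟨t, -, htf, ht⟩ := hK.finite_cover_balls (e := ε / 3) (by positivity)
  have h1 : ∀ᶠ i in l, ∀ y ∈ t, ‖Q i y - R y‖ < ε / 3 := by
    rw [Filter.eventually_all_finite htf]
    intro y _
    have := Metric.tendsto_nhds.1 (hlim y) (ε / 3) (by positivity)
    simpa only [dist_eq_norm] using this
  filter_upwards [hQ, h1] with i hi h1 x hx
  obtain ⟨y, hy, hxy⟩ := Set.mem_iUnion₂.1 (ht hx)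
  rw [Metric.mem_ball, dist_eq_norm] at hxy
  have e : Q i x - R x = Q i (x - y) + (Q i y - R y) - R (x - y) := by
    simp only [map_sub]; abel
  rw [e]
  have h2 := hi (x - y)
  have h3 := hR (x - y)
  have h4 := h1 y hy
  have h5 := norm_sub_le (Q i (x - y) + (Q i y - R y)) (R (x - y))
  have h6 := norm_add_le (Q i (x - y)) (Q i y - R y)
  linarith

/-- Chernoff's theorem for a unitary group: if the contractions `S h` have the derivative `A` at
`h = 0` on a core of the generator `A` of `U`, then `S h ^ n` is close to `U (n h)` for small `h`,
uniformly for `n h ≤ T`. -/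
theorem chernoff (hA : IsSkewAdjointPMap A) (hU : IsUnitaryGroup U) (hAU : IsGeneratorOf A U)
    (hS : ∀ h, 0 < h → ‖S h‖ ≤ 1) {D : Set (H × H)} (hDA : (A.graph : Set (H × H)) ⊆ closure D)
    (hSD : ∀ p ∈ D, Tendsto (fun h : ℝ => h⁻¹ • (S h p.1 - p.1)) (𝓝[>] 0) (𝓝 p.2))
    (f : H) (T : ℝ) {ε : ℝ} (hε : 0 < ε) :
    ∀ᶠ h in 𝓝[>] (0 : ℝ), ∀ n : ℕ, n * h ≤ T → ‖(S h ^ n) f - U (n * h) f‖ < ε := by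
  have hex : ∀ h : ℝ, ∃ Q : H →L[ℂ] H, 0 < h → (∀ x, Q (x - h⁻¹ • (S h x - x)) = x) ∧
      (∀ x, Q (S h x) = S h (Q x)) ∧ ∀ x, ‖Q x‖ ≤ ‖x‖ := by
    intro h
    by_cases hh : 0 < h
    · obtain ⟨Q, hQ⟩ := exists_contraction_resolvent (hS h hh) hh
      exact ⟨Q, fun _ => hQ⟩
    · exact ⟨0, fun h' => absurd h' hh⟩
  choose Q hQ using hex
  have hpos : ∀ᶠ h in 𝓝[>] (0 : ℝ), 0 < h := eventually_mem_nhdsWithin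
  have hQn : ∀ᶠ h in 𝓝[>] (0 : ℝ), ∀ x, ‖Q h x‖ ≤ ‖x‖ := hpos.mono fun h hh => (hQ h hh).2.2
  set R := hA.resolvent 1 with hRdef
  have hR : ∀ x, ‖R x‖ ≤ ‖x‖ := hA.norm_resolvent_one_le
  have hRU : ∀ t x, R (U t x) = U t (R x) := by
    intro t x
    have := hAU.mem_graph hU (hA.resolvent_one_mem x) t
    have h2 := hA.resolvent_one_eq this
    rwa [← map_sub, sub_sub_cancel] at h2
  have hSn : ∀ h, 0 < h → ∀ (n : ℕ) x, ‖(S h ^ n) x‖ ≤ ‖x‖ := by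
    intro h hh n x
    induction n with
    | zero => simp
    | succ n ih =>
      rw [pow_succ']
      exact ((S h).le_of_opNorm_le (hS h hh) _).trans (by rwa [one_mul])
  have hUn : ∀ t x, ‖U t x‖ = ‖x‖ := hU.norm_map
  -- Strong resolvent convergence. For (f, g) in D close to (Ry, Ry − y), the identity Q(f − (Sf −
  -- f)/h) = f reduces Qy − Ry to these two distances and the slope error on D.
  have hlim : ∀ y, Tendsto (fun h => Q h y) (𝓝[>] 0) (𝓝 (R y)) := by
    intro y
    rw [Metric.tendsto_nhds]
    intro ε hε
    obtain ⟨⟨f, g⟩, hfg, hd⟩ := Metric.mem_closure_iff.1 (hDA (hA.resolvent_one_mem y)) (ε / 4)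
      (by positivity)
    rw [Prod.dist_eq, max_lt_iff, dist_eq_norm, dist_eq_norm] at hd
    obtain ⟨hd1, hd2⟩ := hd
    have hlim := Metric.tendsto_nhds.1 (hSD _ hfg) (ε / 4) (by positivity)
    filter_upwards [hpos, hlim] with h hh hl
    rw [dist_eq_norm] at hl ⊢
    obtain ⟨q1, q2, q3⟩ := hQ h hh
    simp only [] at hd1 hd2 hl
    have e : Q h y - R y = Q h (y - (f - g)) + Q h (h⁻¹ • (S h f - f) - g) - (R y - f) := by
      conv_rhs => rw [← map_add]
      have : y - (f - g) + (h⁻¹ • (S h f - f) - g) = y - (f - h⁻¹ • (S h f - f)) := by abel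
      rw [this, map_sub, q1]
      abel
    have h1 := q3 (y - (f - g))
    have h2 := q3 (h⁻¹ • (S h f - f) - g)
    have h3 : ‖y - (f - g)‖ ≤ ‖R y - f‖ + ‖R y - y - g‖ := by
      have : y - (f - g) = (R y - f) - (R y - y - g) := by abel
      rw [this]; exact norm_sub_le _ _
    have h4 := norm_sub_le (Q h (y - (f - g)) + Q h (h⁻¹ • (S h f - f) - g)) (R y - f)
    have h5 := norm_add_le (Q h (y - (f - g))) (Q h (h⁻¹ • (S h f - f) - g))
    rw [e]
    linarith
  have hcomp : ∀ g, IsCompact ((fun t => U t g) '' Set.Icc 0 T) := fun g =>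
    isCompact_Icc.image (hU.continuous g)
  have horb : ∀ (g : H) (h : ℝ) (n : ℕ), 0 < h → n * h ≤ T →
      U (n * h) g ∈ (fun t => U t g) '' Set.Icc 0 T := fun g h n hh hn =>
    ⟨n * h, ⟨by positivity, hn⟩, rfl⟩
  have hmain : ∀ g, ∀ ε > 0, ∀ᶠ h in 𝓝[>] (0 : ℝ), ∀ n : ℕ, n * h ≤ T →
      ‖Q h ((S h ^ n) (R g) - U (n * h) (R g))‖ ≤ ε := by
    intro g ε hε
    -- One step of length h costs at most 2ηh, and nh ≤ T, so the total stays below ε.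
    have hη : 0 < ε / (2 * (|T| + 1)) := by positivity
    set η := ε / (2 * (|T| + 1)) with hηdef
    have h1 := exists_forall_norm_sub_lt_of_isCompact hQn hR hlim (hcomp g) hη
    have h2 : ∀ᶠ h in 𝓝[>] (0 : ℝ), ‖h⁻¹ • (U h (R g) - R g) - (R g - g)‖ < η := by
      have h3 := hAU.hasDerivAt hU (hA.resolvent_one_mem g) 0
      rw [hasDerivAt_iff_tendsto_slope_zero] at h3
      simp only [zero_add, hU.map_zero] at h3
      have h4 := h3.mono_left (nhdsWithin_mono (0 : ℝ) (fun x (hx : 0 < x) => hx.ne'))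
      have h5 := Metric.tendsto_nhds.1 h4 η hη
      simp only [dist_eq_norm] at h5
      exact h5
    filter_upwards [hpos, h1, h2] with h hh h1 h2 n
    obtain ⟨q1, q2, q3⟩ := hQ h hh
    have hne : h ≠ 0 := hh.ne'
    have hstep : ∀ n : ℕ, n * h ≤ T →
        ‖Q h (S h (U (n * h) (R g)) - U h (U (n * h) (R g)))‖ ≤ h * (2 * η) := by
      intro n hn
      set t := n * h
      -- The identity Q(S − 1) = h(Q − 1) replaces the slope of S, which is uncontrolled off the
      -- core, by Q itself.
      have e1 : Q h (S h (U t (R g)) - U t (R g)) = h • (Q h (U t (R g)) - U t (R g)) := by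
        have := q1 (U t (R g))
        rw [map_sub] at this
        have e : S h (U t (R g)) - U t (R g) = h • (h⁻¹ • (S h (U t (R g)) - U t (R g))) := by
          rw [smul_smul, mul_inv_cancel₀ hne, one_smul]
        rw [e, ← Complex.coe_smul h, map_smul, Complex.coe_smul]
        congr 1
        rw [eq_sub_iff_add_eq, add_comm]
        exact (sub_eq_iff_eq_add.1 this).symm
      have hUU : U h (U t (R g)) = U t (U h (R g)) := by
        have h3 := hU.map_add h t
        have h4 := hU.map_add t h
        rw [add_comm] at h3
        exact DFunLike.congr_fun (h3.symm.trans h4) _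
      have e2 : U h (U t (R g)) - U t (R g) =
          h • (U t (h⁻¹ • (U h (R g) - R g) - (R g - g))) + h • (U t (R g) - U t g) := by
        rw [hUU, ← smul_add, ← map_sub, ← map_sub, ← map_add, sub_add_cancel,
          ← Complex.coe_smul h, ← map_smul, Complex.coe_smul, smul_smul, mul_inv_cancel₀ hne,
          one_smul]
      -- The terms QURg cancel. What remains is Q − R on the orbit of g, small uniformly because the
      -- orbit over [0, T] is compact, and the slope error of U at Rg.
      have e3 : Q h (S h (U t (R g)) - U h (U t (R g))) =
          h • ((Q h (U t g) - R (U t g)) -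
            Q h (U t (h⁻¹ • (U h (R g) - R g) - (R g - g)))) := by
        have : S h (U t (R g)) - U h (U t (R g)) = (S h (U t (R g)) - U t (R g)) -
            (U h (U t (R g)) - U t (R g)) := by abel
        rw [this, map_sub, e1, e2, ← Complex.coe_smul h, ← Complex.coe_smul h,
          ← Complex.coe_smul h, ← smul_add, map_smul, ← smul_sub, map_add,
          map_sub (Q h) (U t (R g)),
          hRU, Complex.coe_smul]
        congr 1
        abel
      rw [e3, norm_smul, Real.norm_of_nonneg hh.le]
      gcongr
      have h6 := h1 _ (horb g h n hh hn)
      have h7 := q3 (U t (h⁻¹ • (U h (R g) - R g) - (R g - g)))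
      rw [hUn] at h7
      have h8 := norm_sub_le (Q h (U t g) - R (U t g))
        (Q h (U t (h⁻¹ • (U h (R g) - R g) - (R g - g))))
      linarith
    have hind : ∀ n : ℕ, n * h ≤ T →
        ‖Q h ((S h ^ n) (R g) - U (n * h) (R g))‖ ≤ (n * h) * (2 * η) := by
      intro n
      induction n with
      | zero => intro _; simp [hU.map_zero]
      | succ n ih =>
        intro hn
        rw [Nat.cast_succ] at hn ⊢
        have hn' : n * h ≤ T := by nlinarith
        have e1 : (S h ^ (n + 1)) (R g) = S h ((S h ^ n) (R g)) := by rw [pow_succ']; rfl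
        have e2 : U ((n + 1) * h) (R g) = U h (U (n * h) (R g)) := by
          have : ((n : ℝ) + 1) * h = h + n * h := by ring
          rw [this, hU.map_add]; rfl
        have e3 : Q h (S h ((S h ^ n) (R g)) - U h (U (n * h) (R g))) =
            S h (Q h ((S h ^ n) (R g) - U (n * h) (R g))) +
              Q h (S h (U (n * h) (R g)) - U h (U (n * h) (R g))) := by
          rw [← q2, ← map_add]
          congr 1
          rw [map_sub]
          abel
        rw [e1, e2, e3]
        have h3 := (S h).le_of_opNorm_le (hS h hh) (Q h ((S h ^ n) (R g) - U (n * h) (R g)))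
        have h4 := ih hn'
        have h5 := hstep n hn'
        have h6 := norm_add_le (S h (Q h ((S h ^ n) (R g) - U (n * h) (R g))))
          (Q h (S h (U (n * h) (R g)) - U h (U (n * h) (R g))))
        linarith
    intro hn
    refine (hind n hn).trans ?_
    have h3 : (n * h : ℝ) ≤ |T| + 1 := hn.trans ((le_abs_self T).trans (by linarith))
    calc n * h * (2 * η) ≤ (|T| + 1) * (2 * η) := by gcongr
      _ = ε := by rw [hηdef]; field_simp
  -- Replace f by R²g. One R is the right-hand smoothing of `hmain`; the other is exchanged for Q,
  -- which commutes with Sⁿ. Five errors of size ε/8 result.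
  obtain ⟨g, hg⟩ := hA.dense_resolvent_sq f (ε := ε / 8) (by positivity)
  rw [← hRdef] at hg
  have h1 := hmain g (ε / 8) (by positivity)
  have h2 := exists_forall_norm_sub_lt_of_isCompact hQn hR hlim (hcomp (R g))
    (ε := ε / 8) (by positivity)
  have h3 := Metric.tendsto_nhds.1 (hlim (R g)) (ε / 8) (by positivity)
  filter_upwards [hpos, h1, h2, h3] with h hh h1 h2 h3 n hn
  obtain ⟨q1, q2, q3⟩ := hQ h hh
  have hQS : ∀ (n : ℕ) x, Q h ((S h ^ n) x) = (S h ^ n) (Q h x) := by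
    intro n
    induction n with
    | zero => intro x; simp
    | succ n ih =>
      intro x
      rw [pow_succ']
      change Q h (S h ((S h ^ n) x)) = S h ((S h ^ n) (Q h x))
      rw [q2, ih]
  have e : (S h ^ n) f - U (n * h) f = (S h ^ n) (f - R (R g)) - U (n * h) (f - R (R g))
      - (S h ^ n) (Q h (R g) - R (R g)) + (Q h (U (n * h) (R g)) - R (U (n * h) (R g)))
      + Q h ((S h ^ n) (R g) - U (n * h) (R g)) := by
    simp only [map_sub, hQS, hRU]
    abel
  have h4 := hSn h hh n (f - R (R g))
  have h5 := hUn (n * h) (f - R (R g))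
  have h6 := hSn h hh n (Q h (R g) - R (R g))
  have h7 := h2 _ (horb (R g) h n hh hn)
  have h8 := h1 n hn
  rw [dist_eq_norm] at h3
  rw [norm_sub_rev] at hg
  rw [e]
  refine (norm_add_le _ _).trans_lt ?_
  refine (add_le_add_left ((norm_add_le _ _).trans (add_le_add_left ((norm_sub_le _ _).trans
    (add_le_add_left (norm_sub_le _ _) _)) _)) _).trans_lt ?_
  linarith

end Chernoff

/-! ### The symplectic form, left-invariant fields, their flows and integration by parts. -/

namespace Heis

variable {d : ℕ}

theorem symp_eq_inner (z w : Plane d) : symp z w = inner ℝ (tilde z) w := by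
  simp only [symp, tilde, PiLp.inner_apply, Fintype.sum_sum_type, Sum.elim_inl, Sum.elim_inr]
  rw [← Finset.sum_add_distrib]
  refine Finset.sum_congr rfl fun i _ => ?_
  simp
  ring

theorem tilde_add (z w : Plane d) : tilde (z + w) = tilde z + tilde w := by
  ext (i | i) <;> simp [tilde]
  ring

theorem tilde_smul (c : ℝ) (z : Plane d) : tilde (c • z) = c • tilde z := by
  ext (i | i) <;> simp [tilde]

theorem norm_tilde (z : Plane d) : ‖tilde z‖ = ‖z‖ := by
  simp only [EuclideanSpace.norm_eq, tilde, Fintype.sum_sum_type, Sum.elim_inl, Sum.elim_inr,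
    norm_neg]
  rw [add_comm]

theorem symp_self (z : Plane d) : symp z z = 0 := by
  simp only [symp]
  exact Finset.sum_eq_zero fun i _ => by ring

theorem inner_tilde_self (z : Plane d) : inner ℝ (tilde z) z = 0 := by
  rw [← symp_eq_inner, symp_self]

theorem symp_swap (z w : Plane d) : symp z w = -symp w z := by
  simp only [symp]
  rw [← Finset.sum_neg_distrib]
  exact Finset.sum_congr rfl fun i _ => by ring

theorem symp_add_left (z z' w : Plane d) : symp (z + z') w = symp z w + symp z' w := by
  simp only [symp_eq_inner, tilde_add, inner_add_left]

theorem symp_add_right (z w w' : Plane d) : symp z (w + w') = symp z w + symp z w' := by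
  simp only [symp_eq_inner, inner_add_right]

theorem symp_smul_left (c : ℝ) (z w : Plane d) : symp (c • z) w = c * symp z w := by
  simp only [symp_eq_inner, tilde_smul, real_inner_smul_left]

theorem symp_smul_right (c : ℝ) (z w : Plane d) : symp z (c • w) = c * symp z w := by
  simp only [symp_eq_inner, real_inner_smul_right]

theorem symp_sub_right (z w w' : Plane d) : symp z (w - w') = symp z w - symp z w' := by
  simp only [symp_eq_inner, inner_sub_right]

theorem contDiff_tilde : ContDiff ℝ ∞ (tilde : Plane d → Plane d) := by
  rw [contDiff_euclidean]
  rintro (i | i) <;> simp only [tilde, Sum.elim_inl, Sum.elim_inr] <;> fun_prop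

theorem contDiff_symp : ContDiff ℝ ∞ (fun p : Plane d × Plane d => symp p.1 p.2) := by
  simp only [symp_eq_inner]
  exact (contDiff_tilde.comp contDiff_fst).inner ℝ contDiff_snd

theorem _root_.ContDiff.symp {E : Type*} [NormedAddCommGroup E] [NormedSpace ℝ E]
    {f g : E → Plane d} (hf : ContDiff ℝ ∞ f) (hg : ContDiff ℝ ∞ g) :
    ContDiff ℝ ∞ (fun x => symp (f x) (g x)) :=
  contDiff_symp.comp (hf.prodMk hg)

theorem _root_.Continuous.symp {E : Type*} [TopologicalSpace E]
    {f g : E → Plane d} (hf : Continuous f) (hg : Continuous g) :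
    Continuous (fun x => symp (f x) (g x)) :=
  contDiff_symp.continuous.comp (hf.prodMk hg)

/-- The left-invariant vector field with value `v` at the origin, `v` horizontal. -/
def field (v : Plane d) (f : Heis d → ℂ) (p : Heis d) : ℂ := fderiv ℝ f p (v, symp p.1 v)

/-- The standard basis of the horizontal plane. -/
def basisVec (j : Fin d ⊕ Fin d) : Plane d := EuclideanSpace.single j 1

theorem symp_basisVec (z : Plane d) (j : Fin d ⊕ Fin d) : symp z (basisVec j) = tilde z j := by
  rw [symp_eq_inner, basisVec, EuclideanSpace.inner_single_right]
  simp

theorem fieldX_eq (i : Fin d) (f : Heis d → ℂ) : fieldX i f = field (basisVec (Sum.inl i)) f := by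
  ext p
  rw [fieldX, field, symp_basisVec]
  rfl

theorem fieldY_eq (i : Fin d) (f : Heis d → ℂ) : fieldY i f = field (basisVec (Sum.inr i)) f := by
  ext p
  rw [fieldY, field, symp_basisVec]
  rfl

theorem subLaplacianFun_eq (f : Heis d → ℂ) (p : Heis d) :
    subLaplacianFun f p = ∑ j, field (basisVec j) (field (basisVec j) f) p := by
  rw [Fintype.sum_sum_type, ← Finset.sum_add_distrib]
  simp only [subLaplacianFun, fieldX_eq, fieldY_eq]

theorem field_mem (v : Plane d) {f : Heis d → ℂ} (hf : f ∈ testFunctions d) :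
    field v f ∈ testFunctions d := by
  refine ⟨?_, ?_⟩
  · have h1 : ContDiff ℝ ∞ (fderiv ℝ f) := hf.1.fderiv_right (by simp)
    exact h1.clm_apply (contDiff_const.prodMk (contDiff_fst.symp contDiff_const))
  · refine (hf.2.fderiv (𝕜 := ℝ)).mono ?_
    intro p hp h
    exact hp (by simp [field, h])

/-- The flow of the left-invariant vector field `field v`. -/
def flow (v : Plane d) (t : ℝ) (p : Heis d) : Heis d := (p.1 + t • v, p.2 + t * symp p.1 v)

theorem flow_zero (v : Plane d) (p : Heis d) : flow v 0 p = p := by simp [flow]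

theorem continuous_flow (v : Plane d) : Continuous (fun x : ℝ × Heis d => flow v x.1 x.2) := by
  unfold flow
  exact ((by fun_prop : Continuous fun x : ℝ × Heis d => x.2.1 + x.1 • v)).prodMk
    ((by fun_prop : Continuous fun x : ℝ × Heis d => x.2.2).add
      (continuous_fst.mul ((by fun_prop : Continuous fun x : ℝ × Heis d => x.2.1).symp
        continuous_const)))

theorem flow_flow (v : Plane d) (s t : ℝ) (p : Heis d) :
    flow v s (flow v t p) = flow v (s + t) p := by
  simp only [flow, symp_add_left, symp_smul_left, symp_self, Prod.mk.injEq]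
  constructor
  · module
  · ring

theorem hasDerivAt_flow (v : Plane d) (t : ℝ) (p : Heis d) :
    HasDerivAt (fun t => flow v t p) (v, symp p.1 v) t := by
  unfold flow
  refine HasDerivAt.prodMk ?_ ?_
  · simpa using ((hasDerivAt_id' t).smul_const v).const_add p.1
  · simpa using ((hasDerivAt_id' t).mul_const (symp p.1 v)).const_add p.2

theorem hasDerivAt_comp_flow {f : Heis d → ℂ} (hf : f ∈ testFunctions d) (v : Plane d) (t : ℝ)
    (p : Heis d) : HasDerivAt (fun t => f (flow v t p)) (field v f (flow v t p)) t := by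
  have h := (testFunction_differentiable hf (flow v t p)).hasFDerivAt.comp_hasDerivAt t
    (hasDerivAt_flow v t p)
  have e : symp (flow v t p).1 v = symp p.1 v := by
    simp [flow, symp_add_left, symp_smul_left, symp_self]
  unfold field
  rwa [e]

/-- A skew product: on each fibre over z the map is a translation of s. This covers all right
translations of the group. -/
theorem measurePreserving_shift {z₀ : Plane d} {g : Plane d → ℝ} (hg : Continuous g) :
    MeasurePreserving (fun p : Heis d => (p.1 + z₀, p.2 + g p.1)) volume volume := by
  refine MeasurePreserving.skew_product (f := fun z : Plane d => z + z₀)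
    (g := fun z s => s + g z) (measurePreserving_add_right volume z₀) ?_ ?_
  · exact Continuous.measurable (by fun_prop)
  · exact Eventually.of_forall fun z => (measurePreserving_add_right volume (g z)).map_eq

theorem measurePreserving_flow (v : Plane d) (t : ℝ) :
    MeasurePreserving (flow v t) (volume : Measure (Heis d)) volume :=
  measurePreserving_shift (g := fun z => t * symp z v)
    (continuous_const.mul (continuous_id.symp continuous_const))

theorem testFunction_integrable_mul {f u : Heis d → ℂ} (hf : f ∈ testFunctions d)
    (hu : LocallyIntegrable u (volume : Measure (Heis d))) : Integrable (fun q => f q * u q) :=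
  hu.integrable_smul_left_of_hasCompactSupport hf.1.continuous hf.2

theorem comp_flow_mem {f : Heis d → ℂ} (hf : f ∈ testFunctions d) (v : Plane d) (t : ℝ) :
    (fun q => f (flow v t q)) ∈ testFunctions d := by
  refine ⟨hf.1.comp ?_, ?_⟩
  · unfold flow
    exact (by fun_prop : ContDiff ℝ ∞ fun p : Heis d => p.1 + t • v).prodMk
      (contDiff_snd.add (contDiff_const.mul (contDiff_fst.symp contDiff_const)))
  · refine HasCompactSupport.intro (K := flow v (-t) '' tsupport f)
      (IsCompact.image hf.2 ((continuous_flow v).comp (by fun_prop :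
        Continuous fun q : Heis d => ((-t, q) : ℝ × Heis d)))) fun q hq => ?_
    by_contra h
    refine hq ⟨flow v t q, subset_tsupport f h, ?_⟩
    rw [flow_flow, neg_add_cancel, flow_zero]

/-- Differentiation along the flow under the integral sign. -/
theorem hasDerivAt_integral_flow {f u : Heis d → ℂ} (hf : f ∈ testFunctions d)
    (hu : LocallyIntegrable u (volume : Measure (Heis d))) (v : Plane d) (t : ℝ) :
    HasDerivAt (fun t => ∫ q, f (flow v t q) * u q) (∫ q, field v f (flow v t q) * u q) t := by
  have hf' := field_mem v hf
  obtain ⟨C, hC⟩ := hf'.1.continuous.bounded_above_of_compact_support hf'.2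
  set K : Set (Heis d) := (fun x : ℝ × Heis d => flow v (-x.1) x.2) ''
    (Set.Icc (t - 1) (t + 1) ×ˢ tsupport (field v f)) with hK
  have hKc : IsCompact K := (isCompact_Icc.prod hf'.2).image
    ((continuous_flow v).comp (by fun_prop :
      Continuous fun x : ℝ × Heis d => ((-x.1, x.2) : ℝ × Heis d)))
  refine (hasDerivAt_integral_of_dominated_loc_of_deriv_le
    (F := fun t q => f (flow v t q) * u q)
    (F' := fun t q => field v f (flow v t q) * u q) (s := Set.Icc (t - 1) (t + 1))
    (bound := fun q => C * K.indicator (fun q => ‖u q‖) q) (x₀ := t)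
    (Icc_mem_nhds (by linarith) (by linarith)) (Eventually.of_forall fun r => ?_) ?_ ?_ ?_ ?_ ?_).2
  · exact (testFunction_integrable_mul (comp_flow_mem hf v r) hu).aestronglyMeasurable
  · exact testFunction_integrable_mul (comp_flow_mem hf v t) hu
  · exact (testFunction_integrable_mul (comp_flow_mem hf' v t) hu).aestronglyMeasurable
  · refine Eventually.of_forall fun q r hr => ?_
    rw [norm_mul]
    by_cases h0 : field v f (flow v r q) = 0
    · rw [h0, norm_zero, zero_mul]
      exact mul_nonneg ((norm_nonneg _).trans (hC q))
        (Set.indicator_nonneg (fun _ _ => norm_nonneg _) _)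
    · have hq : q ∈ K := ⟨(r, flow v r q), ⟨hr, subset_tsupport _ h0⟩, by
        simp only [flow_flow, neg_add_cancel, flow_zero]⟩
      rw [Set.indicator_of_mem hq]
      gcongr
      exact hC _
  · exact ((integrable_indicator_iff hKc.measurableSet).2
      (hu.integrableOn_isCompact hKc).norm).const_mul C
  · exact Eventually.of_forall fun q r _ => (hasDerivAt_comp_flow hf v r q).mul_const _

/-- The flow preserves Haar measure, so the integral along it is constant, while its derivative at
time 0 is the integral of the field. -/
theorem integral_field_eq_zero {f : Heis d → ℂ} (hf : f ∈ testFunctions d) (v : Plane d) :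
    ∫ q, field v f q = 0 := by
  have h := hasDerivAt_integral_flow hf (u := fun _ => 1)
    (locallyIntegrable_const (1 : ℂ)) v 0
  simp only [mul_one, flow_zero] at h
  have hc : ∀ t, ∫ q, f (flow v t q) = ∫ q, f q := by
    intro t
    have hmp := measurePreserving_flow v t
    conv_rhs => rw [← hmp.map_eq]
    exact (integral_map hmp.measurable.aemeasurable
      hf.1.continuous.aestronglyMeasurable).symm
  simp only [hc] at h
  exact h.unique (hasDerivAt_const _ _)

theorem conj_mem {f : Heis d → ℂ} (hf : f ∈ testFunctions d) :
    (fun p => (starRingEnd ℂ) (f p)) ∈ testFunctions d :=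
  ⟨Complex.conjCLE.contDiff.comp hf.1, hf.2.comp_left (g := starRingEnd ℂ) (map_zero _)⟩

theorem field_conj {f : Heis d → ℂ} (hf : f ∈ testFunctions d) (v : Plane d) :
    field v (fun p => (starRingEnd ℂ) (f p)) = fun p => (starRingEnd ℂ) (field v f p) := by
  ext p
  have h := (Complex.conjCLE : ℂ ≃L[ℝ] ℂ).toContinuousLinearMap.hasFDerivAt.comp p
    (testFunction_differentiable hf p).hasFDerivAt
  have h2 : fderiv ℝ (fun p => (starRingEnd ℂ) (f p)) p = _ := h.fderiv
  rw [field, h2]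
  rfl

theorem subLaplacianFun_conj {f : Heis d → ℂ} (hf : f ∈ testFunctions d) :
    subLaplacianFun (fun p => (starRingEnd ℂ) (f p)) =
      fun p => (starRingEnd ℂ) (subLaplacianFun f p) := by
  ext p
  simp only [subLaplacianFun_eq, field_conj hf, field_conj (field_mem _ hf), map_sum]

theorem mul_mem {f g : Heis d → ℂ} (hf : f ∈ testFunctions d) (hg : g ∈ testFunctions d) :
    (fun p => f p * g p) ∈ testFunctions d :=
  ⟨hf.1.mul hg.1, hf.2.mul_right⟩

theorem field_mul {f g : Heis d → ℂ} (hf : f ∈ testFunctions d) (hg : g ∈ testFunctions d)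
    (v : Plane d) (p : Heis d) :
    field v (fun p => f p * g p) p = f p * field v g p + field v f p * g p := by
  have h := (testFunction_differentiable hf p).hasFDerivAt.mul
    (testFunction_differentiable hg p).hasFDerivAt
  have h2 : fderiv ℝ (fun p => f p * g p) p = _ := h.fderiv
  rw [field, h2]
  simp [field]
  ring

theorem integral_mul_field {f g : Heis d → ℂ} (hf : f ∈ testFunctions d)
    (hg : g ∈ testFunctions d) (v : Plane d) :
    ∫ p, f p * field v g p = -∫ p, field v f p * g p := by
  have h := integral_field_eq_zero (mul_mem hf hg) v
  have hint : ∀ {f g : Heis d → ℂ}, f ∈ testFunctions d → g ∈ testFunctions d →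
      Integrable (fun p => f p * g p) := fun hf hg =>
    testFunction_integrable_mul hf (hg.1.continuous.locallyIntegrable)
  simp only [field_mul hf hg] at h
  rw [integral_add (hint hf (field_mem v hg)) (hint (field_mem v hf) hg)] at h
  exact eq_neg_of_add_eq_zero_left h

theorem testFunction_integrable {f : Heis d → ℂ} (hf : f ∈ testFunctions d) : Integrable f :=
  hf.1.continuous.integrable_of_hasCompactSupport hf.2

theorem integral_mul_subLaplacianFun {f g : Heis d → ℂ} (hf : f ∈ testFunctions d)
    (hg : g ∈ testFunctions d) :
    ∫ p, f p * subLaplacianFun g p =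
      -∑ j, ∫ p, field (basisVec j) f p * field (basisVec j) g p := by
  simp only [subLaplacianFun_eq, Finset.mul_sum]
  rw [integral_finsetSum, ← Finset.sum_neg_distrib]
  · exact Finset.sum_congr rfl fun j _ => integral_mul_field hf (field_mem _ hg) _
  · exact fun j _ => testFunction_integrable (mul_mem hf (field_mem _ (field_mem _ hg)))

end Heis

/-! ### Group convolution, the maximum principle and uniqueness of weak solutions. -/

/-- The second derivative is nonpositive at a local maximum. -/
theorem IsLocalMax.second_deriv_nonpos {m m' : ℝ → ℝ} {x a : ℝ} (h : IsLocalMax m x)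
    (hm : ∀ t, HasDerivAt m (m' t) t) (hm' : HasDerivAt m' a x) : a ≤ 0 := by
  by_contra! ha
  have e : deriv m = m' := funext fun t => (hm t).deriv
  have h1 : IsLocalMin m x := by
    apply isLocalMin_of_deriv_deriv_pos
    · rw [e, hm'.deriv]; exact ha
    · exact h.deriv_eq_zero
    · exact (hm x).continuousAt
  have h2 : m =ᶠ[𝓝 x] fun _ => m x := by
    filter_upwards [h, h1] with t ht ht'
    exact le_antisymm ht ht'
  have h3 : m' =ᶠ[𝓝 x] fun _ => 0 := by
    filter_upwards [h2.eventuallyEq_nhds] with t ht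
    exact (hm t).unique ((hasDerivAt_const t (m x)).congr_of_eventuallyEq ht)
  have h4 := hm'.unique ((hasDerivAt_const x (0 : ℝ)).congr_of_eventuallyEq h3)
  exact ha.ne' h4

namespace Heis

variable {d : ℕ}

/-- The group difference `p * q⁻¹`. -/
def mulInv (p q : Heis d) : Heis d := (p.1 - q.1, p.2 - q.2 - symp p.1 q.1)

/-- The solution `q` of `p * q⁻¹ = r`. -/
def invMul (p r : Heis d) : Heis d := (p.1 - r.1, p.2 - r.2 + symp p.1 r.1)

theorem invMul_mulInv (p q : Heis d) : invMul p (mulInv p q) = q := by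
  simp only [invMul, mulInv, symp_sub_right, symp_self, Prod.ext_iff]
  exact ⟨by abel, by ring⟩

theorem contDiff_mulInv : ContDiff ℝ ∞ (fun x : Heis d × Heis d => mulInv x.1 x.2) := by
  unfold mulInv
  exact (by fun_prop : ContDiff ℝ ∞ fun x : Heis d × Heis d => x.1.1 - x.2.1).prodMk
    ((by fun_prop : ContDiff ℝ ∞ fun x : Heis d × Heis d => x.1.2 - x.2.2).sub
      ((by fun_prop : ContDiff ℝ ∞ fun x : Heis d × Heis d => x.1.1).symp
        (by fun_prop : ContDiff ℝ ∞ fun x : Heis d × Heis d => x.2.1)))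

theorem continuous_invMul : Continuous (fun x : Heis d × Heis d => invMul x.1 x.2) := by
  unfold invMul
  exact (by fun_prop : Continuous fun x : Heis d × Heis d => x.1.1 - x.2.1).prodMk
    ((by fun_prop : Continuous fun x : Heis d × Heis d => x.1.2 - x.2.2).add
      ((by fun_prop : Continuous fun x : Heis d × Heis d => x.1.1).symp
        (by fun_prop : Continuous fun x : Heis d × Heis d => x.2.1)))

/-- The flow is right multiplication by exp(tv), and (p·exp(tv))·q⁻¹ = p·(q·exp(−tv))⁻¹. Derivatives
of a convolution in p thus become derivatives of the test function in q, where the weak equation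
applies. -/
theorem mulInv_flow (v : Plane d) (t : ℝ) (p q : Heis d) :
    mulInv (flow v t p) q = mulInv p (flow v (-t) q) := by
  simp only [mulInv, flow, symp_add_left, symp_add_right, symp_smul_left, symp_smul_right,
    Prod.ext_iff]
  refine ⟨by module, ?_⟩
  rw [symp_swap q.1 v]
  ring

theorem measurePreserving_mulInv (p : Heis d) :
    MeasurePreserving (mulInv p) (volume : Measure (Heis d)) volume := by
  refine MeasurePreserving.skew_product (f := fun z : Plane d => p.1 - z)
    (g := fun z s => p.2 - s - symp p.1 z) (Measure.measurePreserving_sub_left volume p.1) ?_ ?_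
  · apply Continuous.measurable
    exact (by fun_prop : Continuous fun x : Plane d × ℝ => p.2 - x.2).sub
      (continuous_const.symp continuous_fst)
  · refine Eventually.of_forall fun z => ?_
    have := (Measure.measurePreserving_sub_left volume (p.2 - symp p.1 z)).map_eq
    have e : (fun s => p.2 - s - symp p.1 z) = fun t => p.2 - symp p.1 z - t := by
      ext s
      ring
    exact (congrArg (fun f => Measure.map f volume) e).trans this

theorem comp_mulInv_mem {ρ : Heis d → ℂ} (hρ : ρ ∈ testFunctions d) (p : Heis d) :
    (fun q => ρ (mulInv p q)) ∈ testFunctions d := by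
  refine ⟨hρ.1.comp (contDiff_mulInv.comp (contDiff_const.prodMk contDiff_id)), ?_⟩
  refine HasCompactSupport.intro (K := invMul p '' tsupport ρ)
    (IsCompact.image hρ.2 (continuous_invMul.comp (by fun_prop :
      Continuous fun q : Heis d => ((p, q) : Heis d × Heis d)))) fun q hq => ?_
  by_contra h
  exact hq ⟨mulInv p q, subset_tsupport ρ h, invMul_mulInv p q⟩

/-- The convolution `∫ ρ(p * q⁻¹) u(q) dq`. -/
def mollify (ρ u : Heis d → ℂ) (p : Heis d) : ℂ := ∫ q, ρ (mulInv p q) * u q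

theorem continuous_mollify {ρ u : Heis d → ℂ} (hρ : ρ ∈ testFunctions d)
    (hu : LocallyIntegrable u (volume : Measure (Heis d))) : Continuous (mollify ρ u) := by
  rw [continuous_iff_continuousAt]
  intro p
  obtain ⟨C, hC⟩ := hρ.1.continuous.bounded_above_of_compact_support hρ.2
  set K : Set (Heis d) := (fun x : Heis d × Heis d => invMul x.1 x.2) ''
    (Metric.closedBall p 1 ×ˢ tsupport ρ) with hK
  have hKc : IsCompact K := ((isCompact_closedBall p 1).prod hρ.2).image continuous_invMul
  refine continuousAt_of_dominated (bound := fun q => C * K.indicator (fun q => ‖u q‖) q)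
    (Eventually.of_forall fun r => ?_) ?_ ?_ ?_
  · exact (testFunction_integrable_mul (comp_mulInv_mem hρ r) hu).aestronglyMeasurable
  · filter_upwards [Metric.closedBall_mem_nhds p one_pos] with r hr
    refine Eventually.of_forall fun q => ?_
    rw [norm_mul]
    by_cases h0 : ρ (mulInv r q) = 0
    · rw [h0, norm_zero, zero_mul]
      exact mul_nonneg ((norm_nonneg _).trans (hC q))
        (Set.indicator_nonneg (fun _ _ => norm_nonneg _) _)
    · have hq : q ∈ K := ⟨(r, mulInv r q), ⟨hr, subset_tsupport _ h0⟩, invMul_mulInv r q⟩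
      rw [Set.indicator_of_mem hq]
      gcongr
      exact hC _
  · exact ((integrable_indicator_iff hKc.measurableSet).2
      (hu.integrableOn_isCompact hKc).norm).const_mul C
  · refine Eventually.of_forall fun q => ContinuousAt.mul ?_ continuousAt_const
    exact (hρ.1.continuous.comp (contDiff_mulInv.continuous.comp
      (by fun_prop : Continuous fun p : Heis d => ((p, q) : Heis d × Heis d)))).continuousAt

/-- The crude bound ab ≤ a² + b² with invariance of the measure suffices: only boundedness in p is
used by the maximum principle. -/
theorem norm_mollify_le {ρ u : Heis d → ℂ} (hρ : ρ ∈ testFunctions d)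
    (hu : MemLp u 2 (volume : Measure (Heis d))) (p : Heis d) :
    ‖mollify ρ u p‖ ≤ (∫ q, ‖ρ q‖ ^ 2) + ∫ q, ‖u q‖ ^ 2 := by
  have h2 : Integrable (fun q => ‖u q‖ ^ 2) := hu.integrable_norm_pow two_ne_zero
  have h1 : Integrable (fun q => ‖ρ (mulInv p q)‖ ^ 2) :=
    (memLp_of_mem (comp_mulInv_mem hρ p)).integrable_norm_pow two_ne_zero
  have e : ∫ q, ‖ρ (mulInv p q)‖ ^ 2 = ∫ q, ‖ρ q‖ ^ 2 := by
    have hmp := measurePreserving_mulInv p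
    conv_rhs => rw [← hmp.map_eq]
    exact (integral_map (f := fun q => ‖ρ q‖ ^ 2) hmp.measurable.aemeasurable
      (hρ.1.continuous.norm.pow 2).aestronglyMeasurable).symm
  rw [← e, ← integral_add h1 h2]
  refine norm_integral_le_of_norm_le (h1.add h2) (Eventually.of_forall fun q => ?_)
  rw [norm_mul]
  nlinarith [sq_nonneg (‖ρ (mulInv p q)‖ - ‖u q‖), sq_nonneg (‖ρ (mulInv p q)‖),
    sq_nonneg (‖u q‖)]

/-- A mollified weak solution of `L u = c u` is twice differentiable along horizontal lines and
satisfies the equation pointwise. -/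
theorem mollify_hasDerivAt {ρ u : Heis d → ℂ} (hρ : ρ ∈ testFunctions d)
    (hu : LocallyIntegrable u (volume : Measure (Heis d))) (v : Plane d) (p : Heis d) :
    ∃ g : ℝ → ℂ, (∀ t, HasDerivAt (fun t => mollify ρ u (flow v t p)) (g t) t) ∧
      HasDerivAt g (∫ q, field v (field v fun q => ρ (mulInv p q)) q * u q) 0 := by
  have hw := comp_mulInv_mem hρ p
  set w : Heis d → ℂ := fun q => ρ (mulInv p q)
  have e : ∀ t, mollify ρ u (flow v t p) = ∫ q, w (flow v (-t) q) * u q := fun t => by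
    simp only [mollify, mulInv_flow, w]
  -- Each derivative contributes a sign from the backward flow, so the second one comes out
  -- positive.
  refine ⟨fun t => -∫ q, field v w (flow v (-t) q) * u q, fun t => ?_, ?_⟩
  · simp only [e]
    have := HasDerivAt.scomp (h := fun r : ℝ => -r) t (hasDerivAt_integral_flow hw hu v (-t))
      (hasDerivAt_neg t)
    simpa [Function.comp_def] using this
  · have := HasDerivAt.scomp (h := fun r : ℝ => -r) 0
      (by simpa using hasDerivAt_integral_flow (field_mem v hw) hu v (-0)) (hasDerivAt_neg (0 : ℝ))
    simpa [Function.comp_def, flow_zero] using this.fun_neg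

theorem norm_add_smul_basisVec_sq (z : Plane d) (t : ℝ) (j : Fin d ⊕ Fin d) :
    ‖z + t • basisVec j‖ ^ 2 = ‖z‖ ^ 2 + 2 * t * z j + t ^ 2 := by
  rw [norm_add_sq_real, real_inner_smul_right, norm_smul, basisVec,
    EuclideanSpace.inner_single_right, PiLp.norm_single]
  simp
  ring

/-- The maximum principle: a bounded solution of `L v = (4d + 2) v` is nonpositive. -/
theorem nonpos_of_bounded_solution {v : Heis d → ℝ} (hc : Continuous v) {C : ℝ}
    (hb : ∀ p, v p ≤ C)
    (hd : ∀ p, ∃ (g : Fin d ⊕ Fin d → ℝ → ℝ) (g' : Fin d ⊕ Fin d → ℝ),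
      (∀ j t, HasDerivAt (fun t => v (flow (basisVec j) t p)) (g j t) t) ∧
      (∀ j, HasDerivAt (g j) (g' j) 0) ∧ ∑ j, g' j = (4 * d + 2) * v p) (p : Heis d) :
    v p ≤ 0 := by
  by_contra! hp
  -- The barrier: it grows at infinity, so v − εh attains its maximum, and Lh = 4d + 2|z|² is at
  -- most (4d+2)h.
  set h : Heis d → ℝ := fun p => 1 + ‖p.1‖ ^ 2 + p.2 ^ 2 with hh
  have hpos : ∀ p, 0 < h p := fun p => by simp only [hh]; positivity
  have hge : ∀ p : Heis d, ‖p‖ ^ 2 ≤ h p := by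
    intro p
    have h2 : ‖p.2‖ ^ 2 = p.2 ^ 2 := by simp
    rcases max_choice ‖p.1‖ ‖p.2‖ with h1 | h1 <;> rw [Prod.norm_def, h1] <;> simp only [hh]
    · nlinarith [sq_nonneg p.2]
    · nlinarith [sq_nonneg ‖p.1‖]
  have hhc : Continuous h := by simp only [hh]; fun_prop
  -- Then εh(p) = v(p)/2, so the perturbed function is still positive at p.
  set ε := v p / (2 * h p) with hε
  have hε0 : 0 < ε := div_pos hp (mul_pos two_pos (hpos p))
  set F : Heis d → ℝ := fun q => v q - ε * h q with hF
  have hFp : 0 < F p := by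
    have : ε * h p = v p / 2 := by rw [hε]; have := (hpos p).ne'; field_simp
    simp only [hF]; rw [this]; linarith
  have hFc : Continuous F := hc.sub (continuous_const.mul hhc)
  obtain ⟨p₀, hp₀⟩ : ∃ p₀, ∀ q, F q ≤ F p₀ := by
    refine hFc.exists_forall_ge' p ?_
    have ht : Tendsto (fun q : Heis d => C - ε * ‖q‖ ^ 2) (cocompact _) atBot := by
      have h1 := (tendsto_norm_cocompact_atTop (E := Heis d))
      have h2 := ((tendsto_pow_atTop two_ne_zero).comp h1).const_mul_atTop hε0
      exact tendsto_const_nhds.add_atBot (tendsto_neg_atTop_atBot.comp h2)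
    filter_upwards [ht.eventually_lt_atBot 0] with q hq
    have : F q ≤ C - ε * ‖q‖ ^ 2 := by
      simp only [hF]
      have := hb q
      have := mul_le_mul_of_nonneg_left (hge q) hε0.le
      linarith
    linarith
  obtain ⟨g, g', hg, hg', hsum⟩ := hd p₀
  have hj : ∀ j, g' j ≤ ε * (2 + 2 * tilde p₀.1 j ^ 2) := by
    intro j
    set c := tilde p₀.1 j with hcdef
    have hflow : ∀ t, h (flow (basisVec j) t p₀) =
        h p₀ + t * (2 * p₀.1 j + 2 * p₀.2 * c) + t ^ 2 * (1 + c ^ 2) := by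
      intro t
      simp only [hh, flow, norm_add_smul_basisVec_sq, symp_basisVec, ← hcdef]
      ring
    have hloc : IsLocalMax (fun t => F (flow (basisVec j) t p₀)) 0 := by
      refine Eventually.of_forall fun t => ?_
      simp only [flow_zero]
      exact hp₀ _
    have hm : ∀ t, HasDerivAt (fun t => F (flow (basisVec j) t p₀))
        (g j t - ε * ((2 * p₀.1 j + 2 * p₀.2 * c) + 2 * t * (1 + c ^ 2))) t := by
      intro t
      refine (hg j t).sub (HasDerivAt.const_mul ε ?_)
      simp only [hflow]
      have h1 := ((hasDerivAt_id' t).mul_const (2 * p₀.1 j + 2 * p₀.2 * c)).const_add (h p₀)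
      have h2 := (hasDerivAt_pow 2 t).mul_const (1 + c ^ 2)
      simpa using h1.fun_add h2
    have hm' : HasDerivAt (fun t => g j t - ε * ((2 * p₀.1 j + 2 * p₀.2 * c) +
        2 * t * (1 + c ^ 2))) (g' j - ε * (2 * (1 + c ^ 2))) 0 := by
      refine (hg' j).sub (HasDerivAt.const_mul ε ?_)
      have h1 := (((hasDerivAt_id' (0 : ℝ)).const_mul 2).mul_const (1 + c ^ 2)).const_add
        (2 * p₀.1 j + 2 * p₀.2 * c)
      simpa using h1
    have := hloc.second_deriv_nonpos hm hm'
    linarith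
  have hsum2 : ∑ j, g' j ≤ ε * (4 * d + 2 * ‖p₀.1‖ ^ 2) := by
    refine (Finset.sum_le_sum fun j _ => hj j).trans (le_of_eq ?_)
    rw [← Finset.mul_sum, Finset.sum_add_distrib, ← Finset.mul_sum]
    have : ∑ j, tilde p₀.1 j ^ 2 = ‖p₀.1‖ ^ 2 := by
      rw [← norm_tilde, EuclideanSpace.norm_sq_eq]
      simp
    rw [this]
    simp
    left
    ring
  rw [hsum] at hsum2
  have hle : (4 * d + 2 * ‖p₀.1‖ ^ 2 : ℝ) ≤ (4 * d + 2) * h p₀ := by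
    simp only [hh]
    have : (0 : ℝ) ≤ d := Nat.cast_nonneg d
    nlinarith [mul_nonneg this (sq_nonneg ‖p₀.1‖), mul_nonneg this (sq_nonneg p₀.2),
      sq_nonneg p₀.2]
  -- At the maximum (4d+2)v = Lv ≤ εLh ≤ (4d+2)εh, contradicting positivity of the maximum of v −
  -- εh.
  have h3 : v p₀ ≤ ε * h p₀ := by
    have h4 := hsum2.trans (mul_le_mul_of_nonneg_left hle hε0.le)
    have h5 : (0 : ℝ) < 4 * d + 2 := by positivity
    nlinarith
  have h6 := hp₀ p
  simp only [hF] at h6 hFp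
  linarith

/-- Testing the weak equation against q ↦ ρ(p·q⁻¹) gives the pointwise equation for the convolution
at p, and its real part is bounded and continuous. -/
theorem mollify_re_nonpos {ρ u : Heis d → ℂ} (hρ : ρ ∈ testFunctions d)
    (hu : MemLp u 2 (volume : Measure (Heis d)))
    (hL : ∀ f ∈ testFunctions d, ∫ q, subLaplacianFun f q * u q =
      (4 * d + 2 : ℝ) * ∫ q, f q * u q) (p : Heis d) : (mollify ρ u p).re ≤ 0 := by
  have hul : LocallyIntegrable u (volume : Measure (Heis d)) :=
    hu.locallyIntegrable one_le_two
  refine nonpos_of_bounded_solution (v := fun p => (mollify ρ u p).re)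
    (Complex.continuous_re.comp (continuous_mollify hρ hul))
    (fun p => (Complex.re_le_norm _).trans (norm_mollify_le hρ hu p)) (fun p => ?_) p
  choose g hg hg' using fun j => mollify_hasDerivAt hρ hul (basisVec j) p
  refine ⟨fun j t => (g j t).re, fun j =>
    (∫ q, field (basisVec j) (field (basisVec j) fun q => ρ (mulInv p q)) q * u q).re,
    fun j t => ?_, fun j => ?_, ?_⟩
  · exact Complex.reCLM.hasFDerivAt.comp_hasDerivAt t (hg j t)
  · exact Complex.reCLM.hasFDerivAt.comp_hasDerivAt 0 (hg' j)
  · have h := hL _ (comp_mulInv_mem hρ p)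
    simp only [subLaplacianFun_eq, Finset.sum_mul] at h
    rw [integral_finsetSum _ fun j _ => testFunction_integrable_mul
      (field_mem _ (field_mem _ (comp_mulInv_mem hρ p))) hul] at h
    have h2 := congrArg Complex.re h
    rw [Complex.re_sum, Complex.re_ofReal_mul] at h2
    exact h2

theorem neg_comp_mem {f : Heis d → ℂ} (hf : f ∈ testFunctions d) :
    (fun p => f (-p)) ∈ testFunctions d :=
  ⟨hf.1.comp contDiff_neg, hf.2.comp_homeomorph (Homeomorph.neg (Heis d))⟩

/-- An `L²` function that vanishes against all test functions is zero. -/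
theorem eq_zero_of_integral_testFunction {u : HeisL2 d}
    (h : ∀ f ∈ testFunctions d, ∫ q, f q * u q = 0) : u = 0 := by
  have hu : LocallyIntegrable u (volume : Measure (Heis d)) :=
    (Lp.memLp u).locallyIntegrable one_le_two
  rw [Lp.eq_zero_iff_ae_eq_zero]
  refine ae_eq_zero_of_integral_contDiff_smul_eq_zero hu fun g hg hgc => ?_
  have := h (fun q => (g q : ℂ)) ⟨Complex.ofRealCLM.contDiff.comp hg,
    hgc.comp_left (g := fun x : ℝ => (x : ℂ)) (by simp)⟩
  simpa using this

/-- There is no nonzero `L²` weak solution of `L u = (4d + 2) u`. -/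
theorem eq_zero_of_weak_solution {u : HeisL2 d}
    (hL : ∀ f ∈ testFunctions d, ∫ q, subLaplacianFun f q * u q =
      (4 * d + 2 : ℝ) * ∫ q, f q * u q) : u = 0 := by
  -- The equation is linear, so the sign bound holds for cu as well; c = ±1, ±i then force the
  -- convolution to vanish.
  have hc : ∀ (c : ℂ) (ρ : Heis d → ℂ) (_ : ρ ∈ testFunctions d) (p : Heis d),
      (c * mollify ρ u p).re ≤ 0 := by
    intro c ρ hρ p
    have h := mollify_re_nonpos hρ ((Lp.memLp u).const_mul c) (fun f hf => by
      simp only [mul_left_comm _ c, integral_const_mul, hL f hf]) p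
    simpa only [mollify, mul_left_comm _ c, integral_const_mul] using h
  have h0 : ∀ ρ ∈ testFunctions d, ∀ p, mollify ρ u p = 0 := by
    intro ρ hρ p
    have h1 := hc 1 ρ hρ p
    have h2 := hc (-1) ρ hρ p
    have h3 := hc Complex.I ρ hρ p
    have h4 := hc (-Complex.I) ρ hρ p
    simp at h1 h2 h3 h4
    exact Complex.ext (le_antisymm h1 h2) (le_antisymm h4 h3)
  refine eq_zero_of_integral_testFunction fun f hf => ?_
  -- At the origin 0·q⁻¹ = −q, so convolving with f(−·) there pairs u with f.
  have := h0 _ (neg_comp_mem hf) 0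
  simpa [mollify, mulInv, symp_eq_inner, tilde_smul, show tilde (0 : Plane d) = 0 by
    simpa using tilde_smul (0 : ℝ) (0 : Plane d)] using this

/-! ### Self-adjointness of the horizontal Laplacian. -/

theorem inner_testToL2 (f : testFunctions d) (u : HeisL2 d) :
    inner ℂ (testToL2 d f) u = ∫ q, (starRingEnd ℂ) (f.1 q) * u q := by
  rw [L2.inner_def]
  refine integral_congr_ae ?_
  filter_upwards [(memLp_of_mem f.2).coeFn_toLp] with q hq
  change inner ℂ ((memLp_of_mem f.2).toLp f.1 q) (u q) = _
  rw [hq, RCLike.inner_apply, mul_comm]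

theorem inner_testToL2_testToL2 (f g : testFunctions d) :
    inner ℂ (testToL2 d f) (testToL2 d g) = ∫ q, (starRingEnd ℂ) (f.1 q) * g.1 q := by
  rw [inner_testToL2]
  refine integral_congr_ae ?_
  filter_upwards [(memLp_of_mem g.2).coeFn_toLp] with q hq
  change _ * ((memLp_of_mem g.2).toLp g.1 q) = _
  rw [hq]

theorem minimalLaplacian_mem_graph (f : testFunctions d) :
    (testToL2 d f, testToL2 d (subLaplacian d f)) ∈ (minimalLaplacian d).graph := by
  rw [LinearPMap.mem_graph_iff]
  refine ⟨⟨testToL2 d f, f, rfl⟩, rfl, ?_⟩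
  have e : (LinearEquiv.ofInjective (testToL2 d) (testToL2_injective d)).symm
      ⟨testToL2 d f, f, rfl⟩ = f := by
    rw [LinearEquiv.symm_apply_eq]
    rfl
  change testToL2 d (subLaplacian d ((LinearEquiv.ofInjective (testToL2 d)
    (testToL2_injective d)).symm ⟨testToL2 d f, f, rfl⟩)) = _
  rw [e]

theorem minimalLaplacian_exists (x : (minimalLaplacian d).domain) :
    ∃ f : testFunctions d, (x : HeisL2 d) = testToL2 d f ∧
      minimalLaplacian d x = testToL2 d (subLaplacian d f) := by
  obtain ⟨f, hf⟩ := x.2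
  refine ⟨f, hf.symm, ?_⟩
  have h := minimalLaplacian_mem_graph f
  rw [hf] at h
  obtain ⟨y, hy, hy'⟩ := (LinearPMap.mem_graph_iff _).1 h
  rwa [Subtype.ext hy] at hy'

/-- Integration by parts gives ⟨f, Lg⟩ = −Σ_j ⟨X_j f, X_j g⟩, hence symmetry and nonpositivity. A
vector orthogonal to the range of (4d+2) − L₀ is a weak solution of the resolvent equation, so it is
zero. -/
theorem horizontalLaplacian_spec (d : ℕ) :
    (minimalLaplacian d).IsClosable ∧ IsSelfAdjoint (horizontalLaplacian d) := by
  have hsub : ∀ f : testFunctions d, (subLaplacian d f).1 = subLaplacianFun f.1 := fun _ => rfl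
  have key : ∀ f g : testFunctions d, inner ℂ (testToL2 d f) (testToL2 d (subLaplacian d g)) =
      -∑ j, ∫ p, (starRingEnd ℂ) (field (basisVec j) f.1 p) * field (basisVec j) g.1 p := by
    intro f g
    rw [inner_testToL2_testToL2, hsub, integral_mul_subLaplacianFun (conj_mem f.2) g.2]
    simp only [field_conj f.2]
  refine isSelfAdjoint_closure_of_dense_range ?_ ?_ ?_ (c := 4 * d + 2) (by positivity) ?_
  · change Dense ((LinearMap.range (testToL2 d) : Submodule ℂ (HeisL2 d)) : Set (HeisL2 d))
    rw [Submodule.dense_iff_topologicalClosure_eq_top, Submodule.topologicalClosure_eq_top_iff,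
      Submodule.eq_bot_iff]
    intro u hu
    refine eq_zero_of_integral_testFunction fun f hf => ?_
    have := (Submodule.mem_orthogonal _ _).1 hu _ ⟨⟨_, conj_mem hf⟩, rfl⟩
    rw [inner_testToL2] at this
    simpa using this
  · intro x y
    obtain ⟨f, hf, hf'⟩ := minimalLaplacian_exists x
    obtain ⟨g, hg, hg'⟩ := minimalLaplacian_exists y
    rw [hf, hf', hg, hg', key, ← inner_conj_symm, key]
    simp only [map_neg, map_sum, ← integral_conj, map_mul, Complex.conj_conj]
    congr 1
    refine Finset.sum_congr rfl fun j _ => integral_congr_ae (Eventually.of_forall fun p => ?_)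
    simp only
    ring
  · intro x
    obtain ⟨f, hf, hf'⟩ := minimalLaplacian_exists x
    rw [hf, hf', key]
    rw [Complex.neg_re, Complex.re_sum, neg_nonpos]
    refine Finset.sum_nonneg fun j _ => ?_
    have e : ∀ p, (starRingEnd ℂ) (field (basisVec j) f.1 p) * field (basisVec j) f.1 p =
        ((‖field (basisVec j) f.1 p‖ ^ 2 : ℝ) : ℂ) := fun p => by
      rw [Complex.conj_mul']; push_cast; rfl
    simp only [e, integral_complex_ofReal, Complex.ofReal_re]
    positivity
  · intro u hu
    refine eq_zero_of_weak_solution fun f hf => ?_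
    obtain ⟨x, hx, hx'⟩ := (LinearPMap.mem_graph_iff _).1
      (minimalLaplacian_mem_graph ⟨_, conj_mem hf⟩)
    have h := hu x
    simp only at hx hx'
    rw [hx, hx', inner_sub_left, inner_smul_left, inner_testToL2,
      inner_testToL2, hsub, sub_eq_zero] at h
    simp only [subLaplacianFun_conj hf, Complex.conj_conj, Complex.conj_ofReal] at h
    exact h.symm

end Heis

/-! ### The partial Fourier transform along a splitting, shared by the central and the horizontal
variables. -/

/-- A splitting of `E` along a Euclidean direction `Y`: a projection `P` with section `J`. -/
structure Splitting (E Y : Type) [NormedAddCommGroup E] [NormedSpace ℝ E]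
    [NormedAddCommGroup Y] [InnerProductSpace ℝ Y] where
  /-- the projection -/
  P : E →L[ℝ] Y
  /-- the section -/
  J : Y →L[ℝ] E
  P_J : ∀ y, P (J y) = y

namespace Splitting

open FourierTransform SchwartzMap

variable {E Y : Type} [NormedAddCommGroup E] [NormedSpace ℝ E]
    [NormedAddCommGroup Y] [InnerProductSpace ℝ Y] (σ : Splitting E Y)

/-- The projection onto the kernel of `P`. -/
def N : E →L[ℝ] E := ContinuousLinearMap.id ℝ E - σ.J.comp σ.P

theorem N_apply (p : E) : σ.N p = p - σ.J (σ.P p) := rfl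

theorem P_N (p : E) : σ.P (σ.N p) = 0 := by simp [N_apply, σ.P_J]

theorem N_J (y : Y) : σ.N (σ.J y) = 0 := by simp [N_apply, σ.P_J]

theorem N_N (p : E) : σ.N (σ.N p) = σ.N p := by simp [N_apply, σ.P_J]

theorem P_slice (p : E) (y : Y) : σ.P (σ.N p + σ.J y) = y := by
  rw [map_add, P_N, P_J, zero_add]

theorem N_slice (p : E) (y : Y) : σ.N (σ.N p + σ.J y) = σ.N p := by
  rw [map_add, N_N, N_J, add_zero]

variable {W : Type} [NormedAddCommGroup W] [NormedSpace ℂ W]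

/-- Decay in the fibre coordinate alone, uniform over the base: this yields one integrable majorant
for all fibres in `exists_integrable_bound`. -/
theorem exists_weight_bound (φ : 𝓢(E, W)) (k r : ℕ) :
    ∃ C, ∀ q, ‖q‖ ^ k * ‖φ q‖ ≤ C * (1 + ‖σ.P q‖) ^ (-(r : ℝ)) := by
  have h := fun q => one_add_le_sup_seminorm_apply (𝕜 := ℝ) (m := (k + r, 0)) (k := k + r)
    (n := 0) le_rfl le_rfl φ q
  simp only [norm_iteratedFDeriv_zero] at h
  set C₀ := 2 ^ (k + r) * ((Finset.Iic (k + r, 0)).sup fun m => SchwartzMap.seminorm ℝ m.1 m.2) φ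
  refine ⟨(1 + ‖σ.P‖) ^ r * C₀, fun q => ?_⟩
  have h1 : 1 + ‖σ.P q‖ ≤ (1 + ‖σ.P‖) * (1 + ‖q‖) := by
    have := σ.P.le_opNorm q
    nlinarith [norm_nonneg q, norm_nonneg σ.P]
  have hpos : 0 < 1 + ‖σ.P q‖ := by positivity
  rw [Real.rpow_neg hpos.le, Real.rpow_natCast, ← div_eq_mul_inv, le_div_iff₀ (by positivity)]
  calc ‖q‖ ^ k * ‖φ q‖ * (1 + ‖σ.P q‖) ^ r
      ≤ (1 + ‖q‖) ^ k * ‖φ q‖ * ((1 + ‖σ.P‖) * (1 + ‖q‖)) ^ r := by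
        gcongr
        linarith
    _ = (1 + ‖σ.P‖) ^ r * ((1 + ‖q‖) ^ (k + r) * ‖φ q‖) := by rw [mul_pow, pow_add]; ring
    _ ≤ _ := by gcongr; exact h q

/-- The restriction of a Schwartz function to the fibre through `p`. -/
def slice (p : E) : 𝓢(E, W) →L[ℂ] 𝓢(Y, W) :=
  compCLMOfAntilipschitz ℂ (g := fun y => σ.N p + σ.J y) (K := ‖σ.P‖₊)
    ((Function.HasTemperateGrowth.const _).add σ.J.hasTemperateGrowth)
    -- P is a Lipschitz left inverse of the fibre inclusion, so decay on E passes to the fibre.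
    (AntilipschitzWith.of_le_mul_dist fun y y' => by
      have := σ.P.le_opNorm (σ.N p + σ.J y - (σ.N p + σ.J y'))
      rw [map_sub, P_slice, P_slice] at this
      simpa [dist_eq_norm] using this)

theorem slice_apply (p : E) (ψ : 𝓢(E, W)) (y : Y) : σ.slice p ψ y = ψ (σ.N p + σ.J y) := rfl

variable [FiniteDimensional ℝ Y] [MeasurableSpace Y] [BorelSpace Y]

/-- The partial Fourier integral `∫ e^{-2πi c ⟨y, P p⟩} ψ(N p + J y) dy`. -/
def fourierFun (c : ℝ) (ψ : 𝓢(E, W)) (p : E) : W := 𝓕 (σ.slice p ψ) (c • σ.P p)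

theorem fourierFun_eq (c : ℝ) (ψ : 𝓢(E, W)) (p : E) : σ.fourierFun c ψ p =
    ∫ y : Y, (Real.fourierChar (-inner ℝ y (c • σ.P p)) : ℂ) • ψ (σ.N p + σ.J y) := by
  rw [fourierFun, fourier_coe, Real.fourier_eq]
  rfl

/-- The Schwartz function with values in `E →L[ℝ] W` whose partial Fourier integral is the
derivative of the partial Fourier integral of `ψ`. -/
def derivSymbol (c : ℝ) (ψ : 𝓢(E, W)) : 𝓢(E, E →L[ℝ] W) :=
  postcompCLM ((ContinuousLinearMap.compL ℝ E E W).flip σ.N) (fderivCLM ℝ E W ψ) +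
    (-(2 * Real.pi * Complex.I)) • smulRightCLM ℂ W
      ((innerSL ℝ : Y →L[ℝ] Y →L[ℝ] ℝ).bilinearComp σ.P (c • σ.P)) ψ

theorem derivSymbol_apply (c : ℝ) (ψ : 𝓢(E, W)) (q : E) : σ.derivSymbol c ψ q =
    (fderiv ℝ ψ q).comp σ.N + (-(2 * Real.pi * Complex.I)) •
      (((innerSL ℝ (σ.P q)).comp (c • σ.P)).smulRight (ψ q)) := rfl

theorem exists_integrable_bound (φ : 𝓢(E, W)) (k : ℕ) : ∃ b : Y → ℝ, Integrable b ∧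
    ∀ p y, ‖σ.N p + σ.J y‖ ^ k * ‖φ (σ.N p + σ.J y)‖ ≤ b y := by
  obtain ⟨C, hC⟩ := σ.exists_weight_bound φ k (Module.finrank ℝ Y + 1)
  refine ⟨fun y => C * (1 + ‖y‖) ^ (-((Module.finrank ℝ Y + 1 : ℕ) : ℝ)),
    (integrable_one_add_norm (by push_cast; linarith)).const_mul C, fun p y => ?_⟩
  simpa only [P_slice] using hC (σ.N p + σ.J y)

theorem hasFDerivAt_fourierFun (c : ℝ) (ψ : 𝓢(E, W)) (p : E) :
    HasFDerivAt (σ.fourierFun c ψ) (σ.fourierFun c (σ.derivSymbol c ψ) p) p := by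
  obtain ⟨b, hb, hb'⟩ := σ.exists_integrable_bound (σ.derivSymbol c ψ) 0
  simp only [pow_zero, one_mul] at hb'
  have hcont : ∀ {W : Type} [NormedAddCommGroup W] [NormedSpace ℂ W] (φ : 𝓢(E, W)) (p : E),
      Continuous fun y : Y => (Real.fourierChar (-inner ℝ y (c • σ.P p)) : ℂ) •
        φ (σ.N p + σ.J y) := by
    intro W _ _ φ p
    refine Continuous.smul ?_ (φ.continuous.comp (by fun_prop))
    exact continuous_subtype_val.comp (Real.continuous_fourierChar.comp (by fun_prop))
  have key := hasFDerivAt_integral_of_dominated_of_fderiv_le (μ := (volume : Measure Y)) (𝕜 := ℝ)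
    (F := fun p y => (Real.fourierChar (-inner ℝ y (c • σ.P p)) : ℂ) • ψ (σ.N p + σ.J y))
    (F' := fun p y => (Real.fourierChar (-inner ℝ y (c • σ.P p)) : ℂ) •
      σ.derivSymbol c ψ (σ.N p + σ.J y)) (x₀ := p) (s := Set.univ) (bound := b) univ_mem
    (Eventually.of_forall fun q => (hcont ψ q).aestronglyMeasurable) ?_
    (hcont _ p).aestronglyMeasurable ?_ hb ?_
  · rw [fourierFun_eq]
    refine key.congr_of_eventuallyEq (Eventually.of_forall fun q => ?_)
    exact σ.fourierFun_eq c ψ q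
  · obtain ⟨b₀, hb₀, hb₀'⟩ := σ.exists_integrable_bound ψ 0
    refine hb₀.mono' (hcont ψ p).aestronglyMeasurable (Eventually.of_forall fun y => ?_)
    rw [norm_smul, Circle.norm_coe, one_mul]
    simpa using hb₀' p y
  · refine Eventually.of_forall fun y q _ => ?_
    rw [norm_smul, Circle.norm_coe, one_mul]
    exact hb' q y
  · refine Eventually.of_forall fun y q _ => ?_
    have h1 := Real.hasFDerivAt_fourierChar_neg_bilinear_right
      ((innerSL ℝ : Y →L[ℝ] Y →L[ℝ] ℝ).bilinearComp (ContinuousLinearMap.id ℝ Y) (c • σ.P)) y q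
    have h2 : HasFDerivAt (fun q => ψ (σ.N q + σ.J y))
        ((fderiv ℝ ψ (σ.N q + σ.J y)).comp σ.N) q :=
      (ψ.hasFDerivAt _).comp q (σ.N.hasFDerivAt.add_const (σ.J y))
    have h3 := h1.smul h2
    refine h3.congr_fderiv ?_
    ext v
    rw [derivSymbol_apply, P_slice]
    simp only [add_apply, smul_apply, ContinuousLinearMap.smulRight_apply,
      ContinuousLinearMap.comp_apply, innerSL_apply_apply, ContinuousLinearMap.bilinearComp_apply,
      ContinuousLinearMap.id_apply, inner_smul_right, smul_add]
    congr 1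
    rw [← Complex.coe_smul (c * _), smul_smul, smul_smul]
    congr 1
    rw [Complex.ofRealCLM_apply, smul_eq_mul]
    ring

/-- The derivative is again a partial Fourier integral of a Schwartz function, now with values in E
→L[ℝ] W; the induction therefore runs over all target spaces W. -/
theorem contDiff_fourierFun (c : ℝ) (ψ : 𝓢(E, W)) : ContDiff ℝ ∞ (σ.fourierFun c ψ) := by
  refine contDiff_infty.2 fun n => ?_
  induction n generalizing W with
  | zero =>
    exact contDiff_zero.2 (continuous_iff_continuousAt.2 fun p =>
      (σ.hasFDerivAt_fourierFun c ψ p).continuousAt)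
  | succ n ih =>
    have h : fderiv ℝ (σ.fourierFun c ψ) = σ.fourierFun c (σ.derivSymbol c ψ) :=
      funext fun p => (σ.hasFDerivAt_fourierFun c ψ p).fderiv
    refine contDiff_succ_iff_fderiv.2
      ⟨fun p => (σ.hasFDerivAt_fourierFun c ψ p).differentiableAt,
        fun h => absurd h (WithTop.natCast_ne_top n), ?_⟩
    rw [h]
    exact ih _

/-- The derivative of `ψ` in the direction of the fibres. -/
def fiberDeriv (ψ : 𝓢(E, W)) : 𝓢(E, Y →L[ℝ] W) :=
  postcompCLM ((ContinuousLinearMap.compL ℝ Y E W).flip σ.J) (fderivCLM ℝ E W ψ)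

theorem fiberDeriv_apply (ψ : 𝓢(E, W)) (q : E) : σ.fiberDeriv ψ q = (fderiv ℝ ψ q).comp σ.J := rfl

theorem slice_fiberDeriv (p : E) (ψ : 𝓢(E, W)) :
    σ.slice p (σ.fiberDeriv ψ) = fderivCLM ℝ Y W (σ.slice p ψ) := by
  ext1 y
  rw [slice_apply, fiberDeriv_apply, fderivCLM_apply]
  refine (HasFDerivAt.fderiv ?_).symm
  exact (ψ.hasFDerivAt _).comp y (σ.J.hasFDerivAt.const_add (σ.N p))

theorem fourierFun_fiberDeriv (c : ℝ) (ψ : 𝓢(E, W)) (p : E) :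
    σ.fourierFun c (σ.fiberDeriv ψ) p =
      (2 * Real.pi * Complex.I) • (innerSL ℝ (c • σ.P p)).smulRight (σ.fourierFun c ψ p) := by
  rw [fourierFun, slice_fiberDeriv, fourier_fderivCLM_eq]
  rfl

/-- Each power of the frequency is traded for one fibre derivative of ψ, again at the price of a
larger target space. The weight in the base variable passes under the integral. -/
theorem exists_mixed_weight_bound (c : ℝ) (m k : ℕ) (ψ : 𝓢(E, W)) :
    ∃ C, ∀ p, ‖c • σ.P p‖ ^ m * (‖σ.N p‖ ^ k * ‖σ.fourierFun c ψ p‖) ≤ C := by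
  induction m generalizing W with
  | zero =>
    obtain ⟨b, hb, hb'⟩ := σ.exists_integrable_bound ψ k
    refine ⟨‖σ.N‖ ^ k * ∫ y, b y, fun p => ?_⟩
    rw [pow_zero, one_mul, fourierFun_eq]
    have hpt : ∀ y, ‖σ.N p‖ ^ k * ‖ψ (σ.N p + σ.J y)‖ ≤ ‖σ.N‖ ^ k * b y := fun y => by
      refine le_trans ?_ (mul_le_mul_of_nonneg_left (hb' p y) (by positivity))
      rw [← mul_assoc, ← mul_pow]
      have := σ.N.le_opNorm (σ.N p + σ.J y)
      rw [N_slice] at this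
      gcongr
    have hint : Integrable fun y => ‖ψ (σ.N p + σ.J y)‖ := (σ.slice p ψ).integrable.norm
    calc _ ≤ ‖σ.N p‖ ^ k * ∫ y, ‖ψ (σ.N p + σ.J y)‖ := by
          gcongr
          refine (norm_integral_le_integral_norm _).trans_eq ?_
          simp only [norm_smul, Circle.norm_coe, one_mul]
      _ = ∫ y, ‖σ.N p‖ ^ k * ‖ψ (σ.N p + σ.J y)‖ := (integral_const_mul _ _).symm
      _ ≤ ∫ y, ‖σ.N‖ ^ k * b y := integral_mono (hint.const_mul _) (hb.const_mul _) hpt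
      _ = _ := integral_const_mul _ _
  | succ m ih =>
    obtain ⟨C, hC⟩ := ih (σ.fiberDeriv ψ)
    refine ⟨C / (2 * Real.pi), fun p => ?_⟩
    rw [le_div_iff₀ (by positivity)]
    refine le_trans (le_of_eq ?_) (hC p)
    rw [fourierFun_fiberDeriv, norm_smul (2 * Real.pi * Complex.I : ℂ),
      ContinuousLinearMap.norm_smulRight_apply, innerSL_apply_norm]
    simp only [norm_mul, Complex.norm_I, Complex.norm_real, Complex.norm_ofNat, Real.norm_eq_abs,
      abs_of_pos Real.pi_pos]
    ring

theorem exists_weight_bound_fourierFun {c : ℝ} (hc : c ≠ 0) (k : ℕ) (ψ : 𝓢(E, W)) :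
    ∃ C, ∀ p, ‖p‖ ^ k * ‖σ.fourierFun c ψ p‖ ≤ C := by
  obtain ⟨C₁, h₁⟩ := σ.exists_mixed_weight_bound c 0 k ψ
  obtain ⟨C₂, h₂⟩ := σ.exists_mixed_weight_bound c k 0 ψ
  refine ⟨2 ^ (k - 1) * (C₁ + (‖σ.J‖ * |c|⁻¹) ^ k * C₂), fun p => ?_⟩
  have hp : ‖p‖ ≤ ‖σ.N p‖ + ‖σ.J‖ * |c|⁻¹ * ‖c • σ.P p‖ := by
    have h1 : p = σ.N p + σ.J (σ.P p) := by simp [N_apply]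
    have h2 : |c|⁻¹ * ‖c • σ.P p‖ = ‖σ.P p‖ := by
      rw [norm_smul, Real.norm_eq_abs, inv_mul_cancel_left₀ (abs_ne_zero.2 hc)]
    rw [mul_assoc, h2]
    calc ‖p‖ = ‖σ.N p + σ.J (σ.P p)‖ := by rw [← h1]
      _ ≤ _ := (norm_add_le _ _).trans (by gcongr; exact σ.J.le_opNorm _)
  have h1 := h₁ p
  have h2 := h₂ p
  rw [pow_zero, one_mul] at h1
  rw [pow_zero, one_mul] at h2
  calc ‖p‖ ^ k * ‖σ.fourierFun c ψ p‖
      ≤ (2 ^ (k - 1) * (‖σ.N p‖ ^ k + (‖σ.J‖ * |c|⁻¹ * ‖c • σ.P p‖) ^ k)) *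
          ‖σ.fourierFun c ψ p‖ := by
        gcongr
        exact (pow_le_pow_left₀ (norm_nonneg _) hp k).trans
          (add_pow_le (by positivity) (by positivity) k)
    _ = 2 ^ (k - 1) * (‖σ.N p‖ ^ k * ‖σ.fourierFun c ψ p‖ +
          (‖σ.J‖ * |c|⁻¹) ^ k * (‖c • σ.P p‖ ^ k * ‖σ.fourierFun c ψ p‖)) := by
        rw [mul_pow _ ‖c • σ.P p‖]; ring
    _ ≤ _ := by gcongr

theorem fourierFun_decay {c : ℝ} (hc : c ≠ 0) (k n : ℕ) (ψ : 𝓢(E, W)) :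
    ∃ C, ∀ p, ‖p‖ ^ k * ‖iteratedFDeriv ℝ n (σ.fourierFun c ψ) p‖ ≤ C := by
  induction n generalizing W with
  | zero =>
    simp only [norm_iteratedFDeriv_zero]
    exact σ.exists_weight_bound_fourierFun hc k ψ
  | succ n ih =>
    have h : fderiv ℝ (σ.fourierFun c ψ) = σ.fourierFun c (σ.derivSymbol c ψ) :=
      funext fun p => (σ.hasFDerivAt_fourierFun c ψ p).fderiv
    simp only [← norm_iteratedFDeriv_fderiv, h]
    exact ih _

/-- The partial Fourier transform on Schwartz functions, with frequencies scaled by `c`. -/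
def fourier {c : ℝ} (hc : c ≠ 0) (ψ : 𝓢(E, W)) : 𝓢(E, W) where
  toFun := σ.fourierFun c ψ
  smooth' := σ.contDiff_fourierFun c ψ
  decay' k n := σ.fourierFun_decay hc k n ψ

theorem fourier_apply {c : ℝ} (hc : c ≠ 0) (ψ : 𝓢(E, W)) (p : E) :
    σ.fourier hc ψ p = 𝓕 (σ.slice p ψ) (c • σ.P p) := rfl

theorem slice_fourier_apply {c : ℝ} (hc : c ≠ 0) (ψ : 𝓢(E, W)) (p : E) (y : Y) :
    σ.slice p (σ.fourier hc ψ) y = 𝓕 (σ.slice p ψ) (c • y) := by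
  rw [slice_apply, fourier_apply, P_slice]
  congr 2
  ext y
  rw [slice_apply, slice_apply, N_slice]

theorem fourier_add {c : ℝ} (hc : c ≠ 0) (ψ χ : 𝓢(E, W)) :
    σ.fourier hc (ψ + χ) = σ.fourier hc ψ + σ.fourier hc χ := by
  ext p
  simp only [fourier_apply, map_add, add_apply, FourierTransform.fourier_add]

theorem fourier_smul {c : ℝ} (hc : c ≠ 0) (a : ℂ) (ψ : 𝓢(E, W)) :
    σ.fourier hc (a • ψ) = a • σ.fourier hc ψ := by
  ext p
  simp only [fourier_apply, map_smul, smul_apply, FourierTransform.fourier_smul]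

/-- Fourier inversion on each fibre. Scaling the frequencies by −c in the second transform supplies
the inverse kernel, and the substitution y ↦ cy the Jacobian. -/
theorem fourier_fourier_neg [CompleteSpace W] {c : ℝ} (hc : c ≠ 0) (ψ : 𝓢(E, W)) :
    σ.fourier (neg_ne_zero.2 hc) (σ.fourier hc ψ) = (|c| ^ Module.finrank ℝ Y)⁻¹ • ψ := by
  ext p
  have h1 : σ.fourier (neg_ne_zero.2 hc) (σ.fourier hc ψ) p =
      ∫ y, Real.fourierChar (-inner ℝ y (-c • σ.P p)) • 𝓕 (σ.slice p ψ) (c • y) := by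
    rw [fourier_apply, fourier_coe, Real.fourier_eq]
    simp only [slice_fourier_apply]
  have h2 := Measure.integral_comp_smul (volume : Measure Y)
    (fun y => Real.fourierChar (inner ℝ y (σ.P p)) • 𝓕 (σ.slice p ψ) y) c
  have h3 : 𝓕⁻ (𝓕 (σ.slice p ψ)) (σ.P p) = ψ p := by
    rw [FourierPair.fourierInv_fourier_eq, slice_apply]
    simp [N_apply]
  rw [fourierInv_coe, Real.fourierInv_eq] at h3
  rw [h3] at h2
  rw [h1, smul_apply, ← abs_pow, ← abs_inv, ← h2]
  simp only [inner_smul_left, inner_smul_right, neg_mul, neg_neg]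
  rfl

theorem integral_norm_sq_slice_fourier {H : Type} [NormedAddCommGroup H] [InnerProductSpace ℂ H]
    [CompleteSpace H] {c : ℝ} (hc : c ≠ 0) (ψ : 𝓢(E, H)) (p : E) :
    ∫ y, ‖σ.fourier hc ψ (σ.N p + σ.J y)‖ ^ 2 =
      (|c| ^ Module.finrank ℝ Y)⁻¹ * ∫ y, ‖ψ (σ.N p + σ.J y)‖ ^ 2 := by
  have h1 := Measure.integral_comp_smul (volume : Measure Y)
    (fun y => ‖𝓕 (σ.slice p ψ) y‖ ^ 2) c
  have h2 := integral_norm_sq_fourier (σ.slice p ψ)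
  rw [h2, smul_eq_mul, abs_inv, abs_pow] at h1
  simp only [← slice_apply, slice_fourier_apply]
  exact h1

end Splitting

/-! ### Unimodular multipliers, and extension of the partial Fourier transform to L². -/

theorem hasTemperateGrowth_cexp_I_mul :
    Function.HasTemperateGrowth fun x : ℝ => Complex.exp (Complex.I * x) := by
  have h : ∀ n : ℕ, iteratedDeriv n (fun x : ℝ => Complex.exp (Complex.I * x)) =
      fun x : ℝ => Complex.I ^ n * Complex.exp (Complex.I * x) := by
    intro n
    induction n with
    | zero => simp
    | succ n ih =>
      rw [iteratedDeriv_succ, ih]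
      funext x
      have h1 : HasDerivAt (fun x : ℝ => Complex.I * (x : ℂ)) (Complex.I * 1) x :=
        (Complex.ofRealCLM.hasDerivAt.const_mul _)
      rw [(h1.cexp.const_mul (Complex.I ^ n)).deriv, pow_succ]
      ring
  refine ⟨?_, fun n => ⟨0, 1, fun x => ?_⟩⟩
  · have := Complex.ofRealCLM.contDiff (n := ∞)
    exact (contDiff_const.mul this).cexp
  · rw [norm_iteratedFDeriv_eq_norm_iteratedDeriv, h]
    simp [Complex.norm_exp]

theorem Function.HasTemperateGrowth.cexp_I_mul {E : Type*} [NormedAddCommGroup E]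
    [NormedSpace ℝ E] {r : E → ℝ} (hr : r.HasTemperateGrowth) :
    Function.HasTemperateGrowth fun x => Complex.exp (Complex.I * r x) :=
  hasTemperateGrowth_cexp_I_mul.comp hr

theorem memLp_unimodular_mul {α : Type*} [MeasurableSpace α] {μ : Measure α} {m : α → ℂ}
    (hm : Measurable m) (h1 : ∀ x, ‖m x‖ = 1) (f : Lp ℂ 2 μ) :
    MemLp (fun x => m x * f x) 2 μ :=
  (Lp.memLp f).congr_norm (hm.aestronglyMeasurable.mul (Lp.aestronglyMeasurable f))
    (Eventually.of_forall fun x => by simp [h1])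

/-- Multiplication by a unimodular function as a unitary operator on `L²`. -/
def unimodularMul {α : Type*} [MeasurableSpace α] (μ : Measure α) (m : α → ℂ)
    (hm : Measurable m) (h1 : ∀ x, ‖m x‖ = 1) : Lp ℂ 2 μ ≃ₗᵢ[ℂ] Lp ℂ 2 μ :=
  have hinv : Measurable fun x => (m x)⁻¹ := hm.inv
  have hinv1 : ∀ x, ‖(m x)⁻¹‖ = 1 := fun x => by simp [h1]
  have hne : ∀ x, m x ≠ 0 := fun x h => by simpa [h] using h1 x
  { toFun := fun f => (memLp_unimodular_mul hm h1 f).toLp _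
    invFun := fun f => (memLp_unimodular_mul hinv hinv1 f).toLp _
    map_add' := fun f g => by
      refine Lp.ext ?_
      filter_upwards [(memLp_unimodular_mul hm h1 (f + g)).coeFn_toLp,
        (memLp_unimodular_mul hm h1 f).coeFn_toLp,
        (memLp_unimodular_mul hm h1 g).coeFn_toLp, Lp.coeFn_add f g,
        Lp.coeFn_add ((memLp_unimodular_mul hm h1 f).toLp _)
          ((memLp_unimodular_mul hm h1 g).toLp _)] with x a b c d e
      rw [a, e, Pi.add_apply, b, c, d, Pi.add_apply, mul_add]
    map_smul' := fun r f => by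
      refine Lp.ext ?_
      filter_upwards [(memLp_unimodular_mul hm h1 (r • f)).coeFn_toLp,
        (memLp_unimodular_mul hm h1 f).coeFn_toLp,
        Lp.coeFn_smul r f, Lp.coeFn_smul r ((memLp_unimodular_mul hm h1 f).toLp _)] with x a b c d
      rw [a, RingHom.id_apply, d, Pi.smul_apply, b, c, Pi.smul_apply, smul_eq_mul, smul_eq_mul]
      ring
    left_inv := fun f => by
      refine Lp.ext ?_
      filter_upwards [(memLp_unimodular_mul hinv hinv1
          ((memLp_unimodular_mul hm h1 f).toLp _)).coeFn_toLp,
        (memLp_unimodular_mul hm h1 f).coeFn_toLp] with x a b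
      exact a.trans (by rw [b, inv_mul_cancel_left₀ (hne x)])
    right_inv := fun f => by
      refine Lp.ext ?_
      filter_upwards [(memLp_unimodular_mul hm h1
          ((memLp_unimodular_mul hinv hinv1 f).toLp _)).coeFn_toLp,
        (memLp_unimodular_mul hinv hinv1 f).coeFn_toLp] with x a b
      exact a.trans (by rw [b, mul_inv_cancel_left₀ (hne x)])
    norm_map' := fun f => by
      refine (Lp.norm_toLp _ (memLp_unimodular_mul hm h1 f)).trans ?_
      rw [Lp.norm_def]
      congr 1
      exact eLpNorm_congr_norm_ae (Eventually.of_forall fun x => by simp [h1]) }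

theorem coeFn_unimodularMul {α : Type*} [MeasurableSpace α] (μ : Measure α) (m : α → ℂ)
    (hm : Measurable m) (h1 : ∀ x, ‖m x‖ = 1) (f : Lp ℂ 2 μ) :
    unimodularMul μ m hm h1 f =ᵐ[μ] fun x => m x * f x :=
  MemLp.coeFn_toLp (memLp_unimodular_mul hm h1 f)

theorem unimodularMul_toLp {E : Type*} [NormedAddCommGroup E] [NormedSpace ℝ E]
    [MeasurableSpace E] [BorelSpace E] [SecondCountableTopology E] (μ : Measure E)
    [μ.HasTemperateGrowth] (m : E → ℂ) (hm : Measurable m) (h1 : ∀ x, ‖m x‖ = 1)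
    (hg : m.HasTemperateGrowth) (f : 𝓢(E, ℂ)) :
    unimodularMul μ m hm h1 (f.toLp 2 μ) = (SchwartzMap.smulLeftCLM ℂ m f).toLp 2 μ := by
  refine Lp.ext ?_
  filter_upwards [coeFn_unimodularMul μ m hm h1 (f.toLp 2 μ), f.coeFn_toLp 2 μ,
    (SchwartzMap.smulLeftCLM ℂ m f).coeFn_toLp 2 μ] with x a b c
  rw [a, b, c, SchwartzMap.smulLeftCLM_apply_apply hg, smul_eq_mul]

theorem SchwartzMap.norm_toLp_two_sq {E : Type*} [NormedAddCommGroup E] [NormedSpace ℝ E]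
    [MeasurableSpace E] [BorelSpace E] [SecondCountableTopology E] (μ : Measure E)
    [μ.HasTemperateGrowth] (f : 𝓢(E, ℂ)) : ‖f.toLp 2 μ‖ ^ 2 = ∫ x, ‖f x‖ ^ 2 ∂μ := by
  rw [SchwartzMap.norm_toLp' (by simp) (by simp)]
  simp only [ENNReal.toReal_ofNat, Real.rpow_ofNat]
  rw [← Real.rpow_natCast, ← Real.rpow_mul (integral_nonneg fun x => by positivity)]
  simp

namespace Splitting

variable {E Y : Type} [NormedAddCommGroup E] [NormedSpace ℝ E]
    [NormedAddCommGroup Y] [InnerProductSpace ℝ Y] (σ : Splitting E Y)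
    [FiniteDimensional ℝ Y] [MeasurableSpace Y] [BorelSpace Y]

theorem fourier_neg_fourier {W : Type} [NormedAddCommGroup W] [NormedSpace ℂ W] [CompleteSpace W]
    {c : ℝ} (hc : c ≠ 0) (ψ : 𝓢(E, W)) :
    σ.fourier hc (σ.fourier (neg_ne_zero.2 hc) ψ) = (|c| ^ Module.finrank ℝ Y)⁻¹ • ψ := by
  have := σ.fourier_fourier_neg (neg_ne_zero.2 hc) ψ
  simpa only [neg_neg, abs_neg] using this

/-- The factor that makes the partial Fourier transform unitary. -/
def fourierConst (_ : Splitting E Y) (c : ℝ) : ℂ := (√(|c| ^ Module.finrank ℝ Y) : ℝ)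

theorem fourierConst_mul_self (c : ℝ) :
    σ.fourierConst c * σ.fourierConst c = (|c| ^ Module.finrank ℝ Y : ℝ) := by
  rw [fourierConst, ← Complex.ofReal_mul, Real.mul_self_sqrt (by positivity)]

/-- The normalized partial Fourier transform on Schwartz functions. -/
def fourierEquiv {c : ℝ} (hc : c ≠ 0) : 𝓢(E, ℂ) ≃ₗ[ℂ] 𝓢(E, ℂ) where
  toFun ψ := σ.fourierConst c • σ.fourier hc ψ
  invFun ψ := σ.fourierConst c • σ.fourier (neg_ne_zero.2 hc) ψ
  map_add' ψ χ := by rw [fourier_add, smul_add]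
  map_smul' a ψ := by rw [fourier_smul, smul_comm, RingHom.id_apply]
  left_inv ψ := by
    have h : (0 : ℝ) < |c| ^ Module.finrank ℝ Y := by positivity
    change σ.fourierConst c • σ.fourier _ (σ.fourierConst c • σ.fourier hc ψ) = ψ
    rw [fourier_smul, smul_smul, fourierConst_mul_self, fourier_fourier_neg, Complex.coe_smul,
      smul_smul, mul_inv_cancel₀ h.ne', one_smul]
  right_inv ψ := by
    have h : (0 : ℝ) < |c| ^ Module.finrank ℝ Y := by positivity
    change σ.fourierConst c • σ.fourier hc (σ.fourierConst c • σ.fourier _ ψ) = ψ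
    rw [fourier_smul, smul_smul, fourierConst_mul_self, fourier_neg_fourier, Complex.coe_smul,
      smul_smul, mul_inv_cancel₀ h.ne', one_smul]

theorem fourierEquiv_apply {c : ℝ} (hc : c ≠ 0) (ψ : 𝓢(E, ℂ)) :
    σ.fourierEquiv hc ψ = σ.fourierConst c • σ.fourier hc ψ := rfl

variable [FiniteDimensional ℝ E] [MeasurableSpace E] [BorelSpace E]

/-- The measure `μ` disintegrates into Lebesgue measures along the fibres of the splitting. -/
def IsFibered (μ : Measure E) : Prop :=
  ∀ (f g : 𝓢(E, ℂ)) (K : ℝ), (∀ p, ∫ y, ‖f (σ.N p + σ.J y)‖ ^ 2 =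
    K * ∫ y, ‖g (σ.N p + σ.J y)‖ ^ 2) → ∫ p, ‖f p‖ ^ 2 ∂μ = K * ∫ p, ‖g p‖ ^ 2 ∂μ

variable {μ : Measure E} [μ.HasTemperateGrowth] [IsFiniteMeasureOnCompacts μ]

/-- Plancherel on each fibre, integrated over the base; the square of `fourierConst` cancels the
Jacobian of the frequency scaling. -/
theorem norm_toLp_fourierEquiv {c : ℝ} (hc : c ≠ 0) (hμ : σ.IsFibered μ) (ψ : 𝓢(E, ℂ)) :
    ‖(σ.fourierEquiv hc ψ).toLp 2 μ‖ = ‖ψ.toLp 2 μ‖ := by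
  rw [← sq_eq_sq₀ (norm_nonneg _) (norm_nonneg _), SchwartzMap.norm_toLp_two_sq,
    SchwartzMap.norm_toLp_two_sq]
  have h1 := hμ (σ.fourier hc ψ) ψ _ (σ.integral_norm_sq_slice_fourier hc ψ)
  have h : (0 : ℝ) < |c| ^ Module.finrank ℝ Y := by positivity
  simp only [fourierEquiv_apply, smul_apply, norm_smul, mul_pow]
  rw [integral_const_mul, h1, fourierConst, Complex.norm_real, Real.norm_eq_abs, sq_abs,
    Real.sq_sqrt h.le, mul_inv_cancel_left₀ h.ne']

/-- The normalized partial Fourier transform on `L²`. -/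
def fourierL2 {c : ℝ} (hc : c ≠ 0) (hμ : σ.IsFibered μ) : Lp ℂ 2 μ ≃ₗᵢ[ℂ] Lp ℂ 2 μ :=
  (σ.fourierEquiv hc).extendOfIsometry (SchwartzMap.toLpCLM ℂ ℂ 2 μ).toLinearMap
    (SchwartzMap.toLpCLM ℂ ℂ 2 μ).toLinearMap
    (SchwartzMap.denseRange_toLpCLM ENNReal.ofNat_ne_top)
    (SchwartzMap.denseRange_toLpCLM ENNReal.ofNat_ne_top)
    (σ.norm_toLp_fourierEquiv hc hμ)

theorem fourierL2_toLp {c : ℝ} (hc : c ≠ 0) (hμ : σ.IsFibered μ) (ψ : 𝓢(E, ℂ)) :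
    σ.fourierL2 hc hμ (ψ.toLp 2 μ) = (σ.fourierEquiv hc ψ).toLp 2 μ :=
  LinearEquiv.extendOfIsometry_eq _ _ _ _ _ _ ψ

theorem fourierL2_symm_toLp {c : ℝ} (hc : c ≠ 0) (hμ : σ.IsFibered μ) (ψ : 𝓢(E, ℂ)) :
    (σ.fourierL2 hc hμ).symm (ψ.toLp 2 μ) = ((σ.fourierEquiv hc).symm ψ).toLp 2 μ :=
  LinearEquiv.extendOfIsometry_symm_eq _ _ _ _ _ _ ψ

end Splitting

/-! ### The central Fourier transform F and the free evolution U₁. -/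

namespace Heis

open FourierTransform

variable {d : ℕ}

/-- The splitting of `ℍ^d` along the central variable. -/
def centralSplitting (d : ℕ) : Splitting (Heis d) ℝ where
  P := ContinuousLinearMap.snd ℝ _ _
  J := ContinuousLinearMap.inr ℝ _ _
  P_J _ := rfl

/-- The splitting of `ℍ^d` along the horizontal variables. -/
def horizontalSplitting (d : ℕ) : Splitting (Heis d) (Plane d) where
  P := ContinuousLinearMap.fst ℝ _ _
  J := ContinuousLinearMap.inl ℝ _ _
  P_J _ := rfl

theorem centralSplitting_slice (p : Heis d) (s : ℝ) :
    (centralSplitting d).N p + (centralSplitting d).J s = (p.1, s) := by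
  rw [Splitting.N_apply]
  ext <;> simp [centralSplitting]

theorem horizontalSplitting_slice (p : Heis d) (z : Plane d) :
    (horizontalSplitting d).N p + (horizontalSplitting d).J z = (z, p.2) := by
  rw [Splitting.N_apply]
  ext <;> simp [horizontalSplitting]

theorem integrable_norm_sq (f : 𝓢(Heis d, ℂ)) :
    Integrable (fun p => ‖f p‖ ^ 2) ((volume : Measure (Plane d)).prod (volume : Measure ℝ)) :=
  (f.memLp 2 (volume : Measure (Heis d))).integrable_norm_pow (by simp)

theorem isFibered_central : (centralSplitting d).IsFibered (volume : Measure (Heis d)) := by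
  intro f g K h
  simp only [centralSplitting_slice] at h
  rw [Measure.volume_eq_prod, integral_prod _ (integrable_norm_sq f),
    integral_prod _ (integrable_norm_sq g), ← integral_const_mul]
  exact integral_congr_ae (Eventually.of_forall fun z => h (z, 0))

theorem isFibered_horizontal : (horizontalSplitting d).IsFibered (volume : Measure (Heis d)) := by
  intro f g K h
  simp only [horizontalSplitting_slice] at h
  rw [Measure.volume_eq_prod, integral_prod_symm _ (integrable_norm_sq f),
    integral_prod_symm _ (integrable_norm_sq g), ← integral_const_mul]
  exact integral_congr_ae (Eventually.of_forall fun s => h (0, s))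

/-- The frequency scale 1/(2π) converts the kernel e^{−2πi⟨y,ξ⟩} of `𝓕` into e^{−i⟨y,ξ⟩}; the
unitary constant becomes (2π)^{−1/2} per dimension. -/
theorem inv_two_pi_ne_zero : (2 * Real.pi)⁻¹ ≠ 0 := by positivity

theorem fourierChar_scaled (x : ℝ) :
    (Real.fourierChar (-((2 * Real.pi)⁻¹ * x)) : ℂ) = Complex.exp (-Complex.I * x) := by
  rw [Real.fourierChar_apply]
  congr 1
  push_cast
  have : (Real.pi : ℂ) ≠ 0 := by simp [Real.pi_ne_zero]
  field_simp

theorem fourierChar_scaled_neg (x : ℝ) :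
    (Real.fourierChar (-(-(2 * Real.pi)⁻¹ * x)) : ℂ) = Complex.exp (Complex.I * x) := by
  have := fourierChar_scaled (-x)
  rw [mul_neg] at this
  rw [neg_mul, this]
  simp

/-- The central Fourier transform on Schwartz functions. -/
def centralFourierS (d : ℕ) : 𝓢(Heis d, ℂ) ≃ₗ[ℂ] 𝓢(Heis d, ℂ) :=
  (centralSplitting d).fourierEquiv inv_two_pi_ne_zero

/-- The unitary Fourier transform in the central variable. -/
def centralFourier (d : ℕ) : HeisL2 d ≃ₗᵢ[ℂ] HeisL2 d :=
  (centralSplitting d).fourierL2 inv_two_pi_ne_zero isFibered_central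

theorem centralFourier_toLp (ψ : 𝓢(Heis d, ℂ)) :
    centralFourier d (ψ.toLp 2 volume) = (centralFourierS d ψ).toLp 2 volume :=
  Splitting.fourierL2_toLp _ _ _ ψ

theorem centralFourier_symm_toLp (ψ : 𝓢(Heis d, ℂ)) :
    (centralFourier d).symm (ψ.toLp 2 volume) = ((centralFourierS d).symm ψ).toLp 2 volume :=
  Splitting.fourierL2_symm_toLp _ _ _ ψ

theorem fourierConst_central :
    (centralSplitting d).fourierConst (2 * Real.pi)⁻¹ = ((√(2 * Real.pi) : ℝ) : ℂ)⁻¹ := by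
  rw [Splitting.fourierConst, Module.finrank_self, pow_one,
    abs_of_pos (by positivity), Real.sqrt_inv, Complex.ofReal_inv]

theorem centralFourierS_apply (ψ : 𝓢(Heis d, ℂ)) (p : Heis d) :
    centralFourierS d ψ p = ((√(2 * Real.pi) : ℝ) : ℂ)⁻¹ *
      ∫ s : ℝ, Complex.exp (-Complex.I * p.2 * s) * ψ (p.1, s) := by
  have h : (centralSplitting d).fourier inv_two_pi_ne_zero ψ p = _ :=
    (centralSplitting d).fourierFun_eq (2 * Real.pi)⁻¹ ψ p
  change (centralSplitting d).fourierConst _ * (centralSplitting d).fourier _ ψ p = _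
  rw [fourierConst_central, h]
  congr 1
  refine integral_congr_ae (Eventually.of_forall fun s => ?_)
  have h1 : (centralSplitting d).P p = p.2 := rfl
  simp only [centralSplitting_slice, real_inner_smul_right, fourierChar_scaled, h1]
  simp [mul_assoc]

theorem centralFourierS_symm_apply (ψ : 𝓢(Heis d, ℂ)) (p : Heis d) :
    (centralFourierS d).symm ψ p = ((√(2 * Real.pi) : ℝ) : ℂ)⁻¹ *
      ∫ α : ℝ, Complex.exp (Complex.I * α * p.2) * ψ (p.1, α) := by
  have h : (centralSplitting d).fourier (neg_ne_zero.2 inv_two_pi_ne_zero) ψ p = _ :=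
    (centralSplitting d).fourierFun_eq (-(2 * Real.pi)⁻¹) ψ p
  change (centralSplitting d).fourierConst _ * (centralSplitting d).fourier _ ψ p = _
  rw [fourierConst_central, h]
  congr 1
  refine integral_congr_ae (Eventually.of_forall fun s => ?_)
  have h1 : (centralSplitting d).P p = p.2 := rfl
  simp only [centralSplitting_slice, real_inner_smul_right, fourierChar_scaled_neg, h1]
  simp [mul_assoc, mul_comm (s : ℂ)]

theorem isCentralFourier : IsCentralFourier (centralFourier d) := by
  intro ψ
  rw [centralFourier_toLp]
  filter_upwards [(centralFourierS d ψ).coeFn_toLp 2 volume] with p hp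
  rw [hp, centralFourierS_apply]

/-- The Fourier transform in the horizontal variables on Schwartz functions. -/
def horizontalFourierS (d : ℕ) : 𝓢(Heis d, ℂ) ≃ₗ[ℂ] 𝓢(Heis d, ℂ) :=
  (horizontalSplitting d).fourierEquiv inv_two_pi_ne_zero

/-- The unitary Fourier transform in the horizontal variables. -/
def horizontalFourierL2 (d : ℕ) : HeisL2 d ≃ₗᵢ[ℂ] HeisL2 d :=
  (horizontalSplitting d).fourierL2 inv_two_pi_ne_zero isFibered_horizontal

theorem horizontalFourierL2_toLp (ψ : 𝓢(Heis d, ℂ)) :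
    horizontalFourierL2 d (ψ.toLp 2 volume) = (horizontalFourierS d ψ).toLp 2 volume :=
  Splitting.fourierL2_toLp _ _ _ ψ

theorem horizontalFourierL2_symm_toLp (ψ : 𝓢(Heis d, ℂ)) :
    (horizontalFourierL2 d).symm (ψ.toLp 2 volume) =
      ((horizontalFourierS d).symm ψ).toLp 2 volume :=
  Splitting.fourierL2_symm_toLp _ _ _ ψ

/-- U₁ applies the unitary transform and its inverse, each carrying half of the factor (2π)^{−2d}
that `horizontalFourier` puts on one side. -/
theorem fourierConst_horizontal_mul_self :
    (horizontalSplitting d).fourierConst (2 * Real.pi)⁻¹ *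
      (horizontalSplitting d).fourierConst (2 * Real.pi)⁻¹ =
      ((2 * Real.pi : ℂ) ^ (2 * d))⁻¹ := by
  rw [Splitting.fourierConst_mul_self, abs_of_pos (by positivity)]
  have : Module.finrank ℝ (Plane d) = 2 * d := by simp [two_mul]
  rw [this]
  push_cast
  rw [inv_pow]

theorem horizontalFourierS_apply (χ : 𝓢(Heis d, ℂ)) (p : Heis d) :
    horizontalFourierS d χ p = (horizontalSplitting d).fourierConst (2 * Real.pi)⁻¹ *
      ∫ z : Plane d, Complex.exp (-Complex.I * (inner ℝ p.1 z : ℝ)) * χ (z, p.2) := by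
  have h : (horizontalSplitting d).fourier inv_two_pi_ne_zero χ p = _ :=
    (horizontalSplitting d).fourierFun_eq (2 * Real.pi)⁻¹ χ p
  change (horizontalSplitting d).fourierConst _ * (horizontalSplitting d).fourier _ χ p = _
  rw [h]
  congr 1
  refine integral_congr_ae (Eventually.of_forall fun s => ?_)
  simp only [horizontalSplitting_slice, inner_smul_right, fourierChar_scaled, smul_eq_mul]
  rw [real_inner_comm]
  rfl

theorem horizontalFourierS_symm_apply (χ : 𝓢(Heis d, ℂ)) (p : Heis d) :
    (horizontalFourierS d).symm χ p = (horizontalSplitting d).fourierConst (2 * Real.pi)⁻¹ *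
      ∫ η : Plane d, Complex.exp (Complex.I * (inner ℝ η p.1 : ℝ)) * χ (η, p.2) := by
  have h : (horizontalSplitting d).fourier (neg_ne_zero.2 inv_two_pi_ne_zero) χ p = _ :=
    (horizontalSplitting d).fourierFun_eq (-(2 * Real.pi)⁻¹) χ p
  change (horizontalSplitting d).fourierConst _ * (horizontalSplitting d).fourier _ χ p = _
  rw [h]
  congr 1
  refine integral_congr_ae (Eventually.of_forall fun s => ?_)
  simp only [horizontalSplitting_slice, inner_smul_right, fourierChar_scaled_neg, smul_eq_mul]
  rfl

/-- The symbol `e^{-iτ|η|²/2}` of the free horizontal evolution. -/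
def freeSymbol (τ : ℝ) (p : Heis d) : ℂ :=
  Complex.exp (-Complex.I / 2 * τ * ‖p.1‖ ^ 2)

theorem hasTemperateGrowth_freeSymbol (τ : ℝ) : (freeSymbol (d := d) τ).HasTemperateGrowth := by
  have h1 : Function.HasTemperateGrowth fun p : Heis d => ‖p.1‖ ^ 2 :=
    (Function.hasTemperateGrowth_norm_sq (Plane d)).comp
      (ContinuousLinearMap.fst ℝ (Plane d) ℝ).hasTemperateGrowth
  have h2 := ((Function.HasTemperateGrowth.const (-(τ / 2))).mul h1).cexp_I_mul
  convert h2 using 1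
  funext p
  rw [freeSymbol]
  congr 1
  simp
  ring

theorem norm_freeSymbol (τ : ℝ) (p : Heis d) : ‖freeSymbol τ p‖ = 1 := by
  have : freeSymbol τ p = Complex.exp ((-(τ / 2 * ‖p.1‖ ^ 2) : ℝ) * Complex.I) := by
    rw [freeSymbol]; congr 1; push_cast; ring
  rw [this, Complex.norm_exp_ofReal_mul_I]

theorem measurable_freeSymbol (τ : ℝ) : Measurable (freeSymbol (d := d) τ) :=
  (hasTemperateGrowth_freeSymbol τ).1.continuous.measurable

/-- The free horizontal evolution on Schwartz functions. -/
def freeEvolutionS (τ : ℝ) (χ : 𝓢(Heis d, ℂ)) : 𝓢(Heis d, ℂ) :=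
  (horizontalFourierS d).symm (SchwartzMap.smulLeftCLM ℂ (freeSymbol τ) (horizontalFourierS d χ))

/-- The free horizontal evolution `U₁(τ)`. -/
def freeEvolution (τ : ℝ) : HeisL2 d ≃ₗᵢ[ℂ] HeisL2 d :=
  ((horizontalFourierL2 d).trans (unimodularMul volume (freeSymbol τ) (measurable_freeSymbol τ)
    (norm_freeSymbol τ))).trans (horizontalFourierL2 d).symm

theorem freeEvolution_toLp (τ : ℝ) (χ : 𝓢(Heis d, ℂ)) :
    freeEvolution τ (χ.toLp 2 volume) = (freeEvolutionS τ χ).toLp 2 volume := by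
  change (horizontalFourierL2 d).symm (unimodularMul volume (freeSymbol τ)
    (measurable_freeSymbol τ) (norm_freeSymbol τ) (horizontalFourierL2 d (χ.toLp 2 volume))) = _
  rw [horizontalFourierL2_toLp, unimodularMul_toLp _ _ _ _ (hasTemperateGrowth_freeSymbol τ),
    horizontalFourierL2_symm_toLp]
  rfl

theorem freeEvolutionS_apply (τ : ℝ) (χ : 𝓢(Heis d, ℂ)) (p : Heis d) :
    freeEvolutionS τ χ p = ∫ η : Plane d, Complex.exp (Complex.I * (inner ℝ η p.1 : ℝ)) *
      Complex.exp (-Complex.I / 2 * τ * ‖η‖ ^ 2) * horizontalFourier χ η p.2 := by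
  rw [freeEvolutionS, horizontalFourierS_symm_apply, ← integral_const_mul]
  refine integral_congr_ae (Eventually.of_forall fun η => ?_)
  simp only [SchwartzMap.smulLeftCLM_apply_apply (hasTemperateGrowth_freeSymbol τ),
    horizontalFourierS_apply, horizontalFourier, ← fourierConst_horizontal_mul_self, freeSymbol,
    smul_eq_mul]
  ring

theorem isFourierMultiplier (τ : ℝ≥0) :
    IsFourierMultiplier τ (freeEvolution (d := d) (τ : ℝ)) := by
  intro χ
  rw [freeEvolution_toLp]
  filter_upwards [(freeEvolutionS (τ : ℝ) χ).coeFn_toLp 2 volume] with p hp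
  rw [hp, freeEvolutionS_apply]

end Heis

/-! ### The shear V, the phase U₂ and the product S. -/

theorem quasiMeasurePreserving_of_map_le {α : Type*} [MeasurableSpace α] {μ : Measure α}
    {g : α → α} (hg : Measurable g) (hμ : μ.map g ≤ μ) : Measure.QuasiMeasurePreserving g μ μ :=
  ⟨hg, Measure.absolutelyContinuous_of_le hμ⟩

theorem eLpNorm_comp_le_of_map_le {α : Type*} [MeasurableSpace α] {μ : Measure α}
    {g : α → α} (hg : Measurable g) (hμ : μ.map g ≤ μ) {f : α → ℂ}
    (hf : AEStronglyMeasurable f μ) : eLpNorm (f ∘ g) 2 μ ≤ eLpNorm f 2 μ := by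
  rw [← eLpNorm_map_measure (hf.mono_measure hμ) hg.aemeasurable]
  exact eLpNorm_mono_measure f hμ

theorem MeasureTheory.MemLp.comp_of_map_le {α : Type*} [MeasurableSpace α] {μ : Measure α}
    {g : α → α} (hg : Measurable g) (hμ : μ.map g ≤ μ) {f : α → ℂ}
    (hf : MemLp f 2 μ) : MemLp (f ∘ g) 2 μ :=
  ⟨hf.1.comp_quasiMeasurePreserving (quasiMeasurePreserving_of_map_le hg hμ),
    (eLpNorm_comp_le_of_map_le hg hμ hf.1).trans_lt hf.2⟩

/-- Composition with a map that does not increase the measure, as an operator on `L²`. -/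
def compLp {α : Type*} [MeasurableSpace α] {μ : Measure α}
    {g : α → α} (hg : Measurable g) (hμ : μ.map g ≤ μ) : Lp ℂ 2 μ →L[ℂ] Lp ℂ 2 μ :=
  LinearMap.mkContinuous
    { toFun := fun f => ((Lp.memLp f).comp_of_map_le hg hμ).toLp _
      map_add' := fun f h => by
        rw [← MemLp.toLp_add]
        exact (MemLp.toLp_eq_toLp_iff _ _).2
          ((quasiMeasurePreserving_of_map_le hg hμ).ae_eq (Lp.coeFn_add f h))
      map_smul' := fun r f => by
        rw [RingHom.id_apply, ← MemLp.toLp_const_smul]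
        exact (MemLp.toLp_eq_toLp_iff _ _).2
          ((quasiMeasurePreserving_of_map_le hg hμ).ae_eq (Lp.coeFn_smul r f)) }
    1 fun f => by
      rw [one_mul]
      refine (Lp.norm_toLp _ ((Lp.memLp f).comp_of_map_le hg hμ)).trans_le ?_
      rw [Lp.norm_def]
      exact ENNReal.toReal_mono (Lp.eLpNorm_ne_top f)
        (eLpNorm_comp_le_of_map_le hg hμ (Lp.aestronglyMeasurable f))

theorem norm_compLp_le {α : Type*} [MeasurableSpace α] {μ : Measure α}
    {g : α → α} (hg : Measurable g) (hμ : μ.map g ≤ μ) : ‖compLp hg hμ‖ ≤ 1 :=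
  LinearMap.mkContinuous_norm_le _ zero_le_one _

theorem coeFn_compLp {α : Type*} [MeasurableSpace α] {μ : Measure α}
    {g : α → α} (hg : Measurable g) (hμ : μ.map g ≤ μ) (f : Lp ℂ 2 μ) :
    compLp hg hμ f =ᵐ[μ] f ∘ g :=
  MemLp.coeFn_toLp ((Lp.memLp f).comp_of_map_le hg hμ)

namespace Heis

variable {d : ℕ}

/-- The map `z ↦ z̃` as a continuous linear map. -/
def tildeL (d : ℕ) : Plane d →L[ℝ] Plane d :=
  LinearMap.toContinuousLinearMap
    { toFun := tilde
      map_add' := tilde_add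
      map_smul' := tilde_smul }

theorem tildeL_apply (z : Plane d) : tildeL d z = tilde z := rfl

theorem norm_sub_smul_tilde_sq (b : ℝ) (z : Plane d) :
    ‖z - b • tilde z‖ ^ 2 = (1 + b ^ 2) * ‖z‖ ^ 2 := by
  rw [norm_sub_sq_real, real_inner_smul_right, real_inner_comm, inner_tilde_self, norm_smul,
    norm_tilde, mul_pow, Real.norm_eq_abs, sq_abs]
  ring

theorem norm_le_norm_sub_smul_tilde (b : ℝ) (z : Plane d) : ‖z‖ ≤ ‖z - b • tilde z‖ := by
  rw [← sq_le_sq₀ (norm_nonneg _) (norm_nonneg _), norm_sub_smul_tilde_sq]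
  nlinarith [sq_nonneg (b * ‖z‖)]

/-- The isometry proportional to `z ↦ z - b z̃`. -/
def rotation (b : ℝ) : Plane d →ₗᵢ[ℝ] Plane d where
  toLinearMap := (√(1 + b ^ 2))⁻¹ • (ContinuousLinearMap.id ℝ (Plane d) - b • tildeL d).toLinearMap
  norm_map' z := by
    have h : 0 < 1 + b ^ 2 := by positivity
    change ‖(√(1 + b ^ 2))⁻¹ • (z - b • tilde z)‖ = ‖z‖
    rw [← sq_eq_sq₀ (norm_nonneg _) (norm_nonneg _), norm_smul, mul_pow, norm_sub_smul_tilde_sq,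
      Real.norm_eq_abs, sq_abs, inv_pow, Real.sq_sqrt h.le, inv_mul_cancel_left₀ h.ne']

theorem rotation_apply (b : ℝ) (z : Plane d) :
    rotation b z = (√(1 + b ^ 2))⁻¹ • (z - b • tilde z) := rfl

/-- The map is √(1+b²) times the isometry `rotation b`, so preimages shrink in volume. -/
theorem volume_preimage_sub_smul_tilde_le (b : ℝ) {s : Set (Plane d)} (hs : MeasurableSet s) :
    volume {z : Plane d | z - b • tilde z ∈ s} ≤ volume s := by
  have hc : 0 < √(1 + b ^ 2) := by positivity
  have h1 : {z : Plane d | z - b • tilde z ∈ s} =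
      (rotation b).toLinearIsometryEquiv rfl ⁻¹' ((√(1 + b ^ 2) • ·) ⁻¹' s) := by
    ext z
    change _ ↔ √(1 + b ^ 2) • rotation b z ∈ s
    rw [rotation_apply, smul_inv_smul₀ hc.ne']
    rfl
  have h2 : MeasurableSet ((√(1 + b ^ 2) • · : Plane d → Plane d) ⁻¹' s) :=
    (measurable_const_smul _) hs
  rw [h1, (LinearIsometryEquiv.measurePreserving _).measure_preimage h2.nullMeasurableSet,
    Measure.addHaar_preimage_smul _ hc.ne']
  refine mul_le_of_le_one_left' (ENNReal.ofReal_le_one.2 ?_)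
  have hc1 : 1 ≤ √(1 + b ^ 2) := Real.one_le_sqrt.2 (by nlinarith [sq_nonneg b])
  rw [abs_of_pos (by positivity)]
  exact inv_le_one_of_one_le₀ (one_le_pow₀ hc1)

/-- The shear `(z, α) ↦ (z - τ α z̃, α)`. -/
def shearMap (τ : ℝ) (p : Heis d) : Heis d := (p.1 - (τ * p.2) • tilde p.1, p.2)

theorem hasTemperateGrowth_shearMap (τ : ℝ) : (shearMap (d := d) τ).HasTemperateGrowth := by
  have h1 : Function.HasTemperateGrowth fun p : Heis d => (τ * p.2) • tildeL d p.1 :=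
    ((Function.HasTemperateGrowth.const τ).mul
      (ContinuousLinearMap.snd ℝ (Plane d) ℝ).hasTemperateGrowth).smul
      ((tildeL d).comp (ContinuousLinearMap.fst ℝ (Plane d) ℝ)).hasTemperateGrowth
  have h2 := Function.HasTemperateGrowth.id'.sub
    ((ContinuousLinearMap.inl ℝ (Plane d) ℝ).hasTemperateGrowth.comp h1)
  convert h2 using 1
  funext p
  ext <;> simp [shearMap, tildeL_apply]

/-- Orthogonality of z̃ and z makes the shear norm-increasing. This keeps compositions Schwartz and
makes the decay estimates uniform in τ. -/
theorem norm_le_norm_shearMap (τ : ℝ) (p : Heis d) : ‖p‖ ≤ ‖shearMap τ p‖ :=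
  max_le_max (norm_le_norm_sub_smul_tilde _ _) le_rfl

theorem measurable_shearMap (τ : ℝ) : Measurable (shearMap (d := d) τ) :=
  (hasTemperateGrowth_shearMap τ).1.continuous.measurable

/-- Fubini in α: at fixed α the shear is the horizontal map with b = τα. -/
theorem map_shearMap_le (τ : ℝ) :
    (volume : Measure (Heis d)).map (shearMap τ) ≤ volume := by
  refine Measure.le_iff.2 fun s hs => ?_
  rw [Measure.map_apply (measurable_shearMap τ) hs, Measure.volume_eq_prod,
    Measure.prod_apply_symm hs, Measure.prod_apply_symm (measurable_shearMap τ hs)]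
  refine lintegral_mono fun α => ?_
  exact volume_preimage_sub_smul_tilde_le (τ * α) (measurable_prodMk_right hs)

/-- The shear operator `V(τ)`. -/
def shear (τ : ℝ) : HeisL2 d →L[ℂ] HeisL2 d :=
  compLp (measurable_shearMap τ) (map_shearMap_le τ)

theorem norm_shear_le (τ : ℝ) : ‖shear (d := d) τ‖ ≤ 1 := norm_compLp_le _ _

theorem isShear (τ : ℝ≥0) : IsShear τ (shear (d := d) (τ : ℝ)) := fun χ =>
  coeFn_compLp (measurable_shearMap (τ : ℝ)) (map_shearMap_le (τ : ℝ)) χ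

/-- The shear operator on Schwartz functions. -/
def shearS (τ : ℝ) : 𝓢(Heis d, ℂ) →L[ℂ] 𝓢(Heis d, ℂ) :=
  SchwartzMap.compCLM ℂ (hasTemperateGrowth_shearMap τ)
    ⟨1, 1, fun p => by linarith [norm_le_norm_shearMap τ p]⟩

theorem shearS_apply (τ : ℝ) (χ : 𝓢(Heis d, ℂ)) (p : Heis d) :
    shearS τ χ p = χ (shearMap τ p) := rfl

theorem shear_toLp (τ : ℝ) (χ : 𝓢(Heis d, ℂ)) :
    shear τ (χ.toLp 2 volume) = (shearS τ χ).toLp 2 volume := by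
  refine Lp.ext ?_
  have h := (quasiMeasurePreserving_of_map_le (measurable_shearMap τ)
    (map_shearMap_le (d := d) τ)).ae_eq (χ.coeFn_toLp 2 volume)
  exact (coeFn_compLp _ _ _).trans (h.trans ((shearS τ χ).coeFn_toLp 2 volume).symm)

/-- The symbol `e^{-(i/2) τ |α z̃|²}`. -/
def phaseSymbol (τ : ℝ) (p : Heis d) : ℂ :=
  Complex.exp (-Complex.I / 2 * τ * ‖p.2 • tilde p.1‖ ^ 2)

theorem hasTemperateGrowth_phaseSymbol (τ : ℝ) :
    (phaseSymbol (d := d) τ).HasTemperateGrowth := by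
  have h0 : Function.HasTemperateGrowth fun p : Heis d => p.2 • tildeL d p.1 :=
    (ContinuousLinearMap.snd ℝ (Plane d) ℝ).hasTemperateGrowth.smul
      ((tildeL d).comp (ContinuousLinearMap.fst ℝ (Plane d) ℝ)).hasTemperateGrowth
  have h1 : Function.HasTemperateGrowth fun p : Heis d => ‖p.2 • tilde p.1‖ ^ 2 :=
    (Function.hasTemperateGrowth_norm_sq (Plane d)).comp h0
  have h2 := ((Function.HasTemperateGrowth.const (-(τ / 2))).mul h1).cexp_I_mul
  convert h2 using 1
  funext p
  rw [phaseSymbol]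
  congr 1
  simp only [Pi.mul_apply]
  push_cast
  ring

theorem norm_phaseSymbol (τ : ℝ) (p : Heis d) : ‖phaseSymbol τ p‖ = 1 := by
  have : phaseSymbol τ p =
      Complex.exp ((-(τ / 2 * ‖p.2 • tilde p.1‖ ^ 2) : ℝ) * Complex.I) := by
    rw [phaseSymbol]; congr 1; push_cast; ring
  rw [this, Complex.norm_exp_ofReal_mul_I]

theorem measurable_phaseSymbol (τ : ℝ) : Measurable (phaseSymbol (d := d) τ) :=
  (hasTemperateGrowth_phaseSymbol τ).1.continuous.measurable

/-- The phase multiplication `U₂(τ)`. -/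
def phaseMul (τ : ℝ) : HeisL2 d ≃ₗᵢ[ℂ] HeisL2 d :=
  unimodularMul volume (phaseSymbol τ) (measurable_phaseSymbol τ) (norm_phaseSymbol τ)

theorem isPhaseMultiplication (τ : ℝ≥0) :
    IsPhaseMultiplication τ (phaseMul (d := d) (τ : ℝ)) := fun χ =>
  coeFn_unimodularMul _ _ (measurable_phaseSymbol (τ : ℝ)) (norm_phaseSymbol (τ : ℝ)) χ

/-- The phase multiplication on Schwartz functions. -/
def phaseMulS (τ : ℝ) : 𝓢(Heis d, ℂ) →L[ℂ] 𝓢(Heis d, ℂ) :=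
  SchwartzMap.smulLeftCLM ℂ (phaseSymbol τ)

theorem phaseMulS_apply (τ : ℝ) (χ : 𝓢(Heis d, ℂ)) (p : Heis d) :
    phaseMulS τ χ p = phaseSymbol τ p * χ p :=
  SchwartzMap.smulLeftCLM_apply_apply (hasTemperateGrowth_phaseSymbol τ) χ p

theorem phaseMul_toLp (τ : ℝ) (χ : 𝓢(Heis d, ℂ)) :
    phaseMul τ (χ.toLp 2 volume) = (phaseMulS τ χ).toLp 2 volume :=
  unimodularMul_toLp _ _ (measurable_phaseSymbol τ) (norm_phaseSymbol τ)
    (hasTemperateGrowth_phaseSymbol τ) χ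

/-- The operators `S(τ) = F⁻¹ U₂(τ) V(τ) U₁(τ) F`. -/
def fresnelOperator (τ : ℝ) : HeisL2 d →L[ℂ] HeisL2 d :=
  ((phaseMul τ).trans
    (centralFourier d).symm).toContinuousLinearEquiv.toContinuousLinearMap ∘L (shear τ ∘L
      ((centralFourier d).trans (freeEvolution τ)).toContinuousLinearEquiv.toContinuousLinearMap)

theorem fresnelOperator_apply (τ : ℝ) (ψ : HeisL2 d) : fresnelOperator τ ψ =
    (centralFourier d).symm (phaseMul τ (shear τ (freeEvolution τ (centralFourier d ψ)))) := rfl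

theorem norm_fresnelOperator_le (τ : ℝ) : ‖fresnelOperator (d := d) τ‖ ≤ 1 := by
  refine ContinuousLinearMap.opNorm_le_bound _ zero_le_one fun ψ => ?_
  rw [fresnelOperator_apply, LinearIsometryEquiv.norm_map, LinearIsometryEquiv.norm_map, one_mul]
  refine ((shear τ).le_of_opNorm_le (norm_shear_le τ) _).trans_eq ?_
  rw [one_mul, LinearIsometryEquiv.norm_map, LinearIsometryEquiv.norm_map]

/-- The action of `S(τ)` on Schwartz functions. -/
def fresnelS (τ : ℝ) (ψ : 𝓢(Heis d, ℂ)) : 𝓢(Heis d, ℂ) :=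
  (centralFourierS d).symm (phaseMulS τ (shearS τ (freeEvolutionS τ (centralFourierS d ψ))))

theorem fresnelOperator_toLp (τ : ℝ) (ψ : 𝓢(Heis d, ℂ)) :
    fresnelOperator τ (ψ.toLp 2 volume) = (fresnelS τ ψ).toLp 2 volume := by
  rw [fresnelOperator_apply, centralFourier_toLp, freeEvolution_toLp, shear_toLp, phaseMul_toLp,
    centralFourier_symm_toLp]
  rfl

theorem fresnelS_apply (τ : ℝ) (ψ : 𝓢(Heis d, ℂ)) (p : Heis d) :
    fresnelS τ ψ p = ((√(2 * Real.pi) : ℝ) : ℂ)⁻¹ * ∫ α : ℝ, Complex.exp (Complex.I * α * p.2) *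
      (phaseSymbol τ (p.1, α) *
        freeEvolutionS τ (centralFourierS d ψ) (p.1 - (τ * α) • tilde p.1, α)) := by
  rw [fresnelS, centralFourierS_symm_apply]
  simp only [phaseMulS_apply, shearS_apply, shearMap]

theorem fresnelOperator_zero : fresnelOperator (d := d) 0 = 1 := by
  ext1 ψ
  have h1 : ∀ χ : HeisL2 d, phaseMul 0 χ = χ := fun χ => by
    refine Lp.ext ((coeFn_unimodularMul _ _ (measurable_phaseSymbol 0) (norm_phaseSymbol 0)
      χ).trans (Eventually.of_forall fun p => by simp [phaseSymbol]))
  have h2 : ∀ χ : HeisL2 d, shear 0 χ = χ := fun χ => by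
    refine Lp.ext ((coeFn_compLp _ _ χ).trans (Eventually.of_forall fun p => ?_))
    simp [shearMap]
  have h3 : ∀ χ : HeisL2 d, freeEvolution 0 χ = χ := fun χ => by
    refine (horizontalFourierL2 d).symm_apply_eq.2 (Lp.ext ?_)
    exact (coeFn_unimodularMul _ _ (measurable_freeSymbol 0) (norm_freeSymbol 0)
      _).trans (Eventually.of_forall fun p => by simp [freeSymbol])
  rw [fresnelOperator_apply, h1, h2, h3, LinearIsometryEquiv.symm_apply_apply]
  rfl

end Heis

/-! ### Fresnel integrals of integrable and of constant amplitudes. -/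

section Fresnel

open FourierTransform

variable {V : Type*} [NormedAddCommGroup V] [InnerProductSpace ℝ V] [FiniteDimensional ℝ V]
  [MeasurableSpace V] [BorelSpace V]

theorem norm_cexp_I_mul_norm_sq (x : V) : ‖Complex.exp (Complex.I * ‖x‖ ^ 2 / 2)‖ = 1 := by
  have : Complex.I * (‖x‖ : ℂ) ^ 2 / 2 = ((‖x‖ ^ 2 / 2 : ℝ) : ℂ) * Complex.I := by
    push_cast; ring
  rw [this, Complex.norm_exp_ofReal_mul_I]

theorem norm_fresnelKernel_mul (x : V) (a : ℂ) :
    ‖Complex.exp (Complex.I * ‖x‖ ^ 2 / 2) * a‖ = ‖a‖ := by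
  rw [norm_mul, norm_cexp_I_mul_norm_sq, one_mul]

theorem continuous_fresnelKernel :
    Continuous fun x : V => Complex.exp (Complex.I * ‖x‖ ^ 2 / 2) := by fun_prop

theorem integrable_fresnelKernel_mul {f : V → ℂ} (hf : Integrable f) :
    Integrable fun x => Complex.exp (Complex.I * ‖x‖ ^ 2 / 2) * f x :=
  hf.mono (continuous_fresnelKernel.aestronglyMeasurable.mul hf.1)
    (Eventually.of_forall fun x => (norm_fresnelKernel_mul x _).le)

/-- Dominated convergence: φ is bounded and φ(εx) → φ(0) = 1, so the regularization disappears in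
the limit. -/
theorem hasFresnelIntegral_of_integrable {f : V → ℂ} (hf : Integrable f) :
    HasFresnelIntegral f (∫ x, Complex.exp (Complex.I * ‖x‖ ^ 2 / 2) * f x) := by
  intro φ hφ
  obtain ⟨C, hC⟩ := φ.decay 0 0
  have hC' : ∀ x, ‖φ x‖ ≤ C := fun x => by simpa using hC.2 x
  have hg := integrable_fresnelKernel_mul hf
  have hmeas : ∀ ε : ℝ, AEStronglyMeasurable
      (fun x : V => φ (ε • x) * Complex.exp (Complex.I * ‖x‖ ^ 2 / 2) * f x) volume := fun ε =>
    (((φ.continuous.comp (continuous_const_smul ε)).mul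
      continuous_fresnelKernel).aestronglyMeasurable.mul hf.1)
  have hbd : ∀ (ε : ℝ) (x : V),
      ‖φ (ε • x) * Complex.exp (Complex.I * ‖x‖ ^ 2 / 2) * f x‖ ≤ C * ‖f x‖ := fun ε x => by
    rw [mul_assoc, norm_mul, norm_fresnelKernel_mul]
    gcongr
    exact hC' _
  refine ⟨fun ε _ => (hf.norm.const_mul C).mono' (hmeas ε) (Eventually.of_forall (hbd ε)), ?_⟩
  refine tendsto_integral_filter_of_dominated_convergence (fun x => C * ‖f x‖)
    (Eventually.of_forall hmeas) (Eventually.of_forall fun ε => Eventually.of_forall (hbd ε))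
    (hf.norm.const_mul C) (Eventually.of_forall fun x => ?_)
  have h1 : Tendsto (fun ε : ℝ => φ (ε • x)) (𝓝[>] 0) (𝓝 (φ 0)) := by
    have h2 : Continuous fun ε : ℝ => φ (ε • x) := φ.continuous.comp (by fun_prop)
    have := h2.tendsto 0
    rw [zero_smul] at this
    exact this.mono_left nhdsWithin_le_nhds
  rw [hφ] at h1
  simpa only [one_mul] using
    (h1.mul_const (Complex.exp (Complex.I * ‖x‖ ^ 2 / 2))).mul_const (f x)

theorem exists_schwartz_apply_zero_eq_one (V : Type*) [NormedAddCommGroup V]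
    [InnerProductSpace ℝ V] [FiniteDimensional ℝ V] : ∃ φ : 𝓢(V, ℂ), φ 0 = 1 := by
  let f : ContDiffBump (0 : V) := default
  have h1 : ContDiff ℝ ∞ fun x => (f x : ℂ) := Complex.ofRealCLM.contDiff.comp f.contDiff
  have h2 : HasCompactSupport fun x => (f x : ℂ) := 
    f.hasCompactSupport.comp_left (g := Complex.ofReal) rfl
  exact ⟨h2.toSchwartzMap h1, by 
    change ((f 0 : ℝ) : ℂ) = 1
    rw [f.one_of_mem_closedBall (Metric.mem_closedBall_self f.rIn_pos.le), Complex.ofReal_one]⟩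

theorem HasFresnelIntegral.unique {f : V → ℂ} {w w' : ℂ} (h : HasFresnelIntegral f w)
    (h' : HasFresnelIntegral f w') : w = w' := by
  obtain ⟨φ, hφ⟩ := exists_schwartz_apply_zero_eq_one V
  exact tendsto_nhds_unique (h φ hφ).2 (h' φ hφ).2

/-- Write φ by Fourier inversion, exchange the integrals, and use the known Fourier transform of the
Gaussian. -/
theorem integral_schwartz_mul_gaussian (φ : 𝓢(V, ℂ)) (w : V) (r : ℝ) {b : ℂ} (hb : 0 < b.re) :
    ∫ x, φ (w + r • x) * Complex.exp (-b * ‖x‖ ^ 2) =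
      (Real.pi / b) ^ (Module.finrank ℝ V / 2 : ℂ) *
        ∫ ξ, Complex.exp (2 * Real.pi * Complex.I * (inner ℝ ξ w : ℝ)) *
          Complex.exp (-(Real.pi ^ 2 * r ^ 2 * ‖ξ‖ ^ 2 / b)) * 𝓕 φ ξ := by
  have hinv : ∀ x, φ x =
      ∫ ξ, Complex.exp (2 * Real.pi * Complex.I * (inner ℝ ξ x : ℝ)) * 𝓕 φ ξ := fun x => by
    have h0 : 𝓕⁻ (𝓕 φ) = φ := FourierPair.fourierInv_fourier_eq φ
    conv_lhs => rw [← h0, SchwartzMap.fourierInv_coe,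
      Real.fourierInv_eq']
    refine integral_congr_ae (Eventually.of_forall fun ξ => ?_)
    simp only [smul_eq_mul]
    congr 2
    push_cast
    ring
  have hint : Integrable (Function.uncurry fun (x ξ : V) =>
      Complex.exp (-b * ‖x‖ ^ 2) *
        (Complex.exp (2 * Real.pi * Complex.I * (inner ℝ ξ (w + r • x) : ℝ)) * 𝓕 φ ξ))
      (volume.prod volume) := by
    have h1 : Integrable fun x : V => Complex.exp (-b * ‖x‖ ^ 2) := by
      simpa using GaussianFourier.integrable_cexp_neg_mul_sq_norm_add hb 0 (0 : V)
    refine (h1.mul_prod (𝓕 φ).integrable).mono ?_ (Eventually.of_forall fun p => ?_)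
    · refine Continuous.aestronglyMeasurable ?_
      have := (𝓕 φ).continuous
      unfold Function.uncurry
      fun_prop
    · simp only [Function.uncurry, norm_mul]
      have : Complex.exp (2 * Real.pi * Complex.I * (inner ℝ p.2 (w + r • p.1) : ℝ)) =
          Complex.exp ((2 * Real.pi * inner ℝ p.2 (w + r • p.1) : ℝ) * Complex.I) := by
        congr 1; push_cast; ring
      rw [this, Complex.norm_exp_ofReal_mul_I, one_mul]
  calc ∫ x, φ (w + r • x) * Complex.exp (-b * ‖x‖ ^ 2)
      = ∫ x, ∫ ξ, Complex.exp (-b * ‖x‖ ^ 2) *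
        (Complex.exp (2 * Real.pi * Complex.I * (inner ℝ ξ (w + r • x) : ℝ)) * 𝓕 φ ξ) := by
        refine integral_congr_ae (Eventually.of_forall fun x => ?_)
        simp only [integral_const_mul]
        rw [hinv, mul_comm]
    _ = ∫ ξ, ∫ x, Complex.exp (-b * ‖x‖ ^ 2) *
        (Complex.exp (2 * Real.pi * Complex.I * (inner ℝ ξ (w + r • x) : ℝ)) * 𝓕 φ ξ) :=
        integral_integral_swap hint
    _ = ∫ ξ, (Real.pi / b) ^ (Module.finrank ℝ V / 2 : ℂ) *
        (Complex.exp (2 * Real.pi * Complex.I * (inner ℝ ξ w : ℝ)) *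
          Complex.exp (-(Real.pi ^ 2 * r ^ 2 * ‖ξ‖ ^ 2 / b)) * 𝓕 φ ξ) := by
        refine integral_congr_ae (Eventually.of_forall fun ξ => ?_)
        have h2 := GaussianFourier.integral_cexp_neg_mul_sq_norm_add hb
          (2 * Real.pi * Complex.I * r) ξ
        have h3 : ∀ x : V, Complex.exp (-b * ‖x‖ ^ 2) *
            (Complex.exp (2 * Real.pi * Complex.I * (inner ℝ ξ (w + r • x) : ℝ)) * 𝓕 φ ξ) =
            Complex.exp (-b * ‖x‖ ^ 2 + 2 * Real.pi * Complex.I * r * (inner ℝ ξ x : ℝ)) *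
              (Complex.exp (2 * Real.pi * Complex.I * (inner ℝ ξ w : ℝ)) * 𝓕 φ ξ) := fun x => by
          rw [← mul_assoc, ← mul_assoc, ← Complex.exp_add, ← Complex.exp_add, inner_add_right,
            real_inner_smul_right]
          congr 2
          push_cast
          ring
        simp only [h3]
        rw [integral_mul_const, h2]
        have h4 : (2 * Real.pi * Complex.I * r : ℂ) ^ 2 * ‖ξ‖ ^ 2 / (4 * b) =
            -(Real.pi ^ 2 * r ^ 2 * ‖ξ‖ ^ 2 / b) := by
          rw [show (2 * Real.pi * Complex.I * r : ℂ) ^ 2 = -(4 * (Real.pi ^ 2 * r ^ 2)) by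
            rw [mul_pow, mul_pow, Complex.I_sq]; ring]
          rw [neg_mul, neg_div, mul_assoc, mul_div_mul_left _ _ (by norm_num)]
        rw [h4]
        ring
    _ = _ := integral_const_mul _ _

/-- The Gaussian identity at b = δ − i/2 as δ ↓ 0; both integrands are dominated because Re b and Re
b⁻¹ are positive. The even dimension makes (π/b)^{dim/2} an integer power, so no branch of the root
has to be followed. -/
theorem integral_schwartz_mul_fresnelKernel {d : ℕ} (hd : Module.finrank ℝ V = 2 * d)
    (φ : 𝓢(V, ℂ)) (w : V) {r : ℝ} (hr : r ≠ 0) :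
    ∫ x, Complex.exp (Complex.I * ‖x‖ ^ 2 / 2) * φ (w + r • x) =
      (2 * Real.pi * Complex.I) ^ d *
        ∫ ξ, Complex.exp (2 * Real.pi * Complex.I * (inner ℝ ξ w : ℝ)) *
          Complex.exp (-(2 * Real.pi ^ 2 * r ^ 2 * ‖ξ‖ ^ 2 * Complex.I)) * 𝓕 φ ξ := by
  have hφ : Integrable fun x : V => φ (w + r • x) :=
    ((φ.integrable (μ := volume)).comp_add_left w).comp_smul hr
  let b : ℝ → ℂ := fun δ => δ - Complex.I / 2
  have hbre : ∀ δ, (b δ).re = δ := fun δ => by simp [b]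
  have hbc : Continuous b := by fun_prop
  have hb0 : b 0 = -(Complex.I / 2) := by simp [b]
  have hb0' : b 0 ≠ 0 := by rw [hb0]; simp
  have hbpos : ∀ᶠ δ in 𝓝[>] (0 : ℝ), 0 < (b δ).re := by
    filter_upwards [self_mem_nhdsWithin] with δ hδ
    rw [hbre]; exact hδ
  have hnorm : ∀ (ξ : V), ‖Complex.exp (2 * Real.pi * Complex.I * (inner ℝ ξ w : ℝ))‖ = 1 := by
    intro ξ
    have : Complex.exp (2 * Real.pi * Complex.I * (inner ℝ ξ w : ℝ)) =
        Complex.exp ((2 * Real.pi * inner ℝ ξ w : ℝ) * Complex.I) := by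
      congr 1; push_cast; ring
    rw [this, Complex.norm_exp_ofReal_mul_I]
  have hb : Tendsto b (𝓝[>] 0) (𝓝 (b 0)) := (hbc.tendsto 0).mono_left nhdsWithin_le_nhds
  have L : Tendsto (fun δ => ∫ x, φ (w + r • x) * Complex.exp (-b δ * ‖x‖ ^ 2)) (𝓝[>] 0)
      (𝓝 (∫ x, φ (w + r • x) * Complex.exp (-b 0 * ‖x‖ ^ 2))) := by
    refine tendsto_integral_filter_of_dominated_convergence (fun x => ‖φ (w + r • x)‖)
      (Eventually.of_forall fun δ => ?_) ?_ hφ.norm (Eventually.of_forall fun x => ?_)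
    · exact hφ.1.mul (Continuous.aestronglyMeasurable (by fun_prop))
    · filter_upwards [hbpos] with δ hδ
      refine Eventually.of_forall fun x => ?_
      rw [norm_mul, Complex.norm_exp]
      refine mul_le_of_le_one_right (norm_nonneg _) (Real.exp_le_one_iff.2 ?_)
      rw [← Complex.ofReal_pow, Complex.re_mul_ofReal, Complex.neg_re]
      nlinarith [sq_nonneg ‖x‖]
    · exact ((((hb.neg).mul_const _).cexp).const_mul _)
  have R : Tendsto (fun δ => ((Real.pi / b δ) ^ d *
        ∫ ξ, Complex.exp (2 * Real.pi * Complex.I * (inner ℝ ξ w : ℝ)) *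
          Complex.exp (-(Real.pi ^ 2 * r ^ 2 * ‖ξ‖ ^ 2 / b δ)) * 𝓕 φ ξ)) (𝓝[>] 0)
      (𝓝 ((Real.pi / b 0) ^ d *
        ∫ ξ, Complex.exp (2 * Real.pi * Complex.I * (inner ℝ ξ w : ℝ)) *
          Complex.exp (-(Real.pi ^ 2 * r ^ 2 * ‖ξ‖ ^ 2 / b 0)) * 𝓕 φ ξ)) := by
    refine ((tendsto_const_nhds.div hb hb0').pow d).mul ?_
    refine tendsto_integral_filter_of_dominated_convergence (fun ξ => ‖𝓕 φ ξ‖)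
      (Eventually.of_forall fun δ => ?_) ?_ (𝓕 φ).integrable.norm
      (Eventually.of_forall fun ξ => ?_)
    · have := (𝓕 φ).continuous
      exact Continuous.aestronglyMeasurable (by fun_prop)
    · filter_upwards [hbpos] with δ hδ
      refine Eventually.of_forall fun ξ => ?_
      rw [norm_mul, norm_mul, hnorm, one_mul, Complex.norm_exp]
      refine mul_le_of_le_one_left (norm_nonneg _) (Real.exp_le_one_iff.2 ?_)
      have h5 : (Real.pi : ℂ) ^ 2 * r ^ 2 * ‖ξ‖ ^ 2 / b δ =
          ((Real.pi ^ 2 * r ^ 2 * ‖ξ‖ ^ 2 : ℝ) : ℂ) * (b δ)⁻¹ := by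
        push_cast; rw [div_eq_mul_inv]
      rw [h5, Complex.neg_re, Complex.re_ofReal_mul, Complex.inv_re, Left.neg_nonpos_iff]
      have := Complex.normSq_nonneg (b δ)
      positivity
    · exact (((tendsto_const_nhds.div hb hb0').neg.cexp).const_mul _).mul_const _
  have hcpow : ∀ z : ℂ, z ^ (Module.finrank ℝ V / 2 : ℂ) = z ^ d := fun z => by
    rw [hd]
    push_cast
    rw [mul_div_cancel_left₀ _ two_ne_zero, Complex.cpow_natCast]
  have key := tendsto_nhds_unique L (R.congr' (by
    filter_upwards [hbpos] with δ hδ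
    rw [integral_schwartz_mul_gaussian φ w r hδ, hcpow]))
  have h6 : (Real.pi / b 0 : ℂ) = 2 * Real.pi * Complex.I := by
    rw [hb0, div_eq_iff (by simp)]
    linear_combination (Real.pi : ℂ) * Complex.I_sq
  have h7 : ∀ ξ : V, (Real.pi ^ 2 * r ^ 2 * ‖ξ‖ ^ 2 / b 0 : ℂ) =
      2 * Real.pi ^ 2 * r ^ 2 * ‖ξ‖ ^ 2 * Complex.I := fun ξ => by
    rw [hb0, div_eq_iff (by simp)]
    linear_combination (Real.pi ^ 2 * r ^ 2 * ‖ξ‖ ^ 2 : ℂ) * Complex.I_sq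
  simp only [h6, h7] at key
  rw [← key]
  refine integral_congr_ae (Eventually.of_forall fun x => ?_)
  simp only [hb0]
  rw [mul_comm]
  congr 2
  ring

/-- Needed for τ = 0, where absolute convergence fails without the regularization. On the Fourier
side the regularized integral is a constant times ∫ e^{−2π²iε²|ξ|²} φ̂(ξ) dξ, which tends to ∫ φ̂ =
φ(0) = 1. -/
theorem hasFresnelIntegral_const {d : ℕ} (hd : Module.finrank ℝ V = 2 * d) (a : ℂ) :
    HasFresnelIntegral (fun _ : V => a) ((2 * Real.pi * Complex.I) ^ d * a) := by
  intro φ hφ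
  refine ⟨fun ε hε => ?_, ?_⟩
  · have h1 : Integrable fun x : V => φ (ε • x) := (φ.integrable (μ := volume)).comp_smul hε.ne'
    have := integrable_fresnelKernel_mul h1
    refine (this.congr (Eventually.of_forall fun x => ?_)).mul_const a
    simp only [mul_comm]
  · have h0 : ∀ ε : ℝ, 0 < ε →
        ∫ x : V, φ (ε • x) * Complex.exp (Complex.I * ‖x‖ ^ 2 / 2) * a =
        (2 * Real.pi * Complex.I) ^ d * (∫ ξ,
          Complex.exp (-(2 * Real.pi ^ 2 * ε ^ 2 * ‖ξ‖ ^ 2 * Complex.I)) * 𝓕 φ ξ) * a := by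
      intro ε hε
      have := integral_schwartz_mul_fresnelKernel hd φ 0 hε.ne'
      simp only [zero_add, inner_zero_right, Complex.ofReal_zero, mul_zero, Complex.exp_zero,
        one_mul] at this
      rw [← this, integral_mul_const]
      simp only [mul_comm]
    have h1 : Tendsto (fun ε : ℝ => ∫ ξ,
          Complex.exp (-(2 * Real.pi ^ 2 * ε ^ 2 * ‖ξ‖ ^ 2 * Complex.I)) * 𝓕 φ ξ)
        (𝓝[>] 0) (𝓝 (∫ ξ, 𝓕 φ ξ)) := by
      have hcont := (𝓕 φ).continuous
      refine tendsto_integral_filter_of_dominated_convergence (fun ξ => ‖𝓕 φ ξ‖)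
        (Eventually.of_forall fun δ => Continuous.aestronglyMeasurable (by fun_prop))
        (Eventually.of_forall fun ε => Eventually.of_forall fun ξ => ?_)
        (𝓕 φ).integrable.norm (Eventually.of_forall fun ξ => ?_)
      · have : Complex.exp (-(2 * Real.pi ^ 2 * ε ^ 2 * ‖ξ‖ ^ 2 * Complex.I)) =
            Complex.exp ((-(2 * Real.pi ^ 2 * ε ^ 2 * ‖ξ‖ ^ 2) : ℝ) * Complex.I) := by
          congr 1; push_cast; ring
        rw [norm_mul, this, Complex.norm_exp_ofReal_mul_I, one_mul]
      · have h2 : Continuous fun ε : ℝ =>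
            Complex.exp (-(2 * Real.pi ^ 2 * ε ^ 2 * ‖ξ‖ ^ 2 * Complex.I)) * 𝓕 φ ξ := by fun_prop
        have := h2.tendsto 0
        simp only [Complex.ofReal_zero, ne_eq, OfNat.ofNat_ne_zero, not_false_eq_true, zero_pow,
          mul_zero, zero_mul, neg_zero, Complex.exp_zero, one_mul] at this
        exact this.mono_left nhdsWithin_le_nhds
    have h2 : ∫ ξ, 𝓕 φ ξ = 1 := by
      have : 𝓕⁻ (𝓕 φ) 0 = φ 0 := by rw [FourierPair.fourierInv_fourier_eq]
      rw [SchwartzMap.fourierInv_coe, Real.fourierInv_eq', hφ] at this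
      simpa using this
    rw [h2] at h1
    have h3 := (h1.const_mul ((2 * Real.pi * Complex.I) ^ d)).mul_const a
    rw [mul_one] at h3
    refine h3.congr' ?_
    filter_upwards [self_mem_nhdsWithin] with ε hε
    exact (h0 ε hε).symm

end Fresnel

/-! ### The product of the three factors is the Fresnel average. -/

namespace Heis

open FourierTransform

variable {d : ℕ}

theorem finrank_plane : Module.finrank ℝ (Plane d) = 2 * d := by simp [two_mul]

theorem two_pi_I_pow_ne_zero : (2 * Real.pi * Complex.I : ℂ) ^ d ≠ 0 :=
  pow_ne_zero _ (by simp [Real.pi_ne_zero])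

theorem horizontalSlice_apply (χ : 𝓢(Heis d, ℂ)) (p : Heis d) (z : Plane d) :
    (horizontalSplitting d).slice p χ z = χ (z, p.2) := by
  rw [Splitting.slice_apply, horizontalSplitting_slice]

theorem horizontalFourier_smul (χ : 𝓢(Heis d, ℂ)) (p : Heis d) (ξ : Plane d) :
    horizontalFourier χ ((2 * Real.pi) • ξ) p.2 =
      ((2 * Real.pi : ℂ) ^ (2 * d))⁻¹ * 𝓕 ((horizontalSplitting d).slice p χ) ξ := by
  rw [horizontalFourier, SchwartzMap.fourier_coe, Real.fourier_eq']
  congr 1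
  refine integral_congr_ae (Eventually.of_forall fun z => ?_)
  simp only [horizontalSlice_apply, real_inner_smul_left, smul_eq_mul]
  rw [real_inner_comm]
  congr 2
  push_cast
  ring

/-- The Fresnel form of the free Schrödinger propagator: the kernel identity with r = √τ, after the
substitution η = 2πξ. -/
theorem freeEvolutionS_eq {τ : ℝ} (hτ : 0 < τ) (χ : 𝓢(Heis d, ℂ)) (p : Heis d) :
    freeEvolutionS τ χ p = ((2 * Real.pi * Complex.I) ^ d)⁻¹ *
      ∫ ζ : Plane d, Complex.exp (Complex.I * ‖ζ‖ ^ 2 / 2) * χ (p.1 + √τ • ζ, p.2) := by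
  have h1 := integral_schwartz_mul_fresnelKernel finrank_plane
    ((horizontalSplitting d).slice p χ) p.1 (Real.sqrt_pos.2 hτ).ne'
  simp only [horizontalSlice_apply] at h1
  rw [h1, inv_mul_cancel_left₀ two_pi_I_pow_ne_zero, freeEvolutionS_apply]
  have h2 := Measure.integral_comp_smul (volume : Measure (Plane d))
    (fun η => Complex.exp (Complex.I * (inner ℝ η p.1 : ℝ)) *
      Complex.exp (-Complex.I / 2 * τ * ‖η‖ ^ 2) * horizontalFourier χ η p.2) (2 * Real.pi)
  have hpos : (0 : ℝ) < (2 * Real.pi) ^ (2 * d) := by positivity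
  rw [finrank_plane, abs_of_pos (inv_pos.2 hpos), eq_inv_smul_iff₀ hpos.ne'] at h2
  rw [← h2, Complex.real_smul, ← integral_const_mul]
  refine integral_congr_ae (Eventually.of_forall fun ξ => ?_)
  have hpi : (2 * Real.pi : ℂ) ^ (2 * d) ≠ 0 := pow_ne_zero _ (by simp [Real.pi_ne_zero])
  have hs : ((√τ : ℝ) : ℂ) ^ 2 = τ := by rw [← Complex.ofReal_pow, Real.sq_sqrt hτ.le]
  simp only [horizontalFourier_smul, real_inner_smul_left, norm_smul, hs, Real.norm_eq_abs,
    abs_of_pos Real.two_pi_pos]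
  push_cast
  rw [mul_left_comm, mul_inv_cancel_left₀ hpi]
  congr 3
  · ring
  · ring

/-- Supplies the integrable majorant for the exchange of the α and ζ integrals in `fresnelS_eq`. -/
theorem exists_schwartz_horizontal_dilation (χ : 𝓢(Heis d, ℂ)) (z : Plane d) {r : ℝ}
    (hr : r ≠ 0) : ∃ g : 𝓢(Heis d, ℂ), ∀ q : Heis d, g q = χ (z + r • q.1, q.2) := by
  let A : Heis d →L[ℝ] Heis d := (r • ContinuousLinearMap.fst ℝ (Plane d) ℝ).prod
    (ContinuousLinearMap.snd ℝ (Plane d) ℝ)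
  have hg : Function.HasTemperateGrowth fun q : Heis d => ((z, 0) : Heis d) + A q :=
    (Function.HasTemperateGrowth.const _).add A.hasTemperateGrowth
  refine ⟨SchwartzMap.compCLM ℂ hg ⟨1, (|r|⁻¹ + 1) * (‖z‖ + 1), fun q => ?_⟩ χ, fun q => ?_⟩
  · rw [pow_one]
    have h1 : |r| * ‖q.1‖ ≤ ‖z‖ + ‖z + r • q.1‖ := by
      rw [← Real.norm_eq_abs, ← norm_smul]
      calc ‖r • q.1‖ = ‖z + r • q.1 - z‖ := by rw [add_sub_cancel_left]
        _ ≤ _ := (norm_sub_le _ _).trans_eq (add_comm _ _)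
    have hA : ((z, 0) : Heis d) + A q = (z + r • q.1, q.2) := by ext <;> simp [A]
    rw [hA]
    set m := ‖((z + r • q.1, q.2) : Heis d)‖
    have h2 : ‖z + r • q.1‖ ≤ m := le_max_left _ _
    have h3 : ‖q.2‖ ≤ m := le_max_right _ _
    have hr' : 0 < |r| := abs_pos.2 hr
    have hz := norm_nonneg z
    have hm : 0 ≤ m := norm_nonneg _
    have h5 : (‖z‖ + m) ≤ (‖z‖ + 1) * (1 + m) := by nlinarith
    refine max_le ?_ ?_
    · have h4 : ‖q.1‖ ≤ |r|⁻¹ * (‖z‖ + m) := by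
        rw [inv_mul_eq_div, le_div_iff₀ hr']; linarith
      have : 0 ≤ (‖z‖ + 1) * (1 + m) := by positivity
      calc ‖q.1‖ ≤ |r|⁻¹ * (‖z‖ + m) := h4
        _ ≤ |r|⁻¹ * ((‖z‖ + 1) * (1 + m)) := by gcongr
        _ ≤ _ := by nlinarith
    · have : 0 ≤ |r|⁻¹ * ((‖z‖ + 1) * (1 + m)) := by positivity
      nlinarith
  · change χ (((z, 0) : Heis d) + A q) = _
    congr 1
    ext <;> simp [A]

/-- For r ≠ 0 the map ζ ↦ p + Aζ is affine and antilipschitz, so the amplitude is itself a Schwartz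
function of ζ. -/
theorem integrable_fiber (ψ : 𝓢(Heis d, ℂ)) (p : Heis d) {r : ℝ} (hr : r ≠ 0) :
    Integrable fun ζ : Plane d => ψ (p.1 + r • ζ, p.2 + r * symp p.1 ζ) := by
  let A : Plane d →L[ℝ] Heis d := (r • ContinuousLinearMap.id ℝ (Plane d)).prod
    (r • innerSL ℝ (tilde p.1))
  have hA : ∀ ζ, p + A ζ = (p.1 + r • ζ, p.2 + r * symp p.1 ζ) := fun ζ => by
    ext <;> simp [A, symp_eq_inner]
  have hr' : 0 < |r| := abs_pos.2 hr
  have hanti : AntilipschitzWith ‖r‖₊⁻¹ fun ζ : Plane d => p + A ζ :=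
    AntilipschitzWith.of_le_mul_dist fun ζ ζ' => by
      rw [dist_add_left, dist_eq_norm, dist_eq_norm, ← map_sub]
      have h1 : ‖r • (ζ - ζ')‖ ≤ ‖A (ζ - ζ')‖ := le_max_left _ _
      rw [norm_smul, Real.norm_eq_abs] at h1
      rw [NNReal.coe_inv, coe_nnnorm, Real.norm_eq_abs, inv_mul_eq_div, le_div_iff₀ hr']
      linarith
  have hg : Function.HasTemperateGrowth fun ζ : Plane d => p + A ζ :=
    (Function.HasTemperateGrowth.const _).add A.hasTemperateGrowth
  have := (SchwartzMap.compCLMOfAntilipschitz ℂ hg hanti ψ).integrable (μ := volume)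
  refine this.congr (Eventually.of_forall fun ζ => ?_)
  change ψ (p + A ζ) = _
  rw [hA]

theorem freeEvolutionS_shear {τ : ℝ} (hτ : 0 < τ) (χ : 𝓢(Heis d, ℂ)) (z : Plane d) (α : ℝ) :
    phaseSymbol τ (z, α) * freeEvolutionS τ χ (z - (τ * α) • tilde z, α) =
      ((2 * Real.pi * Complex.I) ^ d)⁻¹ * ∫ ζ : Plane d,
        Complex.exp (Complex.I * ‖ζ‖ ^ 2 / 2) *
          (Complex.exp (Complex.I * α * (√τ * symp z ζ : ℝ)) * χ (z + √τ • ζ, α)) := by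
  rw [freeEvolutionS_eq hτ, mul_left_comm, ← integral_const_mul]
  congr 1
  -- Complete the square: this translation moves the argument of χ back to z + √τζ, and |ζ|²
  -- acquires 2√τα z·_σ ζ + τ|αz̃|², whose last term `phaseSymbol` cancels.
  rw [← integral_add_right_eq_self _ ((√τ * α) • tilde z)]
  refine integral_congr_ae (Eventually.of_forall fun ζ => ?_)
  have hs : √τ * √τ = τ := Real.mul_self_sqrt hτ.le
  have h1 : z - (τ * α) • tilde z + √τ • (ζ + (√τ * α) • tilde z) = z + √τ • ζ := by
    rw [smul_add, smul_smul, ← mul_assoc, hs]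
    abel
  have h2 : ‖ζ + (√τ * α) • tilde z‖ ^ 2 =
      ‖ζ‖ ^ 2 + 2 * (√τ * α * symp z ζ) + τ * ‖α • tilde z‖ ^ 2 := by
    rw [norm_add_sq_real, real_inner_smul_right, symp_eq_inner, real_inner_comm, norm_smul,
      norm_smul, norm_mul, Real.norm_eq_abs, abs_of_nonneg (Real.sqrt_nonneg τ), mul_pow, mul_pow,
      mul_pow, Real.sq_sqrt hτ.le, Real.norm_eq_abs]
    ring
  have h3 : ((‖ζ + (√τ * α) • tilde z‖ : ℝ) : ℂ) ^ 2 =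
      ‖ζ‖ ^ 2 + 2 * (√τ * α * symp z ζ : ℝ) + τ * ‖α • tilde z‖ ^ 2 := by
    rw [← Complex.ofReal_pow, h2]
    push_cast
    ring
  simp only [h1, phaseSymbol]
  rw [← mul_assoc, ← mul_assoc, ← Complex.exp_add, ← Complex.exp_add, h3]
  congr 2
  push_cast
  ring

theorem centralFourierS_inversion (ψ : 𝓢(Heis d, ℂ)) (p : Heis d) :
    ((√(2 * Real.pi) : ℝ) : ℂ)⁻¹ *
      ∫ α : ℝ, Complex.exp (Complex.I * α * p.2) * centralFourierS d ψ (p.1, α) = ψ p := by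
  rw [← centralFourierS_symm_apply, LinearEquiv.symm_apply_apply]

/-- After Fubini the factor e^{iα√τ z·_σ ζ} merges with e^{iαs}, and central Fourier inversion
evaluates ψ at the translated s. -/
theorem fresnelS_eq {τ : ℝ} (hτ : 0 < τ) (ψ : 𝓢(Heis d, ℂ)) (p : Heis d) :
    fresnelS τ ψ p = ((2 * Real.pi * Complex.I) ^ d)⁻¹ *
      ∫ ζ : Plane d, Complex.exp (Complex.I * ‖ζ‖ ^ 2 / 2) *
        ψ (p.1 + √τ • ζ, p.2 + √τ * symp p.1 ζ) := by
  set χ := centralFourierS d ψ with hχ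
  have hr : √τ ≠ 0 := (Real.sqrt_pos.2 hτ).ne'
  obtain ⟨g, hg⟩ := exists_schwartz_horizontal_dilation χ p.1 hr
  have hint : Integrable (Function.uncurry fun (α : ℝ) (ζ : Plane d) =>
      Complex.exp (Complex.I * α * p.2) * (Complex.exp (Complex.I * ‖ζ‖ ^ 2 / 2) *
        (Complex.exp (Complex.I * α * (√τ * symp p.1 ζ : ℝ)) * χ (p.1 + √τ • ζ, α))))
      ((volume : Measure ℝ).prod (volume : Measure (Plane d))) := by
    have h1 : Integrable (fun q : ℝ × Plane d => g q.swap)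
        ((volume : Measure ℝ).prod (volume : Measure (Plane d))) :=
      (g.integrable (μ := (volume : Measure (Heis d)))).swap
    refine h1.mono (Continuous.aestronglyMeasurable ?_) (Eventually.of_forall fun q => ?_)
    · have h2 : Continuous χ := χ.continuous
      have h3 : Continuous fun w : Plane d => symp p.1 w := by
        simp only [symp_eq_inner]; fun_prop
      unfold Function.uncurry
      fun_prop
    · rw [hg]
      simp only [Function.uncurry]
      have e1 : ∀ x y : ℝ, ‖Complex.exp (Complex.I * x * y)‖ = 1 := fun x y => by
        rw [mul_assoc, ← Complex.ofReal_mul, mul_comm, Complex.norm_exp_ofReal_mul_I]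
      rw [norm_mul, e1, one_mul, norm_fresnelKernel_mul, norm_mul, e1, one_mul]
      rfl
  rw [fresnelS_apply]
  simp only [freeEvolutionS_shear hτ]
  have h4 : ∀ α : ℝ, Complex.exp (Complex.I * α * p.2) *
      (((2 * Real.pi * Complex.I) ^ d)⁻¹ * ∫ ζ : Plane d,
        Complex.exp (Complex.I * ‖ζ‖ ^ 2 / 2) *
          (Complex.exp (Complex.I * α * (√τ * symp p.1 ζ : ℝ)) * χ (p.1 + √τ • ζ, α))) =
      ((2 * Real.pi * Complex.I) ^ d)⁻¹ * ∫ ζ : Plane d, Complex.exp (Complex.I * α * p.2) *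
        (Complex.exp (Complex.I * ‖ζ‖ ^ 2 / 2) *
          (Complex.exp (Complex.I * α * (√τ * symp p.1 ζ : ℝ)) * χ (p.1 + √τ • ζ, α))) :=
    fun α => by rw [integral_const_mul]; ring
  simp only [← hχ, h4]
  rw [integral_const_mul, integral_integral_swap hint, mul_left_comm]
  congr 1
  rw [← integral_const_mul]
  refine integral_congr_ae (Eventually.of_forall fun ζ => ?_)
  dsimp only
  have h5 := centralFourierS_inversion ψ (p.1 + √τ • ζ, p.2 + √τ * symp p.1 ζ)
  rw [← h5, ← hχ]
  rw [mul_left_comm]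
  congr 1
  rw [← integral_const_mul]
  refine integral_congr_ae (Eventually.of_forall fun α => ?_)
  simp only
  rw [mul_left_comm, ← mul_assoc (Complex.exp (Complex.I * α * p.2)), ← Complex.exp_add]
  congr 3
  push_cast
  ring

theorem hasFresnelAverage_fresnelS (τ : ℝ≥0) (ψ : 𝓢(Heis d, ℂ)) (p : Heis d) :
    HasFresnelAverage τ ψ p (if τ = 0 then ψ p else fresnelS (τ : ℝ) ψ p) := by
  split_ifs with h
  · subst h
    refine ⟨(2 * Real.pi * Complex.I) ^ d * ψ p, ?_, ?_⟩
    · simpa using hasFresnelIntegral_const finrank_plane (ψ p)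
    · rw [inv_mul_cancel_left₀ two_pi_I_pow_ne_zero]
  · have hτ : 0 < (τ : ℝ) := NNReal.coe_pos.2 (pos_iff_ne_zero.2 h)
    exact ⟨_, hasFresnelIntegral_of_integrable (integrable_fiber ψ p (Real.sqrt_pos.2 hτ).ne'),
      fresnelS_eq hτ ψ p⟩

theorem HasFresnelAverage.unique {τ : ℝ≥0} {ψ : Heis d → ℂ} {p : Heis d} {w w' : ℂ}
    (h : HasFresnelAverage τ ψ p w) (h' : HasFresnelAverage τ ψ p w') : w = w' := by
  obtain ⟨I, hI, rfl⟩ := h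
  obtain ⟨I', hI', rfl⟩ := h'
  rw [hI.unique hI']

theorem existsUnique_fresnelAverage (τ : ℝ≥0) (ψ : 𝓢(Heis d, ℂ)) (p : Heis d) :
    ∃! w : ℂ, HasFresnelAverage τ ψ p w :=
  ⟨_, hasFresnelAverage_fresnelS τ ψ p, fun _ h => h.unique (hasFresnelAverage_fresnelS τ ψ p)⟩

theorem extendsFresnelAverage_fresnelOperator :
    ExtendsFresnelAverage fun τ : ℝ≥0 => fresnelOperator (d := d) (τ : ℝ) := by
  intro τ ψ
  rcases eq_or_ne τ 0 with rfl | h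
  · filter_upwards [ψ.coeFn_toLp 2 volume] with p hp
    have := hasFresnelAverage_fresnelS 0 ψ p
    rw [NNReal.coe_zero, fresnelOperator_zero, one_apply_eq_self, hp]
    simpa using this
  · filter_upwards [(fresnelS (τ : ℝ) ψ).coeFn_toLp 2 volume] with p hp
    have := hasFresnelAverage_fresnelS τ ψ p
    rw [if_neg h] at this
    rw [fresnelOperator_toLp, hp]
    exact this

/-- Fresnel limits are unique and Schwartz functions are dense in L². -/
theorem ExtendsFresnelAverage.unique {S S' : ℝ≥0 → HeisL2 d →L[ℂ] HeisL2 d}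
    (h : ExtendsFresnelAverage S) (h' : ExtendsFresnelAverage S') : S = S' := by
  funext τ
  have hd : DenseRange (SchwartzMap.toLpCLM ℂ ℂ 2 (volume : Measure (Heis d))) :=
    SchwartzMap.denseRange_toLpCLM ENNReal.ofNat_ne_top
  refine ContinuousLinearMap.coeFn_injective
    (hd.equalizer (S τ).continuous (S' τ).continuous (funext fun ψ => Lp.ext ?_))
  filter_upwards [h τ ψ, h' τ ψ] with p hp hp'
  exact hp.unique hp'

theorem existsUnique_extendsFresnelAverage :
    ∃! S : ℝ≥0 → HeisL2 d →L[ℂ] HeisL2 d, ExtendsFresnelAverage S :=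
  ⟨_, extendsFresnelAverage_fresnelOperator,
    fun _ h => h.unique extendsFresnelAverage_fresnelOperator⟩

end Heis

/-! ### Derivatives at τ = 0 of the three factors and of their product. -/

theorem norm_taylor_two_le {γ γ' γ'' : ℝ → ℂ} {M : ℝ} (h1 : ∀ t, HasDerivAt γ (γ' t) t)
    (h2 : ∀ t, HasDerivAt γ' (γ'' t) t) (hM : ∀ t, ‖γ'' t‖ ≤ M) {h : ℝ} (hh : 0 < h) :
    ‖γ h - γ 0 - h • γ' 0‖ ≤ h ^ 2 * M := by
  have hM0 : 0 ≤ M := (norm_nonneg _).trans (hM 0)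
  have h3 : ∀ t ∈ Set.Icc (0 : ℝ) h, ‖γ' t - γ' 0‖ ≤ M * (t - 0) :=
    norm_image_sub_le_of_norm_deriv_le_segment' (fun t _ => (h2 t).hasDerivWithinAt)
      fun t _ => hM t
  have h4 := norm_image_sub_le_of_norm_deriv_le_segment' (f := fun t => γ t - t • γ' 0)
    (f' := fun t => γ' t - (1 : ℝ) • γ' 0) (a := 0) (b := h) (C := M * h)
    (fun t _ => ((h1 t).fun_sub ((hasDerivAt_id' t).smul_const (γ' 0))).hasDerivWithinAt)
    (fun t ht => by
      rw [one_smul]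
      refine (h3 t (Set.Ico_subset_Icc_self ht)).trans ?_
      rw [sub_zero]
      exact mul_le_mul_of_nonneg_left ht.2.le hM0) h (Set.right_mem_Icc.2 hh.le)
  simp only [zero_smul, sub_zero] at h4
  calc ‖γ h - γ 0 - h • γ' 0‖ = ‖γ h - h • γ' 0 - γ 0‖ := by congr 1; abel
    _ ≤ M * h * h := h4
    _ = _ := by ring

/-- A pointwise remainder h²b(p) with b in L² gives an L² remainder O(h) for the slope. The
exceptional null set may depend on h. -/
theorem tendsto_slope_of_sq_bound {α : Type*} [MeasurableSpace α] {μ : Measure α}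
    {u : ℝ → Lp ℂ 2 μ} {f a : Lp ℂ 2 μ} {b : α → ℝ} (hb : MemLp b 2 μ)
    (H : ∀ h : ℝ, 0 < h → ∀ᵐ p ∂μ, ‖u h p - f p - h • a p‖ ≤ h ^ 2 * b p) :
    Tendsto (fun h : ℝ => h⁻¹ • (u h - f)) (𝓝[>] 0) (𝓝 a) := by
  have key : ∀ h : ℝ, 0 < h → ‖h⁻¹ • (u h - f) - a‖ ≤ h * ‖hb.toLp b‖ := by
    intro h hh
    have h1 : ‖u h - f - h • a‖ ≤ h ^ 2 * ‖hb.toLp b‖ := by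
      refine Lp.norm_le_mul_norm_of_ae_le_mul ?_
      filter_upwards [H h hh, hb.coeFn_toLp, Lp.coeFn_sub (u h) f, Lp.coeFn_smul h a,
        Lp.coeFn_sub (u h - f) (h • a)] with p h1 h2 h3 h4 h5
      rw [h5, Pi.sub_apply, h3, h4, Pi.sub_apply, Pi.smul_apply, h2]
      exact h1.trans (mul_le_mul_of_nonneg_left (le_abs_self _) (sq_nonneg h))
    have h2 : h⁻¹ • (u h - f) - a = h⁻¹ • (u h - f - h • a) := by
      rw [smul_sub _ (u h - f), inv_smul_smul₀ hh.ne']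
    rw [h2, norm_smul, Real.norm_eq_abs, abs_of_pos (inv_pos.2 hh), inv_mul_le_iff₀ hh]
    calc _ ≤ h ^ 2 * ‖hb.toLp b‖ := h1
      _ = _ := by ring
  rw [tendsto_iff_norm_sub_tendsto_zero]
  refine squeeze_zero' (Eventually.of_forall fun h => norm_nonneg _)
    (eventually_nhdsWithin_of_forall key) ?_
  have : Tendsto (fun h : ℝ => h * ‖hb.toLp b‖) (𝓝 0) (𝓝 (0 * ‖hb.toLp b‖)) :=
    (continuous_id.mul continuous_const).tendsto 0
  rw [zero_mul] at this
  exact this.mono_left nhdsWithin_le_nhds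

/-- The second derivative in h of e^{−irh}g has modulus r²|g|, independent of h and square
integrable since r has temperate growth. -/
theorem tendsto_slope_unimodularMul {E : Type*} [NormedAddCommGroup E] [NormedSpace ℝ E]
    [MeasurableSpace E] [BorelSpace E] [SecondCountableTopology E] (μ : Measure E)
    [μ.HasTemperateGrowth] {m : ℝ → E → ℂ} (hm : ∀ h, Measurable (m h))
    (h1 : ∀ h x, ‖m h x‖ = 1) {r : E → ℝ} (hr : r.HasTemperateGrowth)
    (hmr : ∀ h x, m h x = Complex.exp (-Complex.I * r x * h)) (g : 𝓢(E, ℂ)) :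
    Tendsto (fun h : ℝ => h⁻¹ • (unimodularMul μ (m h) (hm h) (h1 h) (g.toLp 2 μ) - g.toLp 2 μ))
      (𝓝[>] 0) (𝓝 ((SchwartzMap.smulLeftCLM ℂ (fun x => -Complex.I * r x) g).toLp 2 μ)) := by
  have hrc : Function.HasTemperateGrowth fun x => -Complex.I * (r x : ℂ) :=
    (Function.HasTemperateGrowth.const _).mul (Function.Complex.hasTemperateGrowth_ofReal.comp hr)
  set b := SchwartzMap.smulLeftCLM ℂ (fun x => (-Complex.I * (r x : ℂ)) ^ 2) g with hbdef
  have hb : ∀ x, b x = (-Complex.I * (r x : ℂ)) ^ 2 * g x := fun x =>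
    SchwartzMap.smulLeftCLM_apply_apply (hrc.pow 2) g x
  refine tendsto_slope_of_sq_bound (b.memLp 2 μ).norm fun h hh => ?_
  filter_upwards [coeFn_unimodularMul μ (m h) (hm h) (h1 h) (g.toLp 2 μ), g.coeFn_toLp 2 μ,
    (SchwartzMap.smulLeftCLM ℂ (fun x => -Complex.I * r x) g).coeFn_toLp 2 μ] with x e1 e2 e3
  rw [e1, e2, e3, SchwartzMap.smulLeftCLM_apply_apply hrc]
  set k : ℂ := -Complex.I * r x with hk
  have d0 : ∀ t : ℝ, HasDerivAt (fun t : ℝ => Complex.exp (k * t)) (Complex.exp (k * t) * k) t :=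
    fun t => by
      have : HasDerivAt (fun t : ℝ => k * (t : ℂ)) (k * 1) t :=
        Complex.ofRealCLM.hasDerivAt.const_mul k
      simpa using this.cexp
  have hn : ∀ t : ℝ, ‖Complex.exp (k * t)‖ = 1 := fun t => by rw [hk, ← hmr, h1]
  have hb' : b x = k ^ 2 * g x := hb x
  rw [hmr, ← hk]
  clear_value k
  have := norm_taylor_two_le (γ := fun t : ℝ => Complex.exp (k * t) * g x)
    (γ' := fun t : ℝ => Complex.exp (k * t) * k * g x)
    (γ'' := fun t : ℝ => Complex.exp (k * t) * k * k * g x) (M := ‖b x‖)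
    (fun t => (d0 t).mul_const _) (fun t => ((d0 t).mul_const k).mul_const _)
    (fun t => le_of_eq (by
      rw [hb', norm_mul, norm_mul, norm_mul, hn, norm_mul, norm_pow, one_mul, sq])) hh
  simp only [Complex.ofReal_zero, mul_zero, Complex.exp_zero, one_mul] at this
  exact this

theorem tendsto_of_tendsto_slope {B : Type*} [NormedAddCommGroup B] [NormedSpace ℝ B]
    {u : ℝ → B} {f a : B} (h : Tendsto (fun h : ℝ => h⁻¹ • (u h - f)) (𝓝[>] 0) (𝓝 a)) :
    Tendsto u (𝓝[>] 0) (𝓝 f) := by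
  have h1 : Tendsto (fun h : ℝ => h) (𝓝[>] 0) (𝓝 0) := tendsto_id.mono_left nhdsWithin_le_nhds
  have h2 := (h1.smul h).add_const f
  rw [zero_smul, zero_add] at h2
  refine h2.congr' ?_
  filter_upwards [self_mem_nhdsWithin] with t ht
  rw [smul_inv_smul₀ (ne_of_gt ht), sub_add_cancel]

/-- Uniform boundedness lets the operator and its argument vary together, which the Leibniz rule of
`tendsto_slope_product` needs. -/
theorem tendsto_contraction_apply {B : Type*} [NormedAddCommGroup B] [NormedSpace ℂ B]
    {A : ℝ → B →L[ℂ] B} {l : Filter ℝ} (hA : ∀ h, ‖A h‖ ≤ 1) {u : ℝ → B} {a b : B}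
    (hu : Tendsto u l (𝓝 a)) (hAa : Tendsto (fun h => A h a) l (𝓝 b)) :
    Tendsto (fun h => A h (u h)) l (𝓝 b) := by
  have h1 : Tendsto (fun h => A h (u h - a)) l (𝓝 0) := by
    refine squeeze_zero_norm (fun h => (A h).le_of_opNorm_le (hA h) _) ?_
    simpa using (tendsto_iff_norm_sub_tendsto_zero.1 hu)
  have h2 := h1.add hAa
  rw [zero_add] at h2
  refine h2.congr fun h => ?_
  rw [map_sub, sub_add_cancel]

namespace Heis

variable {d : ℕ}

theorem memLp_one_add_norm (C : ℝ) :
    MemLp (fun p : Heis d => C * (1 + ‖p‖) ^ (-((Module.finrank ℝ (Heis d) + 1 : ℕ) : ℝ))) 2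
      volume := by
  refine MemLp.const_mul ?_ C
  have hc : Continuous fun p : Heis d =>
      (1 + ‖p‖) ^ (-((Module.finrank ℝ (Heis d) + 1 : ℕ) : ℝ)) := by
    refine (continuous_const.add continuous_norm).rpow_const fun p => Or.inl ?_
    have : (0 : ℝ) < 1 + ‖p‖ := by positivity
    exact this.ne'
  refine (memLp_two_iff_integrable_sq hc.aestronglyMeasurable).2 ?_
  have h1 : Integrable (fun p : Heis d =>
      (1 + ‖p‖) ^ (-((Module.finrank ℝ (Heis d) + 1 : ℕ) : ℝ))) :=
    integrable_one_add_norm (by push_cast; linarith)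
  refine h1.mono' (hc.pow 2).aestronglyMeasurable (Eventually.of_forall fun p => ?_)
  have h0 : (0 : ℝ) < 1 + ‖p‖ := by positivity
  have h2 : 0 ≤ (1 + ‖p‖) ^ (-((Module.finrank ℝ (Heis d) + 1 : ℕ) : ℝ)) := by positivity
  have h3 : (1 + ‖p‖) ^ (-((Module.finrank ℝ (Heis d) + 1 : ℕ) : ℝ)) ≤ 1 :=
    Real.rpow_le_one_of_one_le_of_nonpos (by linarith [norm_nonneg p])
      (by rw [Left.neg_nonpos_iff]; positivity)
  rw [Real.norm_eq_abs, abs_of_nonneg (by positivity), sq]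
  exact mul_le_of_le_one_left h2 h3

/-- The infinitesimal generator `-α z̃·∇_z` of the shears, on Schwartz functions. -/
def shearGenerator (χ : 𝓢(Heis d, ℂ)) (p : Heis d) : ℂ :=
  -(fderiv ℝ χ p (p.2 • tilde p.1, 0))

/-- Taylor's formula along the line p − tv with v = (αz̃, 0). Because ‖p − tv‖ ≥ ‖p‖, the decay of
the second derivative holds uniformly in t; the extra 4 in the exponent pays for two factors ‖v‖ ≤
‖p‖². -/
theorem exists_shear_taylor_bound (χ : 𝓢(Heis d, ℂ)) : ∃ C : ℝ, ∀ (h : ℝ), 0 < h →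
    ∀ p : Heis d, ‖χ (shearMap h p) - χ p - h • shearGenerator χ p‖ ≤
      h ^ 2 * (C * (1 + ‖p‖) ^ (-((Module.finrank ℝ (Heis d) + 1 : ℕ) : ℝ))) := by
  set Φ := SchwartzMap.fderivCLM ℝ (Heis d) (Heis d →L[ℝ] ℂ)
    (SchwartzMap.fderivCLM ℝ (Heis d) ℂ χ) with hΦ
  set n := Module.finrank ℝ (Heis d) + 1
  have hC := fun q => SchwartzMap.one_add_le_sup_seminorm_apply (𝕜 := ℝ) (m := (n + 4, 0))
    (k := n + 4) (n := 0) le_rfl le_rfl Φ q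
  simp only [norm_iteratedFDeriv_zero] at hC
  set C := 2 ^ (n + 4) *
    ((Finset.Iic (n + 4, 0)).sup fun m => SchwartzMap.seminorm ℝ m.1 m.2) Φ
  refine ⟨C, fun h hh p => ?_⟩
  set v : Heis d := (p.2 • tilde p.1, 0) with hv
  have hcurve : ∀ t : ℝ, shearMap t p = p - t • v := fun t => by
    ext <;> simp [shearMap, hv, mul_smul]
  have hvn : ‖v‖ ≤ ‖p‖ ^ 2 := by
    refine max_le ?_ (by rw [hv, norm_zero]; positivity)
    rw [norm_smul, norm_tilde, sq]
    exact mul_le_mul (le_max_right _ _) (le_max_left _ _) (norm_nonneg _) (norm_nonneg _)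
  have hline : ∀ t : ℝ, HasDerivAt (fun t : ℝ => p - t • v) (-v) t := fun t => by
    have := ((hasDerivAt_id' t).smul_const v).const_sub p
    rwa [one_smul] at this
  have d1 : ∀ t : ℝ, HasDerivAt (fun t : ℝ => χ (p - t • v)) (-(fderiv ℝ χ (p - t • v) v)) t :=
    fun t => by
      have := (χ.hasFDerivAt (p - t • v)).comp_hasDerivAt t (hline t)
      rwa [map_neg] at this
  have d2 : ∀ t : ℝ, HasDerivAt (fun t : ℝ => -(fderiv ℝ χ (p - t • v) v))
      (Φ (p - t • v) v v) t := fun t => by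
    have h1 := ((SchwartzMap.fderivCLM ℝ (Heis d) ℂ χ).hasFDerivAt (p - t • v)).comp_hasDerivAt t
      (hline t)
    have h2 := (h1.clm_apply (hasDerivAt_const t v)).fun_neg
    refine h2.congr_deriv ?_
    simp [hΦ, SchwartzMap.fderivCLM_apply]
  have hpos : (0 : ℝ) < 1 + ‖p‖ := by positivity
  have hbound : ∀ t : ℝ, ‖Φ (p - t • v) v v‖ ≤ C * (1 + ‖p‖) ^ (-(n : ℝ)) := fun t => by
    rw [Real.rpow_neg hpos.le, Real.rpow_natCast, ← div_eq_mul_inv, le_div_iff₀ (by positivity)]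
    have h1 : ‖p‖ ≤ ‖p - t • v‖ := by rw [← hcurve]; exact norm_le_norm_shearMap t p
    have h2 : ‖v‖ ≤ (1 + ‖p‖) ^ 2 := hvn.trans (by gcongr; linarith)
    calc ‖Φ (p - t • v) v v‖ * (1 + ‖p‖) ^ n
        ≤ ‖Φ (p - t • v)‖ * ‖v‖ * ‖v‖ * (1 + ‖p‖) ^ n := by
          gcongr
          exact (Φ (p - t • v)).le_opNorm₂ v v
      _ ≤ ‖Φ (p - t • v)‖ * (1 + ‖p‖) ^ 2 * (1 + ‖p‖) ^ 2 * (1 + ‖p‖) ^ n := by gcongr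
      _ = (1 + ‖p‖) ^ (n + 4) * ‖Φ (p - t • v)‖ := by ring
      _ ≤ (1 + ‖p - t • v‖) ^ (n + 4) * ‖Φ (p - t • v)‖ := by gcongr
      _ ≤ C := hC _
  have := norm_taylor_two_le d1 d2 hbound hh
  simpa only [zero_smul, sub_zero, ← hcurve, shearGenerator] using this

theorem tendsto_slope_shear (χ a : 𝓢(Heis d, ℂ)) (ha : ∀ p, a p = shearGenerator χ p) :
    Tendsto (fun h : ℝ => h⁻¹ • (shear h (χ.toLp 2 volume) - χ.toLp 2 volume)) (𝓝[>] 0)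
      (𝓝 (a.toLp 2 volume)) := by
  obtain ⟨C, hC⟩ := exists_shear_taylor_bound χ
  refine tendsto_slope_of_sq_bound (memLp_one_add_norm C) fun h hh => ?_
  rw [shear_toLp]
  filter_upwards [(shearS h χ).coeFn_toLp 2 volume, χ.coeFn_toLp 2 volume,
    a.coeFn_toLp 2 volume] with p h1 h2 h3
  rw [h1, h2, h3, shearS_apply, ha]
  exact hC h hh p

theorem hasTemperateGrowth_half_norm_sq_fst :
    Function.HasTemperateGrowth fun p : Heis d => ‖p.1‖ ^ 2 / 2 := by
  have h1 : Function.HasTemperateGrowth fun p : Heis d => ‖p.1‖ ^ 2 :=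
    (Function.hasTemperateGrowth_norm_sq (Plane d)).comp
      (ContinuousLinearMap.fst ℝ (Plane d) ℝ).hasTemperateGrowth
  simp only [div_eq_mul_inv]
  exact h1.mul (Function.HasTemperateGrowth.const _)

theorem hasTemperateGrowth_half_norm_sq_smul_tilde :
    Function.HasTemperateGrowth fun p : Heis d => ‖p.2 • tilde p.1‖ ^ 2 / 2 := by
  have h0 : Function.HasTemperateGrowth fun p : Heis d => p.2 • tildeL d p.1 :=
    (ContinuousLinearMap.snd ℝ (Plane d) ℝ).hasTemperateGrowth.smul
      ((tildeL d).comp (ContinuousLinearMap.fst ℝ (Plane d) ℝ)).hasTemperateGrowth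
  have h1 : Function.HasTemperateGrowth fun p : Heis d => ‖p.2 • tilde p.1‖ ^ 2 :=
    (Function.hasTemperateGrowth_norm_sq (Plane d)).comp h0
  simp only [div_eq_mul_inv]
  exact h1.mul (Function.HasTemperateGrowth.const _)

theorem tendsto_slope_phaseMul (χ : 𝓢(Heis d, ℂ)) :
    Tendsto (fun h : ℝ => h⁻¹ • (phaseMul h (χ.toLp 2 volume) - χ.toLp 2 volume)) (𝓝[>] 0)
      (𝓝 ((SchwartzMap.smulLeftCLM ℂ
        (fun p : Heis d => -Complex.I * ((‖p.2 • tilde p.1‖ ^ 2 / 2 : ℝ) : ℂ)) χ).toLp 2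
          volume)) :=
  tendsto_slope_unimodularMul volume measurable_phaseSymbol norm_phaseSymbol
    hasTemperateGrowth_half_norm_sq_smul_tilde
    (fun h p => by rw [phaseSymbol]; congr 1; push_cast; ring) χ

theorem tendsto_slope_freeEvolution (χ : 𝓢(Heis d, ℂ)) :
    Tendsto (fun h : ℝ => h⁻¹ • (freeEvolution h (χ.toLp 2 volume) - χ.toLp 2 volume)) (𝓝[>] 0)
      (𝓝 (((horizontalFourierS d).symm (SchwartzMap.smulLeftCLM ℂ
        (fun p : Heis d => -Complex.I * ((‖p.1‖ ^ 2 / 2 : ℝ) : ℂ))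
          (horizontalFourierS d χ))).toLp 2 volume)) := by
  have h1 := tendsto_slope_unimodularMul volume measurable_freeSymbol norm_freeSymbol
    hasTemperateGrowth_half_norm_sq_fst
    (fun h (p : Heis d) => by rw [freeSymbol]; congr 1; push_cast; ring) (horizontalFourierS d χ)
  have h2 := ((horizontalFourierL2 d).symm.continuous.tendsto _).comp h1
  rw [horizontalFourierL2_symm_toLp] at h2
  refine h2.congr fun h => ?_
  have h3 : ∀ (r : ℝ) (x : HeisL2 d), (horizontalFourierL2 d).symm (r • x) =
      r • (horizontalFourierL2 d).symm x := fun r x =>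
    map_real_smul (horizontalFourierL2 d).symm (LinearIsometryEquiv.continuous _) r x
  rw [Function.comp_apply, h3, map_sub, ← horizontalFourierL2_toLp,
    LinearIsometryEquiv.symm_apply_apply]
  rfl

theorem norm_phaseMul_le (h : ℝ) :
    ‖(phaseMul (d := d) h).toContinuousLinearEquiv.toContinuousLinearMap‖ ≤ 1 :=
  ContinuousLinearMap.opNorm_le_bound _ zero_le_one fun x => by
    rw [one_mul]
    exact ((phaseMul h).norm_map x).le

/-- Telescoping: U₂VU₁ − 1 = U₂V(U₁ − 1) + U₂(V − 1) + (U₂ − 1), each outer factor being a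
contraction that tends strongly to the identity on Schwartz functions. -/
theorem tendsto_slope_product (χ a₁ a₂ a₃ : 𝓢(Heis d, ℂ))
    (h₁ : Tendsto (fun h : ℝ => h⁻¹ • (freeEvolution h (χ.toLp 2 volume) - χ.toLp 2 volume))
      (𝓝[>] 0) (𝓝 (a₁.toLp 2 volume)))
    (hshear : ∀ χ : 𝓢(Heis d, ℂ), Tendsto (fun h : ℝ => shear h (χ.toLp 2 volume)) (𝓝[>] 0)
      (𝓝 (χ.toLp 2 volume)))
    (h₂ : Tendsto (fun h : ℝ => h⁻¹ • (shear h (χ.toLp 2 volume) - χ.toLp 2 volume))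
      (𝓝[>] 0) (𝓝 (a₂.toLp 2 volume)))
    (h₃ : Tendsto (fun h : ℝ => h⁻¹ • (phaseMul h (χ.toLp 2 volume) - χ.toLp 2 volume))
      (𝓝[>] 0) (𝓝 (a₃.toLp 2 volume))) :
    Tendsto (fun h : ℝ => h⁻¹ • (phaseMul h (shear h (freeEvolution h (χ.toLp 2 volume))) -
      χ.toLp 2 volume)) (𝓝[>] 0) (𝓝 ((a₁ + a₂ + a₃).toLp 2 volume)) := by
  have hphase : ∀ χ : 𝓢(Heis d, ℂ), Tendsto (fun h : ℝ =>
      (phaseMul (d := d) h).toContinuousLinearEquiv.toContinuousLinearMap (χ.toLp 2 volume))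
      (𝓝[>] 0) (𝓝 (χ.toLp 2 volume)) := fun χ =>
    tendsto_of_tendsto_slope (tendsto_slope_phaseMul χ)
  have t1 := tendsto_contraction_apply norm_phaseMul_le
    (tendsto_contraction_apply norm_shear_le h₁ (hshear a₁)) (hphase a₁)
  have t2 := tendsto_contraction_apply norm_phaseMul_le h₂ (hphase a₂)
  have hadd : (a₁ + a₂ + a₃).toLp 2 volume =
      a₁.toLp 2 volume + a₂.toLp 2 volume + a₃.toLp 2 volume := by
    have := (SchwartzMap.toLpCLM ℂ ℂ 2 (volume : Measure (Heis d))).map_add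
    simp only [SchwartzMap.toLpCLM_apply] at this
    rw [this, this]
  rw [hadd]
  refine ((t1.add t2).add h₃).congr fun h => ?_
  have e1 : ∀ (r : ℝ) (x : HeisL2 d), phaseMul h (r • x) = r • phaseMul h x := fun r x =>
    map_real_smul (phaseMul h) (LinearIsometryEquiv.continuous _) r x
  have e2 : ∀ (r : ℝ) (x : HeisL2 d), shear h (r • x) = r • shear h x := fun r x =>
    map_real_smul (shear h) (shear h).continuous r x
  change phaseMul h (shear h (h⁻¹ • _)) + phaseMul h (h⁻¹ • _) + _ = _
  rw [e2, e1, e1, ← smul_add, ← smul_add, map_sub, map_sub, map_sub]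
  congr 1
  abel

end Heis

/-! ### Intertwining with the Fourier transforms, and identification of the derivative with (i/2)L.
-/

namespace Splitting

open FourierTransform LineDeriv

variable {E Y : Type} [NormedAddCommGroup E] [NormedSpace ℝ E]
    [NormedAddCommGroup Y] [InnerProductSpace ℝ Y] (σ : Splitting E Y)
    [FiniteDimensional ℝ Y] [MeasurableSpace Y] [BorelSpace Y]

theorem fourierFun_evalCLM {G : Type} [NormedAddCommGroup G] [NormedSpace ℝ G] (c : ℝ)
    (φ : 𝓢(E, G →L[ℝ] ℂ)) (v : G) (p : E) :
    σ.fourierFun c (SchwartzMap.evalCLM ℂ E ℂ v φ) p = σ.fourierFun c φ p v := by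
  have h : σ.slice p (SchwartzMap.evalCLM ℂ E ℂ v φ) =
      SchwartzMap.evalCLM ℂ Y ℂ v (σ.slice p φ) := rfl
  rw [fourierFun, h, SchwartzMap.fourier_evalCLM_eq]
  rfl

theorem fourier_lineDerivOp_fiber {c : ℝ} (hc : c ≠ 0) (ψ : 𝓢(E, ℂ)) (v : Y) (p : E) :
    σ.fourier hc (∂_{σ.J v} ψ) p =
      2 * Real.pi * Complex.I * (c * inner ℝ (σ.P p) v : ℝ) * σ.fourier hc ψ p := by
  have h1 : ∂_{σ.J v} ψ = SchwartzMap.evalCLM ℂ E ℂ v (σ.fiberDeriv ψ) := rfl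
  have h2 : σ.fourier hc (SchwartzMap.evalCLM ℂ E ℂ v (σ.fiberDeriv ψ)) p = _ :=
    σ.fourierFun_evalCLM c (σ.fiberDeriv ψ) v p
  rw [h1, h2, fourierFun_fiberDeriv]
  change (2 * Real.pi * Complex.I : ℂ) • ((inner ℝ (c • σ.P p) v : ℝ) • σ.fourier hc ψ p) = _
  rw [real_inner_smul_left, Complex.real_smul, smul_eq_mul]
  ring

/-- Directions in the range of N are killed by P, so the phase term of `derivSymbol` vanishes on
them. -/
theorem fourier_lineDerivOp_base {c : ℝ} (hc : c ≠ 0) (ψ : 𝓢(E, ℂ)) (v : E) :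
    σ.fourier hc (∂_{σ.N v} ψ) = ∂_{σ.N v} (σ.fourier hc ψ) := by
  ext p
  have h1 : ∂_{σ.N v} ψ = SchwartzMap.evalCLM ℂ E ℂ (σ.N v) (σ.derivSymbol c ψ) := by
    ext q
    rw [SchwartzMap.evalCLM_apply_apply, derivSymbol_apply, SchwartzMap.lineDerivOp_apply_eq_fderiv]
    simp [N_N, P_N]
  have h2 : σ.fourier hc (SchwartzMap.evalCLM ℂ E ℂ (σ.N v) (σ.derivSymbol c ψ)) p = _ :=
    σ.fourierFun_evalCLM c (σ.derivSymbol c ψ) (σ.N v) p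
  rw [h1, h2, SchwartzMap.lineDerivOp_apply_eq_fderiv]
  exact (congrArg (fun A : E →L[ℝ] ℂ => A (σ.N v)) (σ.hasFDerivAt_fourierFun c ψ p).fderiv).symm

theorem fourier_smulLeftCLM {c : ℝ} (hc : c ≠ 0) {m : E → ℂ} (hm : m.HasTemperateGrowth)
    (hmN : ∀ q q', σ.N q = σ.N q' → m q = m q') (ψ : 𝓢(E, ℂ)) :
    σ.fourier hc (SchwartzMap.smulLeftCLM ℂ m ψ) =
      SchwartzMap.smulLeftCLM ℂ m (σ.fourier hc ψ) := by
  ext p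
  have h1 : ∀ ψ : 𝓢(E, ℂ), σ.fourier hc ψ p = _ := fun ψ => σ.fourierFun_eq c ψ p
  rw [SchwartzMap.smulLeftCLM_apply_apply hm, h1, h1, smul_eq_mul, ← integral_const_mul]
  refine integral_congr_ae (Eventually.of_forall fun y => ?_)
  simp only [SchwartzMap.smulLeftCLM_apply_apply hm, smul_eq_mul,
    hmN (σ.N p + σ.J y) p (σ.N_slice p y)]
  ring

end Splitting

namespace Heis

open FourierTransform LineDeriv

variable {d : ℕ}

/-- The coefficient `z̃_j` of `∂_s` in the left-invariant fields. -/
def tildeCoord (j : Fin d ⊕ Fin d) (p : Heis d) : ℂ := ((tilde p.1 j : ℝ) : ℂ)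

theorem hasTemperateGrowth_tildeCoord (j : Fin d ⊕ Fin d) : (tildeCoord j).HasTemperateGrowth :=
  Function.Complex.hasTemperateGrowth_ofReal.comp
    ((EuclideanSpace.proj j : Plane d →L[ℝ] ℝ) ∘L tildeL d ∘L
      ContinuousLinearMap.fst ℝ (Plane d) ℝ).hasTemperateGrowth

/-- The coefficient `i α z̃_j` of the conjugated fields. -/
def twistCoord (j : Fin d ⊕ Fin d) (p : Heis d) : ℂ := Complex.I * p.2 * tildeCoord j p

theorem hasTemperateGrowth_twistCoord (j : Fin d ⊕ Fin d) :
    (twistCoord j).HasTemperateGrowth :=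
  ((Function.HasTemperateGrowth.const Complex.I).mul
    (Function.Complex.hasTemperateGrowth_ofReal.comp
      (ContinuousLinearMap.snd ℝ (Plane d) ℝ).hasTemperateGrowth)).mul
    (hasTemperateGrowth_tildeCoord j)

/-- The left-invariant field along `e_j` on Schwartz functions. -/
def fieldS (j : Fin d ⊕ Fin d) (ψ : 𝓢(Heis d, ℂ)) : 𝓢(Heis d, ℂ) :=
  ∂_{((basisVec j, 0) : Heis d)} ψ +
    SchwartzMap.smulLeftCLM ℂ (tildeCoord j) (∂_{((0, 1) : Heis d)} ψ)

theorem fieldS_apply (j : Fin d ⊕ Fin d) (ψ : 𝓢(Heis d, ℂ)) (p : Heis d) :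
    fieldS j ψ p = field (basisVec j) ψ p := by
  have h : ((basisVec j, symp p.1 (basisVec j)) : Heis d) =
      (basisVec j, 0) + (tilde p.1 j) • ((0, 1) : Heis d) := by
    ext <;> simp [symp_basisVec]
  rw [field, h, map_add, map_smul, fieldS, add_apply,
    SchwartzMap.smulLeftCLM_apply_apply (hasTemperateGrowth_tildeCoord j),
    SchwartzMap.lineDerivOp_apply_eq_fderiv, SchwartzMap.lineDerivOp_apply_eq_fderiv,
    Complex.real_smul]
  rfl

/-- The sub-Laplacian on Schwartz functions. -/
def subLaplacianS (ψ : 𝓢(Heis d, ℂ)) : 𝓢(Heis d, ℂ) := ∑ j, fieldS j (fieldS j ψ)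

theorem subLaplacianS_apply (ψ : 𝓢(Heis d, ℂ)) (p : Heis d) :
    subLaplacianS ψ p = subLaplacianFun ψ p := by
  rw [subLaplacianFun_eq, subLaplacianS, sum_apply]
  refine Finset.sum_congr rfl fun j _ => ?_
  rw [fieldS_apply, funext (fieldS_apply j ψ)]

/-- The field along `e_j` conjugated with the central Fourier transform. -/
def twistedFieldS (j : Fin d ⊕ Fin d) (χ : 𝓢(Heis d, ℂ)) : 𝓢(Heis d, ℂ) :=
  ∂_{((basisVec j, 0) : Heis d)} χ + SchwartzMap.smulLeftCLM ℂ (twistCoord j) χ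

theorem centralFourierS_fieldS (j : Fin d ⊕ Fin d) (ψ : 𝓢(Heis d, ℂ)) :
    centralFourierS d (fieldS j ψ) = twistedFieldS j (centralFourierS d ψ) := by
  have hN : ((basisVec j, 0) : Heis d) = (centralSplitting d).N (basisVec j, 0) := by
    rw [Splitting.N_apply]
    simp [centralSplitting]
  have hJ : ((0, 1) : Heis d) = (centralSplitting d).J 1 := rfl
  have h1 : ∀ (f : 𝓢(Heis d, ℂ)) (p : Heis d), centralFourierS d f p =
      (centralSplitting d).fourierConst (2 * Real.pi)⁻¹ *
        (centralSplitting d).fourier inv_two_pi_ne_zero f p := fun _ _ => rfl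
  have h0 : centralFourierS d ψ = (centralSplitting d).fourierConst (2 * Real.pi)⁻¹ •
        (centralSplitting d).fourier inv_two_pi_ne_zero ψ := rfl
  ext p
  rw [fieldS, map_add, twistedFieldS, add_apply, add_apply]
  congr 1
  · rw [h1, hN, Splitting.fourier_lineDerivOp_base, h0, lineDerivOp_smul]
    rfl
  · rw [h1, Splitting.fourier_smulLeftCLM _ _ (hasTemperateGrowth_tildeCoord j),
      SchwartzMap.smulLeftCLM_apply_apply (hasTemperateGrowth_tildeCoord j),
      SchwartzMap.smulLeftCLM_apply_apply (hasTemperateGrowth_twistCoord j), hJ,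
      Splitting.fourier_lineDerivOp_fiber, h1, twistCoord]
    · have h2 : (inner ℝ ((centralSplitting d).P p) (1 : ℝ) : ℝ) = p.2 := by
        simp [centralSplitting]
      have hpi : (Real.pi : ℂ) ≠ 0 := by simp [Real.pi_ne_zero]
      rw [h2, smul_eq_mul, smul_eq_mul]
      push_cast
      field_simp
    · intro q q' hq
      have : q.1 = q'.1 := by
        have := congrArg Prod.fst hq
        simpa [Splitting.N_apply, centralSplitting] using this
      rw [tildeCoord, tildeCoord, this]

theorem centralFourierS_subLaplacianS (ψ : 𝓢(Heis d, ℂ)) :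
    centralFourierS d (subLaplacianS ψ) =
      ∑ j, twistedFieldS j (twistedFieldS j (centralFourierS d ψ)) := by
  simp only [subLaplacianS, map_sum, centralFourierS_fieldS]

/-- The coefficient z̃_j is constant along e_j because e_j ·_σ e_j = 0. This is what removes the
commutator from the square of a twisted field. -/
theorem lineDerivOp_smulLeftCLM_twistCoord (j : Fin d ⊕ Fin d) (χ : 𝓢(Heis d, ℂ)) :
    ∂_{((basisVec j, 0) : Heis d)} (SchwartzMap.smulLeftCLM ℂ (twistCoord j) χ) =
      SchwartzMap.smulLeftCLM ℂ (twistCoord j) (∂_{((basisVec j, 0) : Heis d)} χ) := by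
  have hz : ∀ z : Plane d, ∀ t : ℝ, tilde (z + t • basisVec j) j = tilde z j := fun z t => by
    rw [tilde_add, tilde_smul, PiLp.add_apply, PiLp.smul_apply, ← symp_basisVec (basisVec j) j,
      symp_self, smul_zero, add_zero]
  ext p
  rw [SchwartzMap.smulLeftCLM_apply_apply (hasTemperateGrowth_twistCoord j),
    SchwartzMap.lineDerivOp_apply, SchwartzMap.lineDerivOp_apply, lineDeriv, lineDeriv,
    smul_eq_mul]
  have h : ∀ t : ℝ, SchwartzMap.smulLeftCLM ℂ (twistCoord j) χ (p + t • (basisVec j, 0)) =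
      twistCoord j p * χ (p + t • (basisVec j, 0)) := fun t => by
    rw [SchwartzMap.smulLeftCLM_apply_apply (hasTemperateGrowth_twistCoord j), smul_eq_mul]
    simp [twistCoord, tildeCoord, hz]
  simp only [h]
  exact deriv_const_mul_field _

theorem fderiv_horizontal_eq_sum (χ : 𝓢(Heis d, ℂ)) (p : Heis d) (w : Plane d) :
    fderiv ℝ χ p (w, 0) = ∑ j, (w j : ℂ) * (∂_{((basisVec j, 0) : Heis d)} χ) p := by
  have h : ((w, 0) : Heis d) = ∑ j, w j • ((basisVec j, 0) : Heis d) := by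
    have h1 : w = ∑ j, w j • basisVec j := by
      ext i
      simp [basisVec, Finset.sum_apply, Pi.single_apply]
      rcases i with i | i <;> simp
    have h2 : ((w, 0) : Heis d) = ContinuousLinearMap.inl ℝ (Plane d) ℝ w := rfl
    rw [h2]
    conv_lhs => rw [h1]
    rw [map_sum]
    refine Finset.sum_congr rfl fun j _ => ?_
    rw [map_smul]
    rfl
  rw [h, map_sum]
  refine Finset.sum_congr rfl fun j _ => ?_
  rw [map_smul, Complex.real_smul]
  rfl

/-- The horizontal Laplacian `Δ_z` on Schwartz functions. -/
def planeLaplacianS (χ : 𝓢(Heis d, ℂ)) : 𝓢(Heis d, ℂ) :=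
  ∑ j, ∂_{((basisVec j, 0) : Heis d)} (∂_{((basisVec j, 0) : Heis d)} χ)

/-- The generator of the shears on Schwartz functions. -/
def shearGeneratorS (χ : 𝓢(Heis d, ℂ)) : 𝓢(Heis d, ℂ) :=
  Complex.I • ∑ j, SchwartzMap.smulLeftCLM ℂ (twistCoord j) (∂_{((basisVec j, 0) : Heis d)} χ)

theorem shearGeneratorS_apply (χ : 𝓢(Heis d, ℂ)) (p : Heis d) :
    shearGeneratorS χ p = shearGenerator χ p := by
  rw [shearGenerator, fderiv_horizontal_eq_sum, shearGeneratorS, smul_apply,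
    sum_apply, smul_eq_mul, Finset.mul_sum, ← Finset.sum_neg_distrib]
  refine Finset.sum_congr rfl fun j _ => ?_
  rw [SchwartzMap.smulLeftCLM_apply_apply (hasTemperateGrowth_twistCoord j), PiLp.smul_apply,
    twistCoord, tildeCoord, smul_eq_mul, smul_eq_mul]
  push_cast
  linear_combination (p.2 * (tilde p.1 j : ℂ) * (∂_{((basisVec j, 0) : Heis d)} χ) p) *
    Complex.I_sq

theorem sum_twistCoord_sq (p : Heis d) :
    ∑ j, twistCoord j p ^ 2 = -((‖p.2 • tilde p.1‖ ^ 2 : ℝ) : ℂ) := by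
  rw [norm_smul, mul_pow, EuclideanSpace.norm_sq_eq, Finset.mul_sum, Complex.ofReal_sum,
    ← Finset.sum_neg_distrib]
  refine Finset.sum_congr rfl fun j _ => ?_
  rw [twistCoord, tildeCoord, Real.norm_eq_abs, Real.norm_eq_abs, sq_abs, sq_abs]
  push_cast
  linear_combination ((p.2 : ℂ) ^ 2 * (tilde p.1 j : ℂ) ^ 2) * Complex.I_sq

/-- Expanding the squares: the cross terms give the transport −αz̃·∇_z, and Σ_j (iαz̃_j)² = −|αz̃|²
gives the potential. -/
theorem half_I_smul_sum_twistedFieldS (χ : 𝓢(Heis d, ℂ)) :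
    (Complex.I / 2) • ∑ j, twistedFieldS j (twistedFieldS j χ) =
      (Complex.I / 2) • planeLaplacianS χ + shearGeneratorS χ +
        SchwartzMap.smulLeftCLM ℂ
          (fun p : Heis d => -Complex.I * ((‖p.2 • tilde p.1‖ ^ 2 / 2 : ℝ) : ℂ)) χ := by
  have htw : ∀ j, twistedFieldS j (twistedFieldS j χ) =
      ∂_{((basisVec j, 0) : Heis d)} (∂_{((basisVec j, 0) : Heis d)} χ) +
        (2 : ℂ) • SchwartzMap.smulLeftCLM ℂ (twistCoord j) (∂_{((basisVec j, 0) : Heis d)} χ) +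
        SchwartzMap.smulLeftCLM ℂ (twistCoord j) (SchwartzMap.smulLeftCLM ℂ (twistCoord j) χ) := by
    intro j
    rw [twistedFieldS, twistedFieldS, lineDerivOp_add, lineDerivOp_smulLeftCLM_twistCoord,
      map_add, two_smul]
    abel
  have hq : Function.HasTemperateGrowth
      (fun p : Heis d => -Complex.I * ((‖p.2 • tilde p.1‖ ^ 2 / 2 : ℝ) : ℂ)) :=
    (Function.HasTemperateGrowth.const _).mul (Function.Complex.hasTemperateGrowth_ofReal.comp
      hasTemperateGrowth_half_norm_sq_smul_tilde)
  simp only [htw, Finset.sum_add_distrib]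
  rw [smul_add, smul_add]
  congr 1
  · congr 1
    rw [shearGeneratorS, ← Finset.smul_sum, smul_smul]
    congr 1
    ring
  · ext p
    rw [smul_apply, sum_apply, SchwartzMap.smulLeftCLM_apply_apply hq]
    simp only [SchwartzMap.smulLeftCLM_apply_apply (hasTemperateGrowth_twistCoord _), smul_eq_mul,
      ← mul_assoc, ← sq]
    rw [← Finset.sum_mul, sum_twistCoord_sq]
    push_cast
    ring

theorem horizontalFourierS_lineDerivOp (j : Fin d ⊕ Fin d) (χ : 𝓢(Heis d, ℂ)) (p : Heis d) :
    horizontalFourierS d (∂_{((basisVec j, 0) : Heis d)} χ) p =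
      Complex.I * (p.1 j : ℝ) * horizontalFourierS d χ p := by
  have hJ : ((basisVec j, 0) : Heis d) = (horizontalSplitting d).J (basisVec j) := rfl
  have h1 : ∀ (f : 𝓢(Heis d, ℂ)) (p : Heis d), horizontalFourierS d f p =
      (horizontalSplitting d).fourierConst (2 * Real.pi)⁻¹ *
        (horizontalSplitting d).fourier inv_two_pi_ne_zero f p := fun _ _ => rfl
  have h2 : (inner ℝ ((horizontalSplitting d).P p) (basisVec j) : ℝ) = p.1 j := by
    simp [horizontalSplitting, basisVec, EuclideanSpace.inner_single_right]
  have hpi : (Real.pi : ℂ) ≠ 0 := by simp [Real.pi_ne_zero]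
  rw [h1, hJ, Splitting.fourier_lineDerivOp_fiber, h2, h1]
  push_cast
  field_simp

theorem horizontalFourierS_planeLaplacianS (χ : 𝓢(Heis d, ℂ)) :
    (horizontalFourierS d).symm (SchwartzMap.smulLeftCLM ℂ
      (fun p : Heis d => -Complex.I * ((‖p.1‖ ^ 2 / 2 : ℝ) : ℂ)) (horizontalFourierS d χ)) =
      (Complex.I / 2) • planeLaplacianS χ := by
  have hq : Function.HasTemperateGrowth
      (fun p : Heis d => -Complex.I * ((‖p.1‖ ^ 2 / 2 : ℝ) : ℂ)) :=
    (Function.HasTemperateGrowth.const _).mul (Function.Complex.hasTemperateGrowth_ofReal.comp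
      hasTemperateGrowth_half_norm_sq_fst)
  rw [LinearEquiv.symm_apply_eq]
  ext p
  rw [map_smul, smul_apply, planeLaplacianS, map_sum, sum_apply,
    SchwartzMap.smulLeftCLM_apply_apply hq]
  simp only [horizontalFourierS_lineDerivOp, smul_eq_mul]
  have h1 : ∀ j : Fin d ⊕ Fin d, Complex.I * (p.1 j : ℝ) *
      (Complex.I * (p.1 j : ℝ) * horizontalFourierS d χ p) =
      -(((p.1 j) ^ 2 : ℝ) : ℂ) * horizontalFourierS d χ p := fun j => by
    push_cast
    linear_combination ((p.1 j : ℂ) ^ 2 * horizontalFourierS d χ p) * Complex.I_sq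
  simp only [h1]
  rw [← Finset.sum_mul, Finset.sum_neg_distrib, ← Complex.ofReal_sum, EuclideanSpace.norm_sq_eq]
  simp only [Real.norm_eq_abs, sq_abs]
  push_cast
  ring

/-- The derivatives of the three factors add up to the sub-Laplacian conjugated by F, and F⁻¹ is
continuous. -/
theorem tendsto_slope_fresnelOperator (ψ : 𝓢(Heis d, ℂ)) :
    Tendsto (fun h : ℝ => h⁻¹ • (fresnelOperator h (ψ.toLp 2 volume) - ψ.toLp 2 volume))
      (𝓝[>] 0) (𝓝 ((Complex.I / 2) • (subLaplacianS ψ).toLp 2 volume)) := by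
  set χ := centralFourierS d ψ with hχ
  have h₁ := tendsto_slope_freeEvolution χ
  rw [horizontalFourierS_planeLaplacianS] at h₁
  have hprod := tendsto_slope_product χ _ _ _ h₁
    (fun χ => tendsto_of_tendsto_slope
      (tendsto_slope_shear χ (shearGeneratorS χ) (shearGeneratorS_apply χ)))
    (tendsto_slope_shear χ (shearGeneratorS χ) (shearGeneratorS_apply χ))
    (tendsto_slope_phaseMul χ)
  rw [← half_I_smul_sum_twistedFieldS, hχ, ← centralFourierS_subLaplacianS, ← map_smul,
    ← centralFourier_toLp] at hprod
  have h2 := ((centralFourier d).symm.continuous.tendsto _).comp hprod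
  rw [centralFourier_symm_toLp, LinearEquiv.symm_apply_apply] at h2
  have h3 : ((Complex.I / 2) • subLaplacianS ψ).toLp 2 (volume : Measure (Heis d)) =
      (Complex.I / 2) • (subLaplacianS ψ).toLp 2 volume :=
    (SchwartzMap.toLpCLM ℂ ℂ 2 (volume : Measure (Heis d))).map_smul _ _
  rw [h3] at h2
  refine h2.congr fun h => ?_
  have h4 := map_real_smul (centralFourier d).symm (LinearIsometryEquiv.continuous _) h⁻¹
  rw [Function.comp_apply, h4, map_sub, LinearIsometryEquiv.symm_apply_apply]
  rfl

end Heis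

/-! ### Chernoff equivalence and the Schrödinger equation. -/

theorem IsGeneratorOf.tendsto_complex_slope {H : Type*} [NormedAddCommGroup H]
    [InnerProductSpace ℂ H] [CompleteSpace H] {A : H →ₗ.[ℂ] H} {U : ℝ → H →L[ℂ] H}
    (hAU : IsGeneratorOf A U) (hU : IsUnitaryGroup U) {f g : H} (h : (f, g) ∈ A.graph) (t : ℝ) :
    Tendsto (fun r : ℝ => ((r - t : ℝ)⁻¹ : ℂ) • (U r f - U t f)) (𝓝[≠] t) (𝓝 (U t g)) := by
  refine (hasDerivAt_iff_tendsto_slope.1 (hAU.hasDerivAt hU h t)).congr fun r => ?_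
  rw [slope_def_module, ← Complex.coe_smul, Complex.ofReal_inv]

/-- With h = t/n one has nh = t ≤ T, and h < δ for all such t as soon as n > T/δ. The case t = 0 is
separate because the hypothesis concerns h > 0 only. -/
theorem chernoffEquivalent_of_eventually {H : Type*} [NormedAddCommGroup H]
    [NormedSpace ℂ H] {S : ℝ → H →L[ℂ] H} {U : ℝ → H →L[ℂ] H}
    (hS0 : S 0 = 1) (hU0 : U 0 = 1)
    (hSU : ∀ (f : H) (T ε : ℝ), 0 < ε →
      ∀ᶠ h in 𝓝[>] (0 : ℝ), ∀ n : ℕ, n * h ≤ T → ‖(S h ^ n) f - U (n * h) f‖ < ε) :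
    ChernoffEquivalent (fun t : ℝ≥0 => S t) (fun t => U t) := by
  intro f T _
  rw [Metric.tendstoUniformlyOn_iff]
  intro ε hε
  obtain ⟨δ, hδ, hδ'⟩ := mem_nhdsGT_iff_exists_Ioo_subset.1 (hSU f T ε hε)
  have hδ0 : (0 : ℝ) < δ := hδ
  filter_upwards [eventually_gt_atTop ⌈(T : ℝ) / δ⌉₊] with n hn t ht
  have hn0 : (0 : ℝ) < n := Nat.cast_pos.2 (lt_of_le_of_lt (Nat.zero_le _) hn)
  rcases eq_or_ne t 0 with rfl | ht0
  · simp [hS0, hU0, hε]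
  · have htpos : (0 : ℝ) < t := NNReal.coe_pos.2 (pos_iff_ne_zero.2 ht0)
    have h1 : (T : ℝ) / δ < n := (Nat.le_ceil _).trans_lt (Nat.cast_lt.2 hn)
    have htT : (t : ℝ) ≤ T := ht.2
    have h2 : (t : ℝ) / n ∈ Set.Ioo 0 δ := by
      refine ⟨div_pos htpos hn0, ?_⟩
      rw [div_lt_iff₀ hδ0] at h1
      rw [div_lt_iff₀ hn0]
      linarith
    have h3 : (n : ℝ) * (t / n) = t := mul_div_cancel₀ _ hn0.ne'
    have h4 := hδ' h2 n (h3.trans_le htT)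
    rw [h3] at h4
    rw [dist_comm, dist_eq_norm, NNReal.coe_div, NNReal.coe_natCast]
    exact h4

theorem ChernoffEquivalent.tendsto {B : Type*} [NormedAddCommGroup B] [NormedSpace ℂ B]
    {S V : ℝ≥0 → B →L[ℂ] B} (h : ChernoffEquivalent S V) (t : ℝ≥0) (f : B) :
    Tendsto (fun n : ℕ => (S (t / n) ^ n) f) atTop (𝓝 (V t f)) :=
  (h f (t + 1) (by positivity)).tendsto_at ⟨zero_le, le_self_add⟩

namespace Heis

variable {d : ℕ}

/-- The generator `(i/2) L` on test functions, as a set of pairs. -/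
def testGraph (d : ℕ) : Set (HeisL2 d × HeisL2 d) :=
  Set.range fun f : testFunctions d =>
    (testToL2 d f, (Complex.I / 2) • testToL2 d (subLaplacian d f))

theorem half_I_ne_zero : (Complex.I / 2 : ℂ) ≠ 0 := by simp

/-- Test functions are a core: the graph of L is the closure of the minimal graph, and scaling the
second component is continuous. -/
theorem graph_subset_closure_testGraph :
    (((Complex.I / 2) • horizontalLaplacian d).graph : Set (HeisL2 d × HeisL2 d)) ⊆
      closure (testGraph d) := by
  rintro ⟨f, k⟩ hfk
  have hk : k = (Complex.I / 2) • ((Complex.I / 2)⁻¹ • k) := by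
    rw [smul_inv_smul₀ half_I_ne_zero]
  rw [hk] at hfk ⊢
  set g := (Complex.I / 2)⁻¹ • k
  have h1 : (f, g) ∈ closure ((minimalLaplacian d).graph : Set (HeisL2 d × HeisL2 d)) := by
    have h2 : (f, g) ∈ (horizontalLaplacian d).graph := (mem_smul_graph_iff half_I_ne_zero).1 hfk
    rw [horizontalLaplacian,
      ← (horizontalLaplacian_spec d).1.graph_closure_eq_closure_graph] at h2
    exact h2
  have hc : Continuous fun p : HeisL2 d × HeisL2 d => (p.1, (Complex.I / 2) • p.2) := by fun_prop
  refine map_mem_closure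
    (f := fun p : HeisL2 d × HeisL2 d => (p.1, (Complex.I / 2) • p.2)) hc h1 ?_
  rintro ⟨a, b⟩ hab
  obtain ⟨x, hx1, hx2⟩ := (LinearPMap.mem_graph_iff _).1 hab
  obtain ⟨u, hu1, hu2⟩ := minimalLaplacian_exists x
  exact ⟨u, Prod.ext (hu1.symm.trans hx1)
    (congrArg ((Complex.I / 2) • ·) (hu2.symm.trans hx2))⟩

theorem toLp_toSchwartzMap (f : testFunctions d) :
    (f.2.2.toSchwartzMap f.2.1).toLp 2 volume = testToL2 d f := rfl

theorem toLp_subLaplacianS (f : testFunctions d) :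
    (subLaplacianS (f.2.2.toSchwartzMap f.2.1)).toLp 2 volume =
      testToL2 d (subLaplacian d f) := by
  have h : subLaplacianS (f.2.2.toSchwartzMap f.2.1) =
      (subLaplacian d f).2.2.toSchwartzMap (subLaplacian d f).2.1 := by
    ext p
    exact subLaplacianS_apply _ p
  rw [h, toLp_toSchwartzMap]

theorem tendsto_slope_testGraph (p : HeisL2 d × HeisL2 d) (hp : p ∈ testGraph d) :
    Tendsto (fun h : ℝ => h⁻¹ • (fresnelOperator h p.1 - p.1)) (𝓝[>] 0) (𝓝 p.2) := by
  obtain ⟨f, rfl⟩ := hp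
  have := tendsto_slope_fresnelOperator (f.2.2.toSchwartzMap f.2.1)
  rwa [toLp_subLaplacianS, toLp_toSchwartzMap] at this

theorem chernoffEquivalent_fresnelOperator {U : ℝ → HeisL2 d →L[ℂ] HeisL2 d}
    (hU : IsUnitaryGroup U)
    (hAU : IsGeneratorOf ((Complex.I / 2) • horizontalLaplacian d) U) :
    ChernoffEquivalent (fun τ : ℝ≥0 => fresnelOperator (d := d) (τ : ℝ)) (fun t => U t) :=
  chernoffEquivalent_of_eventually fresnelOperator_zero hU.map_zero fun f T _ hε =>
    chernoff (horizontalLaplacian_spec d).2.isSkewAdjointPMap hU hAU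
      (fun h _ => norm_fresnelOperator_le h) graph_subset_closure_testGraph
      (fun p hp => (tendsto_slope_testGraph p hp).congr fun h => by
        rw [RCLike.real_smul_eq_coe_smul (K := ℂ)]
        exact Complex.coe_smul _ _) f T hε

theorem exists_schrodinger_evolution {U : ℝ → HeisL2 d →L[ℂ] HeisL2 d}
    (hU : IsUnitaryGroup U)
    (hAU : IsGeneratorOf ((Complex.I / 2) • horizontalLaplacian d) U)
    {ψ : HeisL2 d} (hψ : ψ ∈ (horizontalLaplacian d).domain) :
    ∃ χ : ℝ → HeisL2 d, Continuous χ ∧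
      ∀ t : ℝ, (U t ψ, χ t) ∈ (horizontalLaplacian d).graph ∧
        HasDerivAt (fun r => U r ψ) ((Complex.I / 2) • χ t) t := by
  have h1 : (ψ, horizontalLaplacian d ⟨ψ, hψ⟩) ∈ (horizontalLaplacian d).graph :=
    (horizontalLaplacian d).mem_graph ⟨ψ, hψ⟩
  have h2 := (mem_smul_graph_iff half_I_ne_zero).2 h1
  -- U commutes with L on the domain, so Lu(t) = U(t)Lψ, which is continuous in t.
  refine ⟨fun t => U t (horizontalLaplacian d ⟨ψ, hψ⟩), hU.continuous _, fun t => ⟨?_, ?_⟩⟩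
  · have h3 := hAU.mem_graph hU h2 t
    rw [map_smul] at h3
    exact (mem_smul_graph_iff half_I_ne_zero).1 h3
  · have h3 := hAU.tendsto_complex_slope hU h2 t
    rw [map_smul] at h3
    refine hasDerivAt_iff_tendsto_slope.2 (h3.congr fun r => ?_)
    rw [slope_def_module, RCLike.real_smul_eq_coe_smul (K := ℂ)]
    simp

end Heis

end

theorem mainTheorem3 (d : ℕ) :
    -- the horizontal Laplacian is self-adjoint and `(i/2) L` generates a unique unitary group
    IsSelfAdjoint (Heis.horizontalLaplacian d) ∧
    (∃! U : ℝ → HeisL2 d →L[ℂ] HeisL2 d,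
      IsUnitaryGroup U ∧
        IsGeneratorOf ((Complex.I / 2) • Heis.horizontalLaplacian d) U) ∧
    -- the Fresnel averages of Schwartz functions exist at every point ...
    (∀ (τ : ℝ≥0) (ψ : 𝓢(Heis d, ℂ)) (p : Heis d), ∃! w : ℂ, Heis.HasFresnelAverage τ ψ p w) ∧
    -- ... and extend uniquely to bounded operators on `L²(ℍ^d)`
    (∃! S : ℝ≥0 → HeisL2 d →L[ℂ] HeisL2 d, Heis.ExtendsFresnelAverage S) ∧
    ∀ S : ℝ≥0 → HeisL2 d →L[ℂ] HeisL2 d, Heis.ExtendsFresnelAverage S →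
      -- contractions
      (∀ τ, ‖S τ‖ ≤ 1) ∧
      -- factorization `S τ = F⁻¹ U₂(τ) V(τ) U₁(τ) F`
      (∃ (F : HeisL2 d ≃ₗᵢ[ℂ] HeisL2 d) (U₁ U₂ : ℝ≥0 → HeisL2 d ≃ₗᵢ[ℂ] HeisL2 d)
          (V : ℝ≥0 → HeisL2 d →L[ℂ] HeisL2 d),
        Heis.IsCentralFourier F ∧ (∀ τ, Heis.IsFourierMultiplier τ (U₁ τ)) ∧
        (∀ τ, Heis.IsShear τ (V τ)) ∧ (∀ τ, ‖V τ‖ ≤ 1) ∧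
        (∀ τ, Heis.IsPhaseMultiplication τ (U₂ τ)) ∧
        ∀ τ ψ, S τ ψ = F.symm (U₂ τ (V τ (U₁ τ (F ψ))))) ∧
      ∀ U : ℝ → HeisL2 d →L[ℂ] HeisL2 d, IsUnitaryGroup U →
        IsGeneratorOf ((Complex.I / 2) • Heis.horizontalLaplacian d) U →
        ChernoffEquivalent S (fun t => U t) ∧
        (∀ (t : ℝ≥0) (ψ : HeisL2 d),
          Tendsto (fun n : ℕ => (S (t / n) ^ n) ψ) atTop (𝓝 (U t ψ))) ∧
        -- `U t ψ` is the free Schrödinger evolution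
        ∀ ψ ∈ (Heis.horizontalLaplacian d).domain, ∃ χ : ℝ → HeisL2 d, Continuous χ ∧
          ∀ t : ℝ, (U t ψ, χ t) ∈ (Heis.horizontalLaplacian d).graph ∧
            HasDerivAt (fun r => U r ψ) ((Complex.I / 2) • χ t) t := by
  refine ⟨(Heis.horizontalLaplacian_spec d).2,
    (Heis.horizontalLaplacian_spec d).2.isSkewAdjointPMap.existsUnique_group,
    Heis.existsUnique_fresnelAverage, Heis.existsUnique_extendsFresnelAverage, fun S hS => ?_⟩
  -- Any extension of the averages is the explicit product, so the remaining claims concern that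
  -- operator alone.
  obtain rfl := hS.unique Heis.extendsFresnelAverage_fresnelOperator
  refine ⟨fun τ => Heis.norm_fresnelOperator_le τ,
    ⟨Heis.centralFourier d, fun τ => Heis.freeEvolution τ, fun τ => Heis.phaseMul τ,
      fun τ => Heis.shear τ, Heis.isCentralFourier, Heis.isFourierMultiplier, Heis.isShear,
      fun τ => Heis.norm_shear_le τ, Heis.isPhaseMultiplication,
      fun τ ψ => Heis.fresnelOperator_apply τ ψ⟩, fun U hU hAU => ?_⟩
  have hC := Heis.chernoffEquivalent_fresnelOperator hU hAU
  exact ⟨hC, hC.tendsto, fun ψ hψ => Heis.exists_schrodinger_evolution hU hAU hψ⟩
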